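/- **Symmetry classification of the extended YdKN (EYdKN) equation.** For real constants, not all zero, collected in $$K=\begin{pmatrix}\alpha&\beta&\gamma\\ \hat\beta&\lambda&\delta\\ \hat\gamma&\hat\delta&\omega\end{pmatrix},$$ consider the differential-difference equation $$\dot u_n=\frac{P(u_n)u_{n+1}u_{n-1}+Q(u_n)(u_{n+1}+u_{n-1})+R(u_n)}{u_{n+1}-u_{n-1}},\qquad n\in\mathbb Z,$$ $$P(u)=\alpha u^2+2\beta u+\gamma,\quad Q(u)=\hat\beta u^2+\lambda u+\delta,\quad R(u)=\hat\gamma u^2+2\hat\delta u+\omega .$$ It is called integrable (of YdKN type) if $\hat\beta=\beta$, $\hat\gamma=\gamma$, $\hat\delta=\delta$. Let $I,J\subseteq\mathbb R$ be non-empty open intervals, and let $L$ be the set of Lie point symmetries of the equation on $t\in I$, $u_n\in J$, i.e. of the smooth vector fields $\tau_n(t,u_n)\partial_t+\phi_n(t,u_n)\partial_{u_n}$ whose prolongation annihilates the equation on its solution set. Two equations are equivalent if one is taken into the other by a real Möbius transformation $\tilde u_n=(\eta_1u_n+\eta_2)/(\eta_3u_n+\eta_4)$, $\eta_1\eta_4-\eta_2\eta_3=\pm1$,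 combined with a rescaling of time by a nonzero real factor. (A) $L$ is a Lie algebra, $1\le\dim L\le5$, and $\dim L\ge4$ occurs only for integrable equations. (B) $\dim L=5$, $4$, $3$ or $2$ if and only if the equation is equivalent to one of those listed below under that dimension, and for the listed equations the given vector fields form a basis of $L$ (for $\dim L=2$, the basis is $\partial_t$ and the given $X$). *$\dim L=5$.* $\dot u_n=\dfrac{u_n^2u_{n+1}u_{n-1}}{u_{n+1}-u_{n-1}}$; $X_0=\partial_t$, $X_1=2t\partial_t-u_n\partial_{u_n}$, $X_2=(-1)^nu_n\partial_{u_n}$, $X_3=u_n^2\partial_{u_n}$, $X_4=(-1)^nu_n^2\partial_{u_n}$. $L$ is solvable, its nilradical is Abelian and spanned by $X_0,X_3,X_4$; $X_1$ and $X_2$ commute and act on the nilradical diagonally in a common basis. *$\dim L=4$.* Two cases, in both $L\cong gl(2,\mathbb R)$. 1. $\dot u_n=\dfrac{u_n^2u_{n+1}u_{n-1}+\lambda u_n(u_{n+1}+u_{n-1})+\lambda^2}{u_{n+1}-u_{n-1}}$, $\lambda=\pm1$; $\partial_t$, $(-1)^nu_n\partial_{u_n}$, $(-1)^n(u_n^2-\lambda)\partial_{u_n}$,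 $(u_n^2+\lambda)\partial_{u_n}$. 2. $\dot u_n=\dfrac{u_{n+1}u_{n-1}-u_n(u_{n+1}+u_{n-1})+u_n^2}{u_{n+1}-u_{n-1}}$; $\partial_t$, $\partial_{u_n}$, $u_n\partial_{u_n}$, $u_n^2\partial_{u_n}$. *$\dim L=3$.* Three cases. 1. $\dot u_n=\dfrac{(u_n^2+\gamma)(u_{n+1}u_{n-1}+\gamma)}{u_{n+1}-u_{n-1}}$, $\gamma=\pm1$; $\partial_t$, $(-1)^n(u_n^2+\gamma)\partial_{u_n}$, $(u_n^2+\gamma)\partial_{u_n}$. $L$ is Abelian. 2. $\dot u_n=\dfrac{(u_n-\mu)[(u_n+\mu)u_{n+1}u_{n-1}-2\mu^2(u_{n+1}+u_{n-1})-\mu^2(u_n-3\mu)]}{u_{n+1}-u_{n-1}}$, $\mu\ne0$; $X_0=\partial_t$, $X_1=(-1)^n(u_n-\mu)^2\partial_{u_n}$, $X_2=t\partial_t-\frac1{4\mu}(u_n+3\mu)(u_n-\mu)\partial_{u_n}$. $L$ is solvable with Abelian nilradical spanned by $X_0,X_1$. 3. $\dot u_n=\dfrac{2u_nu_{n+1}u_{n-1}-u_n^2(u_{n+1}+u_{n-1})}{u_{n+1}-u_{n-1}}$;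 $X_0=\partial_t$, $X_1=t\partial_t-u_n\partial_{u_n}$, $X_2=u_n^2\partial_{u_n}$. $L$ is solvable with Abelian nilradical spanned by $X_0,X_2$. *$\dim L=2$.* Eight families. 1. $K=\begin{pmatrix}1&0&\gamma\\ \hat\beta&\lambda&0\\ \gamma+\hat\beta^2&\hat\beta(\lambda+\gamma)&(\lambda+\gamma)^2\end{pmatrix}$, $\gamma\ne0$, $(\hat\beta,\lambda)\ne(0,0)$; $X=[\lambda+\gamma+\hat\beta u_n+u_n^2]\partial_{u_n}$. 2. $K=\begin{pmatrix}1&0&\gamma\\ \hat\beta&\lambda&\delta\\ \hat\gamma&\hat\delta&\omega\end{pmatrix}$ with $\gamma<0$, $\delta\ne0$, $\hat\beta\neq0$, $\epsilon=\pm1$, $\hat\beta=2\epsilon\sqrt{-\gamma}-\frac\delta\gamma$, $\hat\gamma=-3\gamma+\frac{2\epsilon\delta}{\sqrt{-\gamma}}$, $\hat\delta=2(\delta+\epsilon(-\gamma)^{3/2})$, $\lambda=\gamma+\hat\gamma$, $\omega=\gamma^2+2\epsilon\sqrt{-\gamma}\,\delta$; $X=t\partial_t+\left[(\lambda+\gamma)\frac{\gamma}{2\delta}+\frac12\left(\hat\beta\frac\gamma\delta-1\right)u_n+\frac{\gamma}{2\delta}u_n^2\right]\partial_{u_n}$.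 3. $K=\begin{pmatrix}1&0&0\\ \hat\beta&\lambda&0\\ \hat\beta^2&\hat\beta\lambda&\lambda^2\end{pmatrix}$, $\hat\beta\ne0$, $\lambda\ne\hat\beta^2$; $X=[\lambda+\hat\beta u_n+u_n^2]\partial_{u_n}$. 4. $K=\begin{pmatrix}1&0&0\\ \hat\beta&0&0\\ 0&0&0\end{pmatrix}$, $\hat\beta\ne0$; $X=t\partial_t-\left[u_n+\frac1{2\hat\beta}u_n^2\right]\partial_{u_n}$. 5. $K=\begin{pmatrix}1&0&0\\ \hat\beta&\hat\beta^2&0\\ \hat\beta^2&\hat\beta^3&\hat\beta^4\end{pmatrix}$, $\hat\beta\ne0$; $X=[\hat\beta^2+\hat\beta u_n+u_n^2]\partial_{u_n}$. 6. $K=\begin{pmatrix}0&1&0\\ -1&\lambda&\delta\\ -2\lambda&-\delta&0\end{pmatrix}$, $(\lambda,\delta)\ne(0,0)$; $X=[\delta+\lambda u_n+u_n^2]\partial_{u_n}$. 7. $K=\begin{pmatrix}1&0&\gamma\\ 0&\lambda&\delta\\ \gamma&\delta&(\lambda-\gamma)^2+\frac{\delta^2}\gamma\end{pmatrix}$, $\gamma\ne0$,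 $(2\lambda\gamma^2+\delta^2,\ \delta[2\gamma-\lambda],\ \delta[2\gamma^3+\lambda^2\gamma-\lambda\gamma^2+\delta^2])\ne(0,0,0)$; $X=(-1)^n\left[\gamma-\lambda+\frac\delta\gamma u_n+u_n^2\right]\partial_{u_n}$. 8. $K=\begin{pmatrix}1&0&0\\ 0&\lambda&0\\ 0&0&\omega\end{pmatrix}$, $\omega\ne\lambda^2$; $X=(-1)^nu_n\partial_{u_n}$. -/

import Mathlib

open Set Polynomial TopologicalSpace
open scoped ContDiff Matrix

noncomputable section

namespace EYdKN

/-! ### The equation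

The nine constants are collected in the matrix
`K = !![α, β, γ; β', l, δ; γ', δ', ω]` (a prime stands for a hat, `l` for `λ`). -/

/-- `P(u) = α u² + 2 β u + γ`. -/
def P (K : Matrix (Fin 3) (Fin 3) ℝ) (u : ℝ) : ℝ := K 0 0 * u ^ 2 + 2 * K 0 1 * u + K 0 2

/-- `Q(u) = β' u² + l u + δ`. -/
def Q (K : Matrix (Fin 3) (Fin 3) ℝ) (u : ℝ) : ℝ := K 1 0 * u ^ 2 + K 1 1 * u + K 1 2

/-- `R(u) = γ' u² + 2 δ' u + ω`. -/
def R (K : Matrix (Fin 3) (Fin 3) ℝ) (u : ℝ) : ℝ := K 2 0 * u ^ 2 + 2 * K 2 1 * u + K 2 2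

/-- The right-hand side of the equation, at `u_{n-1} = x`, `u_n = y`, `u_{n+1} = z`. -/
def rhs (K : Matrix (Fin 3) (Fin 3) ℝ) (x y z : ℝ) : ℝ :=
  (P K y * (z * x) + Q K y * (z + x) + R K y) / (z - x)

/-- The equation is `du_n/dt = flow K u n`. -/
def flow (K : Matrix (Fin 3) (Fin 3) ℝ) (u : ℤ → ℝ) (n : ℤ) : ℝ :=
  rhs K (u (n - 1)) (u n) (u (n + 1))

/-- The integrable subclass (the YdKN equation): `β' = β`, `γ' = γ`, `δ' = δ`. -/
def IsYdKN (K : Matrix (Fin 3) (Fin 3) ℝ) : Prop :=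
  K 1 0 = K 0 1 ∧ K 2 0 = K 0 2 ∧ K 2 1 = K 1 2

/-- Allowed transformations: a Möbius transformation `ũ = (η₁ u + η₂) / (η₃ u + η₄)` with
`η₁ η₄ - η₂ η₃ = ± 1` together with a dilation of time `t = c t̃`, `c ≠ 0`, takes the equation
with constants `K` into the equation with constants `K'`. The factor `Δ / (η₃ y + η₄)²` is
the derivative of the Möbius transformation, so that the displayed identity is the chain rule
`dũ_n/dt̃ = c (dũ_n/du_n) (du_n/dt)`. -/
def Equivalent (K K' : Matrix (Fin 3) (Fin 3) ℝ) : Prop :=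
  ∃ η₁ η₂ η₃ η₄ c : ℝ,
    (η₁ * η₄ - η₂ * η₃ = 1 ∨ η₁ * η₄ - η₂ * η₃ = -1) ∧ c ≠ 0 ∧
    ∀ x y z : ℝ, z ≠ x → η₃ * x + η₄ ≠ 0 → η₃ * y + η₄ ≠ 0 → η₃ * z + η₄ ≠ 0 →
      rhs K' ((η₁ * x + η₂) / (η₃ * x + η₄)) ((η₁ * y + η₂) / (η₃ * y + η₄))
          ((η₁ * z + η₂) / (η₃ * z + η₄)) =
        c * ((η₁ * η₄ - η₂ * η₃) / (η₃ * y + η₄) ^ 2) * rhs K x y z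

/-! ### Point vector fields and their Lie bracket -/

/-- Smooth point vector fields `τ_n(t, u_n) ∂_t + φ_n(t, u_n) ∂_{u_n}`, `n ∈ ℤ`, on the domain
`t ∈ I`, `u_n ∈ J`: `V n (t, u) = (τ_n(t, u), φ_n(t, u))`. They are extended by zero outside
of `I × J`, so that two of them are equal iff they agree on the domain. -/
def PointField (I J : Opens ℝ) : Submodule ℝ (ℤ → ℝ × ℝ → ℝ × ℝ) where
  carrier := {V | ∀ n, ContDiffOn ℝ ∞ (V n) ((I : Set ℝ) ×ˢ (J : Set ℝ)) ∧
    ∀ p, p ∉ (I : Set ℝ) ×ˢ (J : Set ℝ) → V n p = 0}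
  add_mem' {V W} hV hW n := ⟨(hV n).1.add (hW n).1, fun p hp => by
    simp [(hV n).2 p hp, (hW n).2 p hp]⟩
  zero_mem' n := ⟨contDiffOn_const, fun _ _ => rfl⟩
  smul_mem' c V hV n := ⟨(hV n).1.const_smul c, fun p hp => by simp [(hV n).2 p hp]⟩

variable {I J : Opens ℝ}

theorem isOpen_dom (I J : Opens ℝ) : IsOpen ((I : Set ℝ) ×ˢ (J : Set ℝ)) :=
  I.isOpen.prod J.isOpen

theorem field_contDiffAt (V : PointField I J) (n : ℤ) {p : ℝ × ℝ}
    (hp : p ∈ (I : Set ℝ) ×ˢ (J : Set ℝ)) : ContDiffAt ℝ ∞ (V.1 n) p :=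
  (V.2 n).1.contDiffAt ((isOpen_dom I J).mem_nhds hp)

theorem field_differentiableAt (V : PointField I J) (n : ℤ) {p : ℝ × ℝ}
    (hp : p ∈ (I : Set ℝ) ×ˢ (J : Set ℝ)) : DifferentiableAt ℝ (V.1 n) p :=
  (field_contDiffAt V n hp).differentiableAt (by simp)

theorem field_eq_zero (V : PointField I J) (n : ℤ) {p : ℝ × ℝ}
    (hp : p ∉ (I : Set ℝ) ×ˢ (J : Set ℝ)) : V.1 n p = 0 := (V.2 n).2 p hp

theorem field_ext {V W : PointField I J}
    (h : ∀ n, ∀ p ∈ (I : Set ℝ) ×ˢ (J : Set ℝ), V.1 n p = W.1 n p) : V = W := by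
  refine Subtype.ext (funext fun n => funext fun p => ?_)
  by_cases hp : p ∈ (I : Set ℝ) ×ˢ (J : Set ℝ)
  · exact h n p hp
  · rw [field_eq_zero V n hp, field_eq_zero W n hp]

/-- The commutator of vector fields, for each `n`. -/
instance : Bracket (PointField I J) (PointField I J) where
  bracket V W := ⟨fun n => VectorField.lieBracket ℝ (V.1 n) (W.1 n), fun n =>
    ⟨fun p hp => (ContDiffAt.lieBracket_vectorField (m := ∞) (n := ∞) (field_contDiffAt V n hp)
        (field_contDiffAt W n hp) (by simp)).contDiffWithinAt,
      fun p hp => by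
        simp [VectorField.lieBracket, field_eq_zero V n hp, field_eq_zero W n hp]⟩⟩

theorem lie_apply (V W : PointField I J) (n : ℤ) :
    (⁅V, W⁆ : PointField I J).1 n = VectorField.lieBracket ℝ (V.1 n) (W.1 n) := rfl

instance : LieRing (PointField I J) where
  add_lie U V W := field_ext fun n p hp =>
    VectorField.lieBracket_add_left (field_differentiableAt U n hp)
      (field_differentiableAt V n hp)
  lie_add U V W := field_ext fun n p hp =>
    VectorField.lieBracket_add_right (field_differentiableAt V n hp)
      (field_differentiableAt W n hp)
  lie_self U := field_ext fun n p _ => by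
    rw [lie_apply]
    simp [VectorField.lieBracket]
  leibniz_lie U V W := field_ext fun n p hp =>
    VectorField.leibniz_identity_lieBracket (n := ∞) (by simp; exact WithTop.coe_le_coe.2 le_top)
      (field_contDiffAt U n hp) (field_contDiffAt V n hp) (field_contDiffAt W n hp)

instance : LieAlgebra ℝ (PointField I J) where
  lie_smul _ _ W := field_ext fun n _ hp =>
    VectorField.lieBracket_const_smul_right (field_differentiableAt W n hp)

theorem contDiff_eval (q : ℝ[X]) : ContDiff ℝ ∞ (fun x : ℝ => q.eval x) := by
  simpa [Polynomial.aeval_def] using Polynomial.contDiff_aeval (𝕜 := ℝ) q ∞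

open Classical in
/-- The vector field `τ(t) ∂_t + (φ(u_n) + (-1)^n ψ(u_n)) ∂_{u_n}` with polynomials `τ, φ, ψ`. -/
def vf (I J : Opens ℝ) (τ φ ψ : ℝ[X]) : PointField I J :=
  ⟨fun n p => if p ∈ (I : Set ℝ) ×ˢ (J : Set ℝ) then
      (τ.eval p.1, φ.eval p.2 + (-1) ^ n * ψ.eval p.2) else 0, fun n => by
    refine ⟨?_, fun p hp => if_neg hp⟩
    have h : ContDiffOn ℝ ∞
        (fun p : ℝ × ℝ => (τ.eval p.1, φ.eval p.2 + (-1) ^ n * ψ.eval p.2))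
        ((I : Set ℝ) ×ˢ (J : Set ℝ)) := by
      refine ContDiff.contDiffOn (ContDiff.prodMk ((contDiff_eval τ).comp contDiff_fst)
        (((contDiff_eval φ).comp contDiff_snd).add
          (contDiff_const.mul ((contDiff_eval ψ).comp contDiff_snd))))
    exact h.congr fun p hp => if_pos hp⟩

/-! ### Lie point symmetries -/

/-- The characteristic `φ_n - τ_n du_n/dt` of a point vector field on solutions. -/
def characteristic (K : Matrix (Fin 3) (Fin 3) ℝ) (V : PointField I J) (t : ℝ) (u : ℤ → ℝ)
    (n : ℤ) : ℝ :=
  (V.1 n (t, u n)).2 - (V.1 n (t, u n)).1 * flow K u n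

/-- `V` is a Lie point symmetry (on `t ∈ I`, `u_n ∈ J`): its prolongation annihilates the
equation on the solution set. In evolutionary form, the total time derivative of the
characteristic, taken along the equation, equals the linearization of the right-hand side
applied to the characteristic, at all `t` and all `(u_k)` where the equation makes sense. -/
def IsSymmetry (K : Matrix (Fin 3) (Fin 3) ℝ) (V : PointField I J) : Prop :=
  ∀ t ∈ I, ∀ u : ℤ → ℝ, (∀ k, u k ∈ J) → (∀ k, u (k + 1) ≠ u (k - 1)) → ∀ n : ℤ,
    deriv (fun s : ℝ => characteristic K V (t + s) (u + s • flow K u) n) 0 =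
      deriv (fun s : ℝ => flow K (u + s • characteristic K V t u) n) 0

/-- The Lie point symmetry algebra: the Lie algebra generated by the Lie point symmetries.
(That every element of it is a symmetry is a part of the theorem.) -/
def symmetryAlgebra (I J : Opens ℝ) (K : Matrix (Fin 3) (Fin 3) ℝ) :
    LieSubalgebra ℝ (PointField I J) :=
  LieSubalgebra.lieSpan ℝ (PointField I J) {V | IsSymmetry K V}

/-- The vectors `e 0, …, e (d - 1)` form a basis of `L`. -/
def IsBasisOf {d : ℕ} (e : Fin d → PointField I J) (L : LieSubalgebra ℝ (PointField I J)) :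
    Prop :=
  LinearIndependent ℝ e ∧ Submodule.span ℝ (range e) = L.toSubmodule

/-- `V` and `W` act on the space `S` diagonally (in one and the same basis of `S`). -/
def ActDiagonally (V W : PointField I J) (S : Submodule ℝ (PointField I J)) : Prop :=
  ∃ (d : ℕ) (e : Fin d → PointField I J), LinearIndependent ℝ e ∧
    Submodule.span ℝ (range e) = S ∧
    ∀ i, (∃ s : ℝ, ⁅V, e i⁆ = s • e i) ∧ ∃ s : ℝ, ⁅W, e i⁆ = s • e i

/-- `L` is solvable, and its nilradical (largest nilpotent ideal) is Abelian and has the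
underlying space `S`. -/
def IsSolvableWithAbelianNilradical (L : LieSubalgebra ℝ (PointField I J))
    (S : Submodule ℝ (PointField I J)) : Prop :=
  LieAlgebra.IsSolvable L ∧
    ∃ N : LieIdeal ℝ L, IsGreatest {M : LieIdeal ℝ L | LieRing.IsNilpotent M} N ∧
      IsLieAbelian N ∧ N.toSubmodule.map L.toSubmodule.subtype = S

attribute [local instance] LieRing.ofAssociativeRing in
/-- `L` is isomorphic to `gl(2, ℝ)`: the `2 × 2` matrices with the commutator. -/
def IsGL2 (L : LieSubalgebra ℝ (PointField I J)) : Prop :=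
  Nonempty (L ≃ₗ⁅ℝ⁆ Matrix (Fin 2) (Fin 2) ℝ)

/-! ### The equations and vector fields of the classification -/

/-- `du_n/dt = u_n² u_{n+1} u_{n-1} / (u_{n+1} - u_{n-1})`. -/
def K5 : Matrix (Fin 3) (Fin 3) ℝ := !![1, 0, 0; 0, 0, 0; 0, 0, 0]

def basis5 (I J : Opens ℝ) : Fin 5 → PointField I J :=
  ![vf I J 1 0 0, vf I J (2 * X) (-X) 0, vf I J 0 0 X, vf I J 0 (X ^ 2) 0, vf I J 0 0 (X ^ 2)]

/-- `du_n/dt = (u_n² u_{n+1} u_{n-1} + l u_n (u_{n+1} + u_{n-1}) + l²) / (u_{n+1} - u_{n-1})`. -/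
def K4a (l : ℝ) : Matrix (Fin 3) (Fin 3) ℝ := !![1, 0, 0; 0, l, 0; 0, 0, l ^ 2]

def basis4a (I J : Opens ℝ) (l : ℝ) : Fin 4 → PointField I J :=
  ![vf I J 1 0 0, vf I J 0 0 X, vf I J 0 0 (X ^ 2 - C l), vf I J 0 (X ^ 2 + C l) 0]

/-- `du_n/dt = (u_{n+1} u_{n-1} - u_n (u_{n+1} + u_{n-1}) + u_n²) / (u_{n+1} - u_{n-1})`. -/
def K4b : Matrix (Fin 3) (Fin 3) ℝ := !![0, 0, 1; 0, -1, 0; 1, 0, 0]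

def basis4b (I J : Opens ℝ) : Fin 4 → PointField I J :=
  ![vf I J 1 0 0, vf I J 0 1 0, vf I J 0 X 0, vf I J 0 (X ^ 2) 0]

/-- `du_n/dt = (u_n² + γ) (u_{n+1} u_{n-1} + γ) / (u_{n+1} - u_{n-1})`. -/
def K3a (γ : ℝ) : Matrix (Fin 3) (Fin 3) ℝ := !![1, 0, γ; 0, 0, 0; γ, 0, γ ^ 2]

def basis3a (I J : Opens ℝ) (γ : ℝ) : Fin 3 → PointField I J :=
  ![vf I J 1 0 0, vf I J 0 0 (X ^ 2 + C γ), vf I J 0 (X ^ 2 + C γ) 0]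

/-- `du_n/dt = (u_n - μ) [(u_n + μ) u_{n+1} u_{n-1} - 2 μ² (u_{n+1} + u_{n-1}) - μ² (u_n - 3 μ)]
/ (u_{n+1} - u_{n-1})`. -/
def K3b (μ : ℝ) : Matrix (Fin 3) (Fin 3) ℝ :=
  !![1, 0, -μ ^ 2; 0, -2 * μ ^ 2, 2 * μ ^ 3; -μ ^ 2, 2 * μ ^ 3, -3 * μ ^ 4]

def basis3b (I J : Opens ℝ) (μ : ℝ) : Fin 3 → PointField I J :=
  ![vf I J 1 0 0, vf I J 0 0 ((X - C μ) ^ 2),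
    vf I J X (-C (1 / (4 * μ)) * (X + C (3 * μ)) * (X - C μ)) 0]

/-- `du_n/dt = (2 u_n u_{n+1} u_{n-1} - u_n² (u_{n+1} + u_{n-1})) / (u_{n+1} - u_{n-1})`. -/
def K3c : Matrix (Fin 3) (Fin 3) ℝ := !![0, 1, 0; -1, 0, 0; 0, 0, 0]

def basis3c (I J : Opens ℝ) : Fin 3 → PointField I J :=
  ![vf I J 1 0 0, vf I J X (-X) 0, vf I J 0 (X ^ 2) 0]

/-- The families with a two-dimensional symmetry algebra. `DimTwo K τ φ ψ` says that `K` is a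
member of one of them and that the symmetry that the list gives besides `∂_t` is
`τ(t) ∂_t + (φ(u_n) + (-1)^n ψ(u_n)) ∂_{u_n}`. -/
inductive DimTwo : Matrix (Fin 3) (Fin 3) ℝ → ℝ[X] → ℝ[X] → ℝ[X] → Prop
  | family1 (β' γ l : ℝ) (hγ : γ ≠ 0) (h : (β', l) ≠ (0, 0)) :
      DimTwo !![1, 0, γ; β', l, 0; γ + β' ^ 2, β' * (l + γ), (l + γ) ^ 2]
        0 (C (l + γ) + C β' * X + X ^ 2) 0
  | family2 (ε γ δ β' γ' δ' l w : ℝ) (hε : ε = 1 ∨ ε = -1) (hγ : γ < 0)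
      (eβ' : β' = 2 * ε * √(-γ) - δ / γ) (eγ' : γ' = -3 * γ + 2 * ε * (δ / √(-γ)))
      (eδ' : δ' = 2 * (δ + ε * √(-γ) ^ 3)) (el : l = γ + γ')
      (ew : w = γ ^ 2 + 2 * ε * √(-γ) * δ) (hβ' : β' ≠ 0) (hδ : δ ≠ 0) :
      DimTwo !![1, 0, γ; β', l, δ; γ', δ', w]
        X (C ((l + γ) * (γ / (2 * δ))) + C (1 / 2 * (β' * (γ / δ) - 1)) * X
            + C (γ / (2 * δ)) * X ^ 2) 0
  | family3 (β' l : ℝ) (hβ' : β' ≠ 0) (hl : l ≠ β' ^ 2) :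
      DimTwo !![1, 0, 0; β', l, 0; β' ^ 2, β' * l, l ^ 2]
        0 (C l + C β' * X + X ^ 2) 0
  | family4 (β' : ℝ) (hβ' : β' ≠ 0) :
      DimTwo !![1, 0, 0; β', 0, 0; 0, 0, 0]
        X (-(X + C (1 / (2 * β')) * X ^ 2)) 0
  | family5 (β' : ℝ) (hβ' : β' ≠ 0) :
      DimTwo !![1, 0, 0; β', β' ^ 2, 0; β' ^ 2, β' ^ 3, β' ^ 4]
        0 (C (β' ^ 2) + C β' * X + X ^ 2) 0
  | family6 (l δ : ℝ) (h : (l, δ) ≠ (0, 0)) :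
      DimTwo !![0, 1, 0; -1, l, δ; -2 * l, -δ, 0]
        0 (C δ + C l * X + X ^ 2) 0
  | family7 (γ l δ : ℝ) (hγ : γ ≠ 0)
      (h : (2 * l * γ ^ 2 + δ ^ 2, δ * (2 * γ - l),
        δ * (2 * γ ^ 3 + l ^ 2 * γ - l * γ ^ 2 + δ ^ 2)) ≠ (0, 0, 0)) :
      DimTwo !![1, 0, γ; 0, l, δ; γ, δ, (l - γ) ^ 2 + δ ^ 2 / γ]
        0 0 (C (γ - l) + C (δ / γ) * X + X ^ 2)
  | family8 (l w : ℝ) (hw : w ≠ l ^ 2) :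
      DimTwo !![1, 0, 0; 0, l, 0; 0, 0, w] 0 0 X

end EYdKN

end

/-!
The equation is governed by the biquadratic polynomial `N(x, y) = P(y) x² + 2 Q(y) x + R(y)`: the
numerator of the right-hand side at `(x, y, z)` is the polarization of `N(·, y)` at `x, z`. Its
`3 × 3` matrix `form K` determines `K`, Möbius transformations act on it by congruence with their
symmetric square (`equivalent_iff`), and the equation is of YdKN type iff the matrix is symmetric.

**Symmetries are quadratic vector fields.** In the symmetry condition the variable `u_{n+2}`
enters only through `τ_{n+1} - τ_n`, with a coefficient that does not vanish identically; so
`τ_n(t, u_n) = T(t)` for all `n`. Now clear denominators. At `u_{n-1} = u_{n+1}` the condition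
says that `φ_{n-1}` and `φ_{n+1}` are the same function; for fixed `u_{n-1}, u_n` it expresses
`φ_{n+1}` as a quadratic polynomial; and its part symmetric in `u_{n-1}, u_{n+1}` gives `∂φ_n/∂t =
0`. Hence the symmetry is `(s₀ + s₁ t) ∂_t + (f(u_n) + (-1)^n g(u_n)) ∂_{u_n}` with quadratic `f`
and `g`, and what is left of the condition is linear algebra (`sol`): when `f ∂_u` acts on
quadratic polynomials by `q ↦ f q' - f' q`, its action on both arguments of `N` multiplies `N` by
`- s₁`, and that of `g ∂_u`, with opposite signs on the two arguments, annihilates `N`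
(`IsSymmetry.exists_coef`). Conversely such vector fields are symmetries (`isSymmetry_field`) and
are closed under commutators (`coefBracket_mem_sol`), so that they make up the symmetry algebra,
wherever the intervals lie (`symmetryAlgebra_eq`).

**Classification.** The dimension of `sol` is a Möbius invariant (`Equivalent.finrank_sol`). If
`N(m, m) ≠ 0` for some `m`, sending `m` to infinity and translating gives the normal form `α = 1`,
`β = 0`. There a solution with `g ≠ 0`, or one with `f ≠ 0`, determines all but two or three of
the constants, and the remaining matrices are the listed ones up to dilations. If `N` vanishes on the
diagonal, it is `x - y` times a bilinear polynomial, and two normal forms remain. So an equation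
with a symmetry besides `∂_t` is equivalent to a listed one (`exists_listed`). For each listed
equation the system `sol` is solved outright, which gives the bases and the dimensions
(`Listed.finrank_sol`); since the dimension is invariant, the list under each dimension is
complete and contains nothing else.

**Structure.** An element of a nilpotent ideal has no eigenvector with a nonzero eigenvalue. So an
Abelian subspace that contains all commutators, and outside of which every element has such an
eigenvector, is the nilradical (`isSolvableWithAbelianNilradical_of`). The isomorphisms with
`gl(2, ℝ)` are given by explicit parametrizations (`isGL2_of`).
-/

noncomputable section

namespace EYdKN

/-! ### The biquadratic form of an equation -/

/-- The matrix of the biquadratic polynomial `N(x, y) = P(y) x² + 2 Q(y) x + R(y)` in the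
basis `u², u, 1`: `N(x, y) = v(x)ᵀ (form K) v(y)` with `v(u) = (u², u, 1)`. -/
def form (K : Matrix (Fin 3) (Fin 3) ℝ) : Matrix (Fin 3) (Fin 3) ℝ :=
  !![K 0 0, 2 * K 0 1, K 0 2; 2 * K 1 0, 2 * K 1 1, 2 * K 1 2; K 2 0, 2 * K 2 1, K 2 2]

/-- The matrix of constants with a given biquadratic form. -/
def unform (E : Matrix (Fin 3) (Fin 3) ℝ) : Matrix (Fin 3) (Fin 3) ℝ :=
  !![E 0 0, E 0 1 / 2, E 0 2; E 1 0 / 2, E 1 1 / 2, E 1 2 / 2; E 2 0, E 2 1 / 2, E 2 2]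

theorem form_unform (E : Matrix (Fin 3) (Fin 3) ℝ) : form (unform E) = E := by
  ext i j; fin_cases i <;> fin_cases j <;> simp [form, unform] <;> ring

theorem unform_form (K : Matrix (Fin 3) (Fin 3) ℝ) : unform (form K) = K := by
  ext i j; fin_cases i <;> fin_cases j <;> simp [form, unform]

theorem form_eq_zero {K : Matrix (Fin 3) (Fin 3) ℝ} (h : form K = 0) : K = 0 := by
  rw [← unform_form K, h]
  ext i j; fin_cases i <;> fin_cases j <;> simp [unform]

/-- The polarization of `v(x)ᵀ E v(y)` in `x`, at `x`, `z`. -/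
def pol (E : Matrix (Fin 3) (Fin 3) ℝ) (x y z : ℝ) : ℝ :=
  (E 0 0 * y ^ 2 + E 0 1 * y + E 0 2) * (z * x)
    + (E 1 0 * y ^ 2 + E 1 1 * y + E 1 2) * ((z + x) / 2)
    + (E 2 0 * y ^ 2 + E 2 1 * y + E 2 2)

theorem rhs_eq_pol (K : Matrix (Fin 3) (Fin 3) ℝ) (x y z : ℝ) :
    rhs K x y z = pol (form K) x y z / (z - x) := by
  simp only [rhs, pol, P, Q, R, form]
  congr 1
  simp
  ring

theorem quadratic_eq_zero {S : Set ℝ} (hS : S.Infinite) {a b c : ℝ}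
    (h : ∀ u ∈ S, a * u ^ 2 + b * u + c = 0) : a = 0 ∧ b = 0 ∧ c = 0 := by
  have h0 : (C a * X ^ 2 + C b * X + C c : ℝ[X]) = 0 :=
    Polynomial.eq_zero_of_infinite_isRoot _ (hS.mono fun u hu => by simpa using h u hu)
  refine ⟨?_, ?_, ?_⟩
  · simpa using congrArg (fun q => q.coeff 2) h0
  · simpa using congrArg (fun q => q.coeff 1) h0
  · simpa using congrArg (fun q => q.coeff 0) h0

theorem polar_eq_zero {S : Set ℝ} (hS : S.Infinite) {a b c : ℝ}
    (h : ∀ x ∈ S, ∀ z ∈ S, z ≠ x → a * (z * x) + b * ((z + x) / 2) + c = 0) :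
    a = 0 ∧ b = 0 ∧ c = 0 := by
  have key : ∀ x ∈ S, a * x + b / 2 = 0 ∧ b / 2 * x + c = 0 := fun x hx => by
    have := quadratic_eq_zero (hS.sdiff (finite_singleton x)) (a := 0) (b := a * x + b / 2)
      (c := b / 2 * x + c) fun z hz => by
        have := h x hx z hz.1 hz.2
        linear_combination this
    exact this.2
  have h1 := quadratic_eq_zero hS (a := 0) (b := a) (c := b / 2)
    fun x hx => by linear_combination (key x hx).1
  have h2 := quadratic_eq_zero hS (a := 0) (b := b / 2) (c := c)
    fun x hx => by linear_combination (key x hx).2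
  exact ⟨h1.2.1, by linarith [h1.2.2], h2.2.2⟩

/-- A biquadratic form vanishes if its polarization does, off the diagonal of an infinite set. -/
theorem eq_zero_of_pol_eq_zero {S : Set ℝ} (hS : S.Infinite) {E : Matrix (Fin 3) (Fin 3) ℝ}
    (h : ∀ x ∈ S, ∀ y ∈ S, ∀ z ∈ S, z ≠ x → pol E x y z = 0) : E = 0 := by
  have key : ∀ y ∈ S, ∀ i, E i 0 * y ^ 2 + E i 1 * y + E i 2 = 0 := fun y hy => by
    have := polar_eq_zero hS fun x hx z hz hzx => h x hx y hy z hz hzx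
    intro i; fin_cases i
    exacts [this.1, this.2.1, this.2.2]
  ext i j
  have := quadratic_eq_zero hS fun y hy => key y hy i
  fin_cases j
  exacts [this.1, this.2.1, this.2.2]

/-! ### Möbius transformations -/

/-- The symmetric square of a `2 × 2` matrix: `v((η₁ u + η₂) / (η₃ u + η₄)) (η₃ u + η₄)²` is
`sq2 !![η₁, η₂; η₃, η₄]` applied to `v(u) = (u², u, 1)`. -/
def sq2 (g : Matrix (Fin 2) (Fin 2) ℝ) : Matrix (Fin 3) (Fin 3) ℝ :=
  !![g 0 0 ^ 2, 2 * g 0 0 * g 0 1, g 0 1 ^ 2;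
    g 0 0 * g 1 0, g 0 0 * g 1 1 + g 0 1 * g 1 0, g 0 1 * g 1 1;
    g 1 0 ^ 2, 2 * g 1 0 * g 1 1, g 1 1 ^ 2]

theorem sq2_mul (g h : Matrix (Fin 2) (Fin 2) ℝ) : sq2 (g * h) = sq2 g * sq2 h := by
  ext i j
  fin_cases i <;> fin_cases j <;>
    simp [sq2, Matrix.mul_apply, Fin.sum_univ_succ] <;> ring

theorem sq2_one : sq2 1 = 1 := by
  ext i j; fin_cases i <;> fin_cases j <;> simp [sq2]

theorem sq2_smul (r : ℝ) (g : Matrix (Fin 2) (Fin 2) ℝ) : sq2 (r • g) = r ^ 2 • sq2 g := by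
  ext i j; fin_cases i <;> fin_cases j <;> simp [sq2] <;> ring

/-- The transform of a biquadratic form under a Möbius transformation. -/
def pullback (g : Matrix (Fin 2) (Fin 2) ℝ) (E : Matrix (Fin 3) (Fin 3) ℝ) :
    Matrix (Fin 3) (Fin 3) ℝ := (sq2 g)ᵀ * E * sq2 g

theorem pol_div (E : Matrix (Fin 3) (Fin 3) ℝ) (x y z : ℝ) {p q r : ℝ} (hp : p ≠ 0) (hq : q ≠ 0)
    (hr : r ≠ 0) : pol E (x / p) (y / q) (z / r) * (p * r * q ^ 2) =
      (E 0 0 * y ^ 2 + E 0 1 * (y * q) + E 0 2 * q ^ 2) * (z * x)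
      + (E 1 0 * y ^ 2 + E 1 1 * (y * q) + E 1 2 * q ^ 2) * ((z * p + x * r) / 2)
      + (E 2 0 * y ^ 2 + E 2 1 * (y * q) + E 2 2 * q ^ 2) * (p * r) := by
  simp only [pol]
  field_simp

/-- Covariance of the polarization; the weights `2` in `y` and `1` in each of `x`, `z` come from the
denominators. -/
theorem pol_pullback (g : Matrix (Fin 2) (Fin 2) ℝ) (E : Matrix (Fin 3) (Fin 3) ℝ)
    {x y z : ℝ} (hx : g 1 0 * x + g 1 1 ≠ 0) (hy : g 1 0 * y + g 1 1 ≠ 0)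
    (hz : g 1 0 * z + g 1 1 ≠ 0) :
    pol E ((g 0 0 * x + g 0 1) / (g 1 0 * x + g 1 1))
        ((g 0 0 * y + g 0 1) / (g 1 0 * y + g 1 1))
        ((g 0 0 * z + g 0 1) / (g 1 0 * z + g 1 1)) *
      ((g 1 0 * x + g 1 1) * (g 1 0 * z + g 1 1) * (g 1 0 * y + g 1 1) ^ 2) =
    pol (pullback g E) x y z := by
  rw [pol_div E _ _ _ hx hy hz]
  simp [pol, pullback, sq2, Matrix.mul_apply, Fin.sum_univ_succ]
  ring

theorem pol_sub_smul (E F : Matrix (Fin 3) (Fin 3) ℝ) (c x y z : ℝ) :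
    pol (E - c • F) x y z = pol E x y z - c * pol F x y z := by
  simp [pol]; ring

theorem mobius_sub (a b c d : ℝ) {x z : ℝ} (hx : c * x + d ≠ 0) (hz : c * z + d ≠ 0) :
    (a * z + b) / (c * z + d) - (a * x + b) / (c * x + d) =
      (a * d - b * c) * (z - x) / ((c * x + d) * (c * z + d)) := by
  rw [div_sub_div _ _ hz hx, mul_comm (c * z + d)]
  ring

/-- The right-hand sides of two equations correspond to each other under a Möbius
transformation iff their biquadratic forms do. -/
theorem rhs_mobius_iff (g : Matrix (Fin 2) (Fin 2) ℝ) (c : ℝ)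
    (hg : g 0 0 * g 1 1 - g 0 1 * g 1 0 ≠ 0) (K K' : Matrix (Fin 3) (Fin 3) ℝ) :
    (∀ x y z : ℝ, z ≠ x → g 1 0 * x + g 1 1 ≠ 0 → g 1 0 * y + g 1 1 ≠ 0 →
      g 1 0 * z + g 1 1 ≠ 0 →
      rhs K' ((g 0 0 * x + g 0 1) / (g 1 0 * x + g 1 1))
          ((g 0 0 * y + g 0 1) / (g 1 0 * y + g 1 1))
          ((g 0 0 * z + g 0 1) / (g 1 0 * z + g 1 1)) =
        c * ((g 0 0 * g 1 1 - g 0 1 * g 1 0) / (g 1 0 * y + g 1 1) ^ 2) * rhs K x y z) ↔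
    pullback g (form K') = (c * (g 0 0 * g 1 1 - g 0 1 * g 1 0) ^ 2) • form K := by
  have key : ∀ x y z : ℝ, z ≠ x → g 1 0 * x + g 1 1 ≠ 0 → g 1 0 * y + g 1 1 ≠ 0 →
      g 1 0 * z + g 1 1 ≠ 0 →
      (rhs K' ((g 0 0 * x + g 0 1) / (g 1 0 * x + g 1 1))
          ((g 0 0 * y + g 0 1) / (g 1 0 * y + g 1 1))
          ((g 0 0 * z + g 0 1) / (g 1 0 * z + g 1 1)) =
        c * ((g 0 0 * g 1 1 - g 0 1 * g 1 0) / (g 1 0 * y + g 1 1) ^ 2) * rhs K x y z ↔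
      pol (pullback g (form K')) x y z =
        (c * (g 0 0 * g 1 1 - g 0 1 * g 1 0) ^ 2) * pol (form K) x y z) := by
    intro x y z hzx hx hy hz
    have hzx' : z - x ≠ 0 := sub_ne_zero.2 hzx
    rw [← pol_pullback g _ hx hy hz, rhs_eq_pol, rhs_eq_pol, mobius_sub _ _ _ _ hx hz]
    generalize pol (form K') _ _ _ = p
    generalize pol (form K) x y z = q
    field_simp
  constructor
  · intro h
    have hS : {u : ℝ | g 1 0 * u + g 1 1 ≠ 0}.Infinite := by
      have hfin : {u : ℝ | g 1 0 * u + g 1 1 ≠ 0}ᶜ.Finite := by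
        by_contra hinf
        have := quadratic_eq_zero (S := {u : ℝ | g 1 0 * u + g 1 1 ≠ 0}ᶜ) hinf (a := 0)
          (b := g 1 0) (c := g 1 1) fun u hu => by
            simp only [mem_compl_iff, mem_ofPred_eq, not_not] at hu
            linarith
        exact hg (by rw [this.2.1, this.2.2]; ring)
      simpa only [compl_compl] using hfin.infinite_compl
    refine sub_eq_zero.1 (eq_zero_of_pol_eq_zero hS fun x hx y hy z hz hzx => ?_)
    rw [pol_sub_smul, (key x y z hzx hx hy hz).1 (h x y z hzx hx hy hz), sub_self]
  · intro h x y z hzx hx hy hz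
    rw [key x y z hzx hx hy hz, h]
    simp [pol]; ring

theorem equivalent_iff {K K' : Matrix (Fin 3) (Fin 3) ℝ} :
    Equivalent K K' ↔ ∃ (g : Matrix (Fin 2) (Fin 2) ℝ) (c : ℝ), g.det ≠ 0 ∧ c ≠ 0 ∧
      pullback g (form K') = c • form K := by
  constructor
  · rintro ⟨η₁, η₂, η₃, η₄, c, hη, hc, h⟩
    have hη0 : η₁ * η₄ - η₂ * η₃ ≠ 0 := by rcases hη with h | h <;> rw [h] <;> norm_num
    refine ⟨!![η₁, η₂; η₃, η₄], c * (η₁ * η₄ - η₂ * η₃) ^ 2, by simpa using hη0, by positivity, ?_⟩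
    exact (rhs_mobius_iff !![η₁, η₂; η₃, η₄] c (by simpa using hη0) K K').1 (by simpa using h)
  · rintro ⟨g, c, hg, hc, h⟩
    -- rescale `g` to determinant `± 1`
    set r : ℝ := (√|g.det|)⁻¹ with hr
    have hpos : 0 < |g.det| := abs_pos.2 hg
    have hr0 : r ≠ 0 := by positivity
    have hr2 : r ^ 2 = |g.det|⁻¹ := by rw [hr, inv_pow, Real.sq_sqrt hpos.le]
    have hd : (r • g) 0 0 * (r • g) 1 1 - (r • g) 0 1 * (r • g) 1 0 = r ^ 2 * g.det := by
      simp [Matrix.det_fin_two]; ring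
    have hd1 : r ^ 2 * g.det = 1 ∨ r ^ 2 * g.det = -1 := by
      rw [hr2]
      rcases abs_choice g.det with h | h <;> rw [h]
      · left; field_simp
      · right; field_simp
    have hdsq : (r ^ 2 * g.det) ^ 2 = 1 := by rcases hd1 with h | h <;> rw [h] <;> norm_num
    refine ⟨(r • g) 0 0, (r • g) 0 1, (r • g) 1 0, (r • g) 1 1, r ^ 4 * c, ?_, by positivity, ?_⟩
    · rw [hd]; exact hd1
    · rw [rhs_mobius_iff (r • g) (r ^ 4 * c)
        (by rw [hd]; rcases hd1 with h | h <;> rw [h] <;> norm_num), hd, hdsq, mul_one, pullback,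
        sq2_smul, mul_smul, ← h, pullback, Matrix.transpose_smul]
      simp only [Matrix.smul_mul, Matrix.mul_smul, smul_smul]
      congr 1; ring

theorem Equivalent.refl (K : Matrix (Fin 3) (Fin 3) ℝ) : Equivalent K K :=
  equivalent_iff.2 ⟨1, 1, by simp, by simp, by simp [pullback, sq2_one]⟩

theorem Equivalent.symm {K K' : Matrix (Fin 3) (Fin 3) ℝ} (h : Equivalent K K') :
    Equivalent K' K := by
  obtain ⟨g, c, hg, hc, h⟩ := equivalent_iff.1 h
  have hg1 : g * g⁻¹ = 1 := Matrix.mul_nonsing_inv g (isUnit_iff_ne_zero.2 hg)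
  have hG : sq2 g * sq2 g⁻¹ = 1 := by rw [← sq2_mul, hg1, sq2_one]
  have hG' : (sq2 g⁻¹)ᵀ * (sq2 g)ᵀ = 1 := by rw [← Matrix.transpose_mul, hG, Matrix.transpose_one]
  refine equivalent_iff.2 ⟨g⁻¹, c⁻¹, ?_, inv_ne_zero hc, ?_⟩
  · intro h0
    have := congrArg Matrix.det hg1
    rw [Matrix.det_mul, h0] at this
    simp at this
  · have h1 : form K = c⁻¹ • pullback g (form K') := by rw [h, smul_smul, inv_mul_cancel₀ hc, one_smul]
    rw [h1, pullback, pullback, Matrix.mul_smul, Matrix.smul_mul]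
    congr 1
    calc (sq2 g⁻¹)ᵀ * ((sq2 g)ᵀ * form K' * sq2 g) * sq2 g⁻¹
        = ((sq2 g⁻¹)ᵀ * (sq2 g)ᵀ) * form K' * (sq2 g * sq2 g⁻¹) := by
          simp only [Matrix.mul_assoc]
      _ = form K' := by rw [hG, hG', Matrix.one_mul, Matrix.mul_one]

theorem Equivalent.trans {K K' K'' : Matrix (Fin 3) (Fin 3) ℝ} (h : Equivalent K K')
    (h' : Equivalent K' K'') : Equivalent K K'' := by
  obtain ⟨g, c, hg, hc, h⟩ := equivalent_iff.1 h
  obtain ⟨g', c', hg', hc', h'⟩ := equivalent_iff.1 h'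
  refine equivalent_iff.2 ⟨g' * g, c' * c, by rw [Matrix.det_mul]; exact mul_ne_zero hg' hg,
    mul_ne_zero hc' hc, ?_⟩
  rw [mul_smul, ← h, pullback, pullback, sq2_mul, Matrix.transpose_mul, ← Matrix.smul_mul,
    ← Matrix.mul_smul, ← h', pullback]
  simp only [Matrix.mul_assoc]

theorem equivalent_pullback (K : Matrix (Fin 3) (Fin 3) ℝ) {g : Matrix (Fin 2) (Fin 2) ℝ}
    (hg : g.det ≠ 0) {c : ℝ} (hc : c ≠ 0) :
    Equivalent K (unform (c • pullback g (form K))) :=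
  (equivalent_iff.2 ⟨g, c⁻¹, hg, inv_ne_zero hc, by
    rw [form_unform, smul_smul, inv_mul_cancel₀ hc, one_smul]⟩ : Equivalent _ _).symm

theorem Equivalent.isYdKN {K K' : Matrix (Fin 3) (Fin 3) ℝ} (h : Equivalent K K')
    (hK : IsYdKN K') : IsYdKN K := by
  obtain ⟨g, c, -, hc, h⟩ := equivalent_iff.1 h
  have h1 : (form K')ᵀ = form K' := by
    obtain ⟨h1, h2, h3⟩ := hK
    ext i j; fin_cases i <;> fin_cases j <;> simp [form, h1, h2, h3]
  have h2 : (c • form K)ᵀ = c • form K := by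
    rw [← h, pullback]
    simp only [Matrix.transpose_mul, Matrix.transpose_transpose, h1, Matrix.mul_assoc]
  rw [Matrix.transpose_smul] at h2
  have h3 : (form K)ᵀ = form K := smul_right_injective _ hc h2
  have e := fun i j => congrFun (congrFun h3 i) j
  have e01 := e 0 1
  have e02 := e 0 2
  have e12 := e 1 2
  simp [form] at e01 e02 e12
  exact ⟨e01, e02, e12⟩

/-! ### The determining equations -/

/-- The matrix of `q ↦ a q' - a' q` on the quadratic polynomials `q`, where
`a = a₀ u² + a₁ u + a₂`: if `q = cᵀ v` with `v(u) = (u², u, 1)`, then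
`a q' - a' q = cᵀ (adMat a) v`. -/
def adMat (a : Fin 3 → ℝ) : Matrix (Fin 3) (Fin 3) ℝ :=
  !![a 1, 2 * a 2, 0; -a 0, 0, a 2; 0, -2 * a 0, -a 1]

/-- The commutator `a b' - a' b` of quadratic polynomials, in coefficients. -/
def brk (a b : Fin 3 → ℝ) : Fin 3 → ℝ :=
  ![a 1 * b 0 - a 0 * b 1, 2 * (a 2 * b 0 - a 0 * b 2), a 2 * b 1 - a 1 * b 2]

theorem adMat_add (a b : Fin 3 → ℝ) : adMat (a + b) = adMat a + adMat b := by
  ext i j; fin_cases i <;> fin_cases j <;> simp [adMat] <;> ring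

theorem adMat_smul (r : ℝ) (a : Fin 3 → ℝ) : adMat (r • a) = r • adMat a := by
  ext i j; fin_cases i <;> fin_cases j <;> simp [adMat] <;> ring

theorem adMat_zero : adMat 0 = 0 := by
  ext i j; fin_cases i <;> fin_cases j <;> simp [adMat]

theorem adMat_brk (a b : Fin 3 → ℝ) :
    adMat (brk a b) = adMat b * adMat a - adMat a * adMat b := by
  ext i j; fin_cases i <;> fin_cases j <;>
    simp [adMat, brk] <;> ring

/-- Equivariance of the commutator under Möbius transformations. -/
theorem sq2_mul_adMat (g : Matrix (Fin 2) (Fin 2) ℝ) (a : Fin 3 → ℝ) :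
    sq2 g * adMat ((sq2 g)ᵀ *ᵥ a) = g.det • (adMat a * sq2 g) := by
  ext i j; fin_cases i <;> fin_cases j <;>
    simp [adMat, sq2, Matrix.mul_apply, Fin.sum_univ_succ, Matrix.mulVec, dotProduct,
      Matrix.det_fin_two] <;> ring

/-- Coefficients `(s₀, s₁, f, g)` of a vector field
`(s₀ + s₁ t) ∂_t + (f(u_n) + (-1)^n g(u_n)) ∂_{u_n}` with quadratic polynomials `f`, `g`. -/
abbrev Coef : Type := ℝ × ℝ × (Fin 3 → ℝ) × (Fin 3 → ℝ)

/-- The determining equations: `f` multiplies the biquadratic form `E` by `- s₁`, and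
`g`, acting on its two arguments with opposite signs, annihilates it. -/
def sol (E : Matrix (Fin 3) (Fin 3) ℝ) : Submodule ℝ Coef where
  carrier := {w | (adMat w.2.2.1)ᵀ * E = -(E * adMat w.2.2.1) - w.2.1 • E ∧
    (adMat w.2.2.2)ᵀ * E = E * adMat w.2.2.2}
  add_mem' {v w} hv hw := by
    refine ⟨?_, ?_⟩
    · simp only [Prod.snd_add, Prod.fst_add, adMat_add, Matrix.transpose_add, Matrix.add_mul,
        Matrix.mul_add, hv.1, hw.1, add_smul]
      abel
    · simp only [Prod.snd_add, adMat_add, Matrix.transpose_add, Matrix.add_mul,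
        Matrix.mul_add, hv.2, hw.2]
  zero_mem' := by simp [adMat_zero]
  smul_mem' r w hw := by
    refine ⟨?_, ?_⟩
    · simp only [Prod.smul_snd, Prod.smul_fst, adMat_smul, Matrix.transpose_smul,
        Matrix.smul_mul, Matrix.mul_smul, hw.1, smul_eq_mul, mul_smul, smul_sub, smul_neg]
    · simp only [Prod.smul_snd, adMat_smul, Matrix.transpose_smul, Matrix.smul_mul,
        Matrix.mul_smul, hw.2]

/-- The commutator of vector fields in coefficients. -/
def coefBracket (v w : Coef) : Coef :=
  (v.1 * w.2.1 - v.2.1 * w.1, 0, brk v.2.2.1 w.2.2.1 + brk v.2.2.2 w.2.2.2,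
    brk v.2.2.1 w.2.2.2 + brk v.2.2.2 w.2.2.1)

/-- The determining equations are graded by the parity in `n`: the commutators `[f, f']` and
`[g, g']` solve the equation for `f` with `s₁ = 0`, and `[f, g']`, `[g, f']` solve the one for `g`. -/
theorem coefBracket_mem_sol {E : Matrix (Fin 3) (Fin 3) ℝ} {v w : Coef} (hv : v ∈ sol E)
    (hw : w ∈ sol E) : coefBracket v w ∈ sol E := by
  obtain ⟨a, s, f, g⟩ := v
  obtain ⟨b, s', f', g'⟩ := w
  obtain ⟨h1, h2⟩ : (adMat f)ᵀ * E = -(E * adMat f) - s • E ∧ (adMat g)ᵀ * E = E * adMat g := hv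
  obtain ⟨h3, h4⟩ : (adMat f')ᵀ * E = -(E * adMat f') - s' • E ∧
    (adMat g')ᵀ * E = E * adMat g' := hw
  have ff : ∀ {A A' B B' : Matrix (Fin 3) (Fin 3) ℝ} {r r' : ℝ}, A * E = -(E * B) - r • E →
      A' * E = -(E * B') - r' • E →
      A * (A' * E) = E * (B * B') + r • (E * B') + r' • (E * B) + (r * r') • E := by
    intro A A' B B' r r' h h'
    rw [h', Matrix.mul_sub, Matrix.mul_neg, Matrix.mul_smul, ← Matrix.mul_assoc, h]
    simp only [Matrix.sub_mul, Matrix.neg_mul, Matrix.smul_mul, Matrix.mul_assoc]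
    module
  have gg : ∀ {A A' B B' : Matrix (Fin 3) (Fin 3) ℝ}, A * E = E * B → A' * E = E * B' →
      A * (A' * E) = E * (B * B') := by
    intro A A' B B' h h'
    rw [h', ← Matrix.mul_assoc, h, Matrix.mul_assoc]
  have fg : ∀ {A A' B B' : Matrix (Fin 3) (Fin 3) ℝ} {r : ℝ}, A * E = -(E * B) - r • E →
      A' * E = E * B' → A * (A' * E) = -(E * (B * B')) - r • (E * B') := by
    intro A A' B B' r h h'
    rw [h', ← Matrix.mul_assoc, h]
    simp only [Matrix.sub_mul, Matrix.neg_mul, Matrix.smul_mul, Matrix.mul_assoc]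
  have gf : ∀ {A A' B B' : Matrix (Fin 3) (Fin 3) ℝ} {r : ℝ}, A * E = E * B →
      A' * E = -(E * B') - r • E → A * (A' * E) = -(E * (B * B')) - r • (E * B) := by
    intro A A' B B' r h h'
    rw [h', Matrix.mul_sub, Matrix.mul_neg, Matrix.mul_smul, ← Matrix.mul_assoc, h,
      Matrix.mul_assoc]
  refine ⟨?_, ?_⟩
  · simp only [coefBracket, adMat_add, adMat_brk, Matrix.transpose_add, Matrix.transpose_sub,
      Matrix.transpose_mul, Matrix.add_mul, Matrix.sub_mul, Matrix.mul_assoc, Matrix.mul_add,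
      Matrix.mul_sub, ff h1 h3, ff h3 h1, gg h2 h4, gg h4 h2]
    module
  · simp only [coefBracket, adMat_add, adMat_brk, Matrix.transpose_add, Matrix.transpose_sub,
      Matrix.transpose_mul, Matrix.add_mul, Matrix.sub_mul, Matrix.mul_assoc, Matrix.mul_add,
      Matrix.mul_sub, fg h1 h4, gf h4 h1, gf h2 h3, fg h3 h2]
    module

/-- The transport of coefficients along a Möbius transformation. -/
def transport (g : Matrix (Fin 2) (Fin 2) ℝ) : Coef →ₗ[ℝ] Coef :=
  LinearMap.id.prodMap ((g.det • LinearMap.id).prodMap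
    ((Matrix.mulVecLin (sq2 g)ᵀ).prodMap (Matrix.mulVecLin (sq2 g)ᵀ)))

theorem transport_apply (g : Matrix (Fin 2) (Fin 2) ℝ) (w : Coef) :
    transport g w = (w.1, g.det * w.2.1, (sq2 g)ᵀ *ᵥ w.2.2.1, (sq2 g)ᵀ *ᵥ w.2.2.2) := rfl

theorem transport_injective {g : Matrix (Fin 2) (Fin 2) ℝ} (hg : g.det ≠ 0) :
    Function.Injective (transport g) := by
  have hG : (sq2 g⁻¹)ᵀ * (sq2 g)ᵀ = 1 := by
    rw [← Matrix.transpose_mul, ← sq2_mul,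
      Matrix.mul_nonsing_inv g (isUnit_iff_ne_zero.2 hg), sq2_one, Matrix.transpose_one]
  have hinj : ∀ a b : Fin 3 → ℝ, (sq2 g)ᵀ *ᵥ a = (sq2 g)ᵀ *ᵥ b → a = b := fun a b h => by
    have := congrArg (fun c => (sq2 g⁻¹)ᵀ *ᵥ c) h
    simpa only [Matrix.mulVec_mulVec, hG, Matrix.one_mulVec] using this
  rintro ⟨a, s, f, q⟩ ⟨a', s', f', q'⟩ h
  simp only [transport_apply, Prod.mk.injEq] at h
  obtain ⟨h1, h2, h3, h4⟩ := h
  rw [h1, mul_left_cancel₀ hg h2, hinj _ _ h3, hinj _ _ h4]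

theorem transport_mem_sol {g : Matrix (Fin 2) (Fin 2) ℝ} {E : Matrix (Fin 3) (Fin 3) ℝ}
    {w : Coef} (hw : w ∈ sol E) : transport g w ∈ sol (pullback g E) := by
  obtain ⟨a, s, f, q⟩ := w
  obtain ⟨h1, h2⟩ : (adMat f)ᵀ * E = -(E * adMat f) - s • E ∧ (adMat q)ᵀ * E = E * adMat q := hw
  have right : ∀ b, pullback g E * adMat ((sq2 g)ᵀ *ᵥ b) =
      g.det • ((sq2 g)ᵀ * (E * adMat b) * sq2 g) := fun b => by
    rw [pullback, Matrix.mul_assoc, sq2_mul_adMat, Matrix.mul_smul]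
    simp only [Matrix.mul_assoc]
  have left : ∀ b, (adMat ((sq2 g)ᵀ *ᵥ b))ᵀ * pullback g E =
      g.det • ((sq2 g)ᵀ * ((adMat b)ᵀ * E) * sq2 g) := fun b => by
    have := congrArg Matrix.transpose (sq2_mul_adMat g b)
    rw [Matrix.transpose_mul, Matrix.transpose_smul, Matrix.transpose_mul] at this
    rw [pullback, ← Matrix.mul_assoc, ← Matrix.mul_assoc, this]
    simp only [Matrix.smul_mul, Matrix.mul_assoc]
  refine ⟨?_, ?_⟩
  · simp only [transport_apply]
    rw [left, right, h1, pullback]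
    simp only [Matrix.mul_sub, Matrix.sub_mul, Matrix.mul_neg, Matrix.neg_mul, Matrix.mul_smul,
      Matrix.smul_mul]
    module
  · simp only [transport_apply]
    rw [left, right, h2]

theorem sol_smul {c : ℝ} (hc : c ≠ 0) (E : Matrix (Fin 3) (Fin 3) ℝ) : sol (c • E) = sol E := by
  have hinj := smul_right_injective (Matrix (Fin 3) (Fin 3) ℝ) hc
  ext w
  refine and_congr ?_ ?_
  · rw [← hinj.eq_iff (a := (adMat w.2.2.1)ᵀ * E)]
    simp only [Matrix.mul_smul, Matrix.smul_mul, smul_sub, smul_neg, smul_comm w.2.1 c]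
  · rw [← hinj.eq_iff (a := (adMat w.2.2.2)ᵀ * E)]
    simp only [Matrix.mul_smul, Matrix.smul_mul]

theorem Equivalent.finrank_sol_le {K K' : Matrix (Fin 3) (Fin 3) ℝ} (h : Equivalent K K') :
    Module.finrank ℝ (sol (form K')) ≤ Module.finrank ℝ (sol (form K)) := by
  obtain ⟨g, c, hg, hc, h⟩ := equivalent_iff.1 h
  have hmem : ∀ w ∈ sol (form K'), transport g w ∈ sol (form K) := fun w hw => by
    rw [← sol_smul hc, ← h]
    exact transport_mem_sol hw
  exact LinearMap.finrank_le_finrank_of_injective (f := (transport g).restrict hmem)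
    fun x y hxy => Subtype.ext (transport_injective hg (congrArg Subtype.val hxy))

theorem Equivalent.finrank_sol {K K' : Matrix (Fin 3) (Fin 3) ℝ} (h : Equivalent K K') :
    Module.finrank ℝ (sol (form K)) = Module.finrank ℝ (sol (form K')) :=
  le_antisymm h.symm.finrank_sol_le h.finrank_sol_le

/-- The determining equations for `f` and `s₁`, written out in the constants. -/
structure SymEqs (K : Matrix (Fin 3) (Fin 3) ℝ) (s : ℝ) (f : Fin 3 → ℝ) : Prop where
  e00 : 2 * f 1 * K 0 0 - 2 * f 0 * K 1 0 - 2 * f 0 * K 0 1 + s * K 0 0 = 0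
  e01 : f 1 * K 0 1 - f 0 * K 1 1 + f 2 * K 0 0 - f 0 * K 0 2 + s * K 0 1 = 0
  e02 : -2 * f 0 * K 1 2 + 2 * f 2 * K 0 1 + s * K 0 2 = 0
  e10 : f 2 * K 0 0 - f 0 * K 2 0 + f 1 * K 1 0 - f 0 * K 1 1 + s * K 1 0 = 0
  e11 : 2 * f 2 * K 0 1 - 2 * f 0 * K 2 1 + 2 * f 2 * K 1 0 - 2 * f 0 * K 1 2 + s * K 1 1 = 0
  e12 : f 2 * K 0 2 - f 0 * K 2 2 + f 2 * K 1 1 - f 1 * K 1 2 + s * K 1 2 = 0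
  e20 : 2 * f 2 * K 1 0 - 2 * f 0 * K 2 1 + s * K 2 0 = 0
  e21 : f 2 * K 1 1 - f 1 * K 2 1 + f 2 * K 2 0 - f 0 * K 2 2 + s * K 2 1 = 0
  e22 : 2 * f 2 * K 1 2 + 2 * f 2 * K 2 1 - 2 * f 1 * K 2 2 + s * K 2 2 = 0

/-- The determining equations for `g`, written out in the constants. -/
structure AntiEqs (K : Matrix (Fin 3) (Fin 3) ℝ) (g : Fin 3 → ℝ) : Prop where
  e00 : g 0 * (K 0 1 - K 1 0) = 0
  e01 : g 1 * K 0 1 - g 0 * K 1 1 - g 2 * K 0 0 + g 0 * K 0 2 = 0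
  e02 : g 1 * K 0 2 - g 0 * K 1 2 - g 2 * K 0 1 = 0
  e10 : g 2 * K 0 0 - g 0 * K 2 0 - g 1 * K 1 0 + g 0 * K 1 1 = 0
  e11 : g 2 * K 0 1 - g 0 * K 2 1 - g 2 * K 1 0 + g 0 * K 1 2 = 0
  e12 : g 2 * K 0 2 - g 0 * K 2 2 - g 2 * K 1 1 + g 1 * K 1 2 = 0
  e20 : g 2 * K 1 0 - g 1 * K 2 0 + g 0 * K 2 1 = 0
  e21 : g 2 * K 1 1 - g 1 * K 2 1 - g 2 * K 2 0 + g 0 * K 2 2 = 0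
  e22 : g 2 * (K 1 2 - K 2 1) = 0

theorem symEqs_iff {K : Matrix (Fin 3) (Fin 3) ℝ} {s : ℝ} {f : Fin 3 → ℝ} :
    (adMat f)ᵀ * form K = -(form K * adMat f) - s • form K ↔ SymEqs K s f := by
  rw [← Matrix.ext_iff]
  simp only [Fin.forall_fin_succ, Matrix.mul_apply, Fin.sum_univ_succ, adMat, form,
    Matrix.sub_apply, Matrix.neg_apply, Matrix.smul_apply, Matrix.transpose_apply]
  simp
  constructor
  · rintro ⟨⟨h1, h2, h3⟩, ⟨h4, h5, h6⟩, h7, h8, h9⟩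
    constructor <;> linarith
  · rintro ⟨h1, h2, h3, h4, h5, h6, h7, h8, h9⟩
    refine ⟨⟨?_, ?_, ?_⟩, ⟨?_, ?_, ?_⟩, ?_, ?_, ?_⟩ <;> linarith

theorem antiEqs_iff {K : Matrix (Fin 3) (Fin 3) ℝ} {g : Fin 3 → ℝ} :
    (adMat g)ᵀ * form K = form K * adMat g ↔ AntiEqs K g := by
  rw [← Matrix.ext_iff]
  simp only [Fin.forall_fin_succ, Matrix.mul_apply, Fin.sum_univ_succ, adMat, form,
    Matrix.transpose_apply]
  simp
  constructor
  · rintro ⟨⟨h1, h2, h3⟩, ⟨h4, h5, h6⟩, h7, h8, h9⟩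
    constructor <;> linarith
  · rintro ⟨h1, h2, h3, h4, h5, h6, h7, h8, h9⟩
    refine ⟨⟨?_, ?_, ?_⟩, ⟨?_, ?_, ?_⟩, ?_, ?_, ?_⟩ <;> linarith

theorem mem_sol_form {K : Matrix (Fin 3) (Fin 3) ℝ} {w : Coef} :
    w ∈ sol (form K) ↔ SymEqs K w.2.1 w.2.2.1 ∧ AntiEqs K w.2.2.2 :=
  and_congr symEqs_iff antiEqs_iff

theorem time_mem_sol (E : Matrix (Fin 3) (Fin 3) ℝ) : ((1, 0, 0, 0) : Coef) ∈ sol E := by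
  refine ⟨?_, ?_⟩ <;> simp [adMat_zero]

/-! ### Normal forms -/

/-- `K` is equivalent to an equation that the classification lists under dimension `d`. -/
def Listed (K : Matrix (Fin 3) (Fin 3) ℝ) : ℕ → Prop
  | 5 => Equivalent K K5
  | 4 => (∃ l : ℝ, (l = 1 ∨ l = -1) ∧ Equivalent K (K4a l)) ∨ Equivalent K K4b
  | 3 => (∃ γ : ℝ, (γ = 1 ∨ γ = -1) ∧ Equivalent K (K3a γ)) ∨
      (∃ μ : ℝ, μ ≠ 0 ∧ Equivalent K (K3b μ)) ∨ Equivalent K K3c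
  | 2 => ∃ K' τ φ ψ, DimTwo K' τ φ ψ ∧ Equivalent K K'
  | _ => False

theorem Listed.of_equivalent {K K' : Matrix (Fin 3) (Fin 3) ℝ} {d : ℕ} (h : Equivalent K K')
    (hK : Listed K' d) : Listed K d := by
  match d, hK with
  | 5, hK => exact h.trans hK
  | 4, Or.inl ⟨l, hl, hK⟩ => exact Or.inl ⟨l, hl, h.trans hK⟩
  | 4, Or.inr hK => exact Or.inr (h.trans hK)
  | 3, Or.inl ⟨l, hl, hK⟩ => exact Or.inl ⟨l, hl, h.trans hK⟩
  | 3, Or.inr (Or.inl ⟨l, hl, hK⟩) => exact Or.inr (Or.inl ⟨l, hl, h.trans hK⟩)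
  | 3, Or.inr (Or.inr hK) => exact Or.inr (Or.inr (h.trans hK))
  | 2, ⟨L, τ, φ, ψ, hL, hK⟩ => exact ⟨L, τ, φ, ψ, hL, h.trans hK⟩

theorem DimTwo.listed {K : Matrix (Fin 3) (Fin 3) ℝ} {τ φ ψ : ℝ[X]} (h : DimTwo K τ φ ψ) :
    Listed K 2 := ⟨K, τ, φ, ψ, h, Equivalent.refl K⟩

theorem equivalent_smul (K : Matrix (Fin 3) (Fin 3) ℝ) {c : ℝ} (hc : c ≠ 0) :
    Equivalent K (c • K) := by
  have := equivalent_pullback K (g := 1) (by simp) hc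
  convert this using 1
  rw [← unform_form (c • K)]
  congr 1
  ext i j; fin_cases i <;> fin_cases j <;> simp [form, pullback, sq2_one] <;> ring

/-- The effect of the dilation `u = k ũ`, with time rescaled so that `α` is kept. -/
theorem equivalent_dilate (K : Matrix (Fin 3) (Fin 3) ℝ) {k : ℝ} (hk : k ≠ 0) :
    Equivalent K !![K 0 0, K 0 1 / k, K 0 2 / k ^ 2; K 1 0 / k, K 1 1 / k ^ 2, K 1 2 / k ^ 3;
      K 2 0 / k ^ 2, K 2 1 / k ^ 3, K 2 2 / k ^ 4] := by
  have := equivalent_pullback K (g := !![k, 0; 0, 1]) (by simpa using hk)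
    (c := (k ^ 4)⁻¹) (by positivity)
  convert this using 1
  ext i j; fin_cases i <;> fin_cases j <;>
    simp [unform, form, pullback, sq2, Matrix.mul_apply, Fin.sum_univ_succ] <;> field_simp

theorem exists_sq_div_eq {x : ℝ} (hx : x ≠ 0) :
    ∃ k : ℝ, k ≠ 0 ∧ (x / k ^ 2 = 1 ∨ x / k ^ 2 = -1) := by
  refine ⟨√|x|, (Real.sqrt_pos.2 (abs_pos.2 hx)).ne', ?_⟩
  rw [Real.sq_sqrt (abs_nonneg x)]
  rcases abs_choice x with h | h <;> rw [h]
  · left; field_simp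
  · right; field_simp

theorem listed_diagonal (l w : ℝ) : ∃ d, Listed !![1, 0, 0; 0, l, 0; 0, 0, w] d := by
  by_cases hw : w = l ^ 2
  · subst hw
    by_cases hl : l = 0
    · subst hl
      exact ⟨5, by simpa [Listed, K5] using Equivalent.refl K5⟩
    · obtain ⟨k, hk, h⟩ := exists_sq_div_eq hl
      refine ⟨4, Or.inl ⟨_, h, ?_⟩⟩
      have := equivalent_dilate !![1, 0, 0; 0, l, 0; 0, 0, l ^ 2] hk
      convert this using 1
      ext i j; fin_cases i <;> fin_cases j <;> simp [K4a] ; ring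
  · exact ⟨2, (DimTwo.family8 l w hw).listed⟩

theorem listed_K3a {γ : ℝ} (hγ : γ ≠ 0) : Listed (K3a γ) 3 := by
  obtain ⟨k, hk, h⟩ := exists_sq_div_eq hγ
  refine Or.inl ⟨_, h, ?_⟩
  have := equivalent_dilate (K3a γ) hk
  convert this using 1
  ext i j; fin_cases i <;> fin_cases j <;> simp [K3a] ; ring

/-- A matrix of constants with a symmetry that commutes with `∂_t` and is not alternating
in `n`. -/
theorem listed_of_commuting (b γ l : ℝ) :
    ∃ d, Listed !![1, 0, γ; b, l, 0; γ + b ^ 2, b * (l + γ), (l + γ) ^ 2] d := by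
  by_cases hγ : γ = 0
  · subst hγ
    by_cases hb : b = 0
    · subst hb
      simpa using listed_diagonal l (l ^ 2)
    · by_cases hl : l = b ^ 2
      · subst hl
        refine ⟨2, ?_⟩
        convert (DimTwo.family5 b hb).listed using 2
        ext i j; fin_cases i <;> fin_cases j <;> simp <;> ring
      · refine ⟨2, ?_⟩
        convert (DimTwo.family3 b l hb hl).listed using 2
        ext i j; fin_cases i <;> fin_cases j <;> simp
  · by_cases h : (b, l) = (0, 0)
    · obtain ⟨rfl, rfl⟩ := Prod.mk.inj h
      exact ⟨3, by simpa [K3a] using listed_K3a hγ⟩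
    · exact ⟨2, (DimTwo.family1 b γ l hγ h).listed⟩

/-- The constants with a symmetry that rescales time: a two-parameter form, in which `- m` is a
root of `N(x, y)` in both variables and `s₁ = 4 m - 2 b` for monic `f`. It is a member of a
two-dimensional family unless `b = 0`, where the alternating symmetry of `K3b` appears. -/
theorem listed_of_scaling (b m : ℝ) (h : b ≠ 2 * m) :
    ∃ d, Listed !![1, 0, -m ^ 2; b, 2 * b * m - 2 * m ^ 2, (b - 2 * m) * m ^ 2;
      2 * b * m - m ^ 2, 2 * b * m ^ 2 - 2 * m ^ 3, 2 * b * m ^ 3 - 3 * m ^ 4] d := by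
  by_cases hb : b = 0
  · subst hb
    have hm : m ≠ 0 := by rintro rfl; simp at h
    refine ⟨3, Or.inr (Or.inl ⟨-m, neg_ne_zero.2 hm, ?_⟩)⟩
    convert Equivalent.refl (K3b (-m)) using 1
    ext i j; fin_cases i <;> fin_cases j <;> simp [K3b] <;> ring
  by_cases hm : m = 0
  · subst hm
    exact ⟨2, by simpa using (DimTwo.family4 b hb).listed⟩
  obtain ⟨ε, hε, hεm⟩ : ∃ ε : ℝ, (ε = 1 ∨ ε = -1) ∧ ε * |m| = m := by
    rcases abs_choice m with h | h
    · exact ⟨1, Or.inl rfl, by rw [h, one_mul]⟩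
    · exact ⟨-1, Or.inr rfl, by rw [h]; ring⟩
  have hs : √(-(-m ^ 2)) = |m| := by rw [neg_neg, Real.sqrt_sq_eq_abs]
  have hε2 : ε ^ 2 = 1 := by rcases hε with h | h <;> rw [h] <;> norm_num
  have hε0 : ε ≠ 0 := by rintro rfl; norm_num at hε2
  have habs : |m| = ε * m := by linear_combination (-|m|) * hε2 + ε * hεm
  refine ⟨2, (DimTwo.family2 ε (-m ^ 2) ((b - 2 * m) * m ^ 2) b (2 * b * m - m ^ 2)
    (2 * b * m ^ 2 - 2 * m ^ 3) (2 * b * m - 2 * m ^ 2) (2 * b * m ^ 3 - 3 * m ^ 4) hε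
    (by have : 0 < m ^ 2 := by positivity
        linarith) ?_ ?_ ?_ (by ring) ?_ hb
    (mul_ne_zero (sub_ne_zero.2 h) (pow_ne_zero 2 hm))).listed⟩
  · rw [hs, habs]; field_simp; linear_combination (-2 * m) * hε2
  · rw [hs, habs]; field_simp; ring
  · rw [hs, habs]; linear_combination (-2 * m ^ 3 * (ε ^ 2 + 1)) * hε2
  · rw [hs, habs]; linear_combination (-2 * (b - 2 * m) * m ^ 3) * hε2

/-- Equations with an alternating symmetry, in the normal form `α = 1`, `β = 0`. -/
theorem exists_listed_of_antiEqs {K : Matrix (Fin 3) (Fin 3) ℝ} (h0 : K 0 0 = 1) (h1 : K 0 1 = 0)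
    {g : Fin 3 → ℝ} (hg : g ≠ 0) (h : AntiEqs K g) : ∃ d, Listed K d := by
  obtain ⟨a00, a01, a02, a10, a11, a12, a20, a21, a22⟩ := h
  rw [h1] at a00 a01 a02 a11
  rw [h0] at a01 a10
  -- if `g` is a multiple of `u`, only the constants of weight zero survive
  by_cases hg0 : g 0 = 0
  · have hg2 : g 2 = 0 := by rw [hg0] at a01; linarith
    have hg1 : g 1 ≠ 0 := fun hg1 => hg (by ext i; fin_cases i <;> assumption)
    rw [hg0, hg2] at a02 a10 a12 a20 a21
    have k02 : K 0 2 = 0 := (mul_eq_zero.1 (by linarith : g 1 * K 0 2 = 0)).resolve_left hg1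
    have k10 : K 1 0 = 0 := (mul_eq_zero.1 (by linarith : g 1 * K 1 0 = 0)).resolve_left hg1
    have k12 : K 1 2 = 0 := (mul_eq_zero.1 (by linarith : g 1 * K 1 2 = 0)).resolve_left hg1
    have k20 : K 2 0 = 0 := (mul_eq_zero.1 (by linarith : g 1 * K 2 0 = 0)).resolve_left hg1
    have k21 : K 2 1 = 0 := (mul_eq_zero.1 (by linarith : g 1 * K 2 1 = 0)).resolve_left hg1
    obtain ⟨d, hd⟩ := listed_diagonal (K 1 1) (K 2 2)
    refine ⟨d, ?_⟩
    convert hd using 1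
    ext i j; fin_cases i <;> fin_cases j <;> simp [*]
  have k10 : K 1 0 = 0 := by
    have := (mul_eq_zero.1 a00).resolve_left hg0
    linarith
  rw [k10] at a10 a11
  have k20 : K 2 0 = K 0 2 := mul_left_cancel₀ hg0 (by linarith)
  have k21 : K 2 1 = K 1 2 := mul_left_cancel₀ hg0 (by linarith)
  have e2 : g 2 = g 0 * (K 0 2 - K 1 1) := by linarith
  by_cases hγ : K 0 2 = 0
  · have k12 : K 1 2 = 0 :=
      (mul_eq_zero.1 (by rw [hγ] at a02; linarith : g 0 * K 1 2 = 0)).resolve_left hg0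
    have k22 : K 2 2 = K 1 1 ^ 2 := mul_left_cancel₀ hg0 (by
      rw [k12, hγ, e2, hγ] at a12; linear_combination -a12)
    obtain ⟨d, hd⟩ := listed_diagonal (K 1 1) (K 2 2)
    refine ⟨d, ?_⟩
    convert hd using 1
    ext i j; fin_cases i <;> fin_cases j <;> simp [*]
  have k22 : K 2 2 = (K 1 1 - K 0 2) ^ 2 + K 1 2 ^ 2 / K 0 2 := by
    have e1 : g 1 = g 0 * K 1 2 / K 0 2 := by field_simp; linarith
    rw [e2, e1] at a12
    field_simp at a12 ⊢
    refine mul_left_cancel₀ hg0 ?_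
    linear_combination -a12
  have hK : K = !![1, 0, K 0 2; 0, K 1 1, K 1 2; K 0 2, K 1 2,
      (K 1 1 - K 0 2) ^ 2 + K 1 2 ^ 2 / K 0 2] := by
    ext i j; fin_cases i <;> fin_cases j <;> simp [*]
  generalize K 0 2 = γ at hK hγ
  generalize K 1 1 = l at hK
  generalize K 1 2 = δ at hK
  subst hK
  -- the excluded parameters are those of `K3a` and `K3b`
  by_cases hex : (2 * l * γ ^ 2 + δ ^ 2, δ * (2 * γ - l),
        δ * (2 * γ ^ 3 + l ^ 2 * γ - l * γ ^ 2 + δ ^ 2)) = (0, 0, 0)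
  · refine ⟨3, ?_⟩
    simp only [Prod.mk.injEq] at hex
    obtain ⟨x1, x2, -⟩ := hex
    by_cases hδ : δ = 0
    · subst hδ
      have hl : l = 0 := by
        have : l * γ ^ 2 = 0 := by linarith
        simpa [hγ] using this
      subst hl
      simpa [K3a] using listed_K3a hγ
    · have hl : l = 2 * γ := by
        have := (mul_eq_zero.1 x2).resolve_left hδ
        linarith
      subst hl
      -- here `δ² = - 4 γ³`, so that `γ = - μ²`, `δ = 2 μ³` for `μ = - δ / (2 γ)`
      set μ : ℝ := -δ / (2 * γ) with hμ
      have m2 : γ = -μ ^ 2 := by rw [hμ]; field_simp; linarith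
      have m3 : δ = 2 * μ ^ 3 := by
        have : δ = -2 * γ * μ := by rw [hμ]; field_simp
        rw [this, m2]; ring
      have hμ0 : μ ≠ 0 := by rintro h; rw [h] at m3; exact hδ (by simpa using m3)
      refine Or.inr (Or.inl ⟨μ, hμ0, ?_⟩)
      clear_value μ
      subst m2 m3
      convert Equivalent.refl (K3b μ) using 1
      ext i j; fin_cases i <;> fin_cases j <;> simp [K3b]
      · field_simp; ring
  · exact ⟨2, (DimTwo.family7 γ l δ hγ hex).listed⟩

/-- Equations with a symmetry that is not alternating, in the normal form `α = 1`, `β = 0`. -/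
theorem exists_listed_of_symEqs {K : Matrix (Fin 3) (Fin 3) ℝ} (h0 : K 0 0 = 1) (h1 : K 0 1 = 0)
    {s : ℝ} {f : Fin 3 → ℝ} (hf : f ≠ 0) (h : SymEqs K s f) : ∃ d, Listed K d := by
  obtain ⟨a00, a01, a02, a10, a11, a12, a20, a21, a22⟩ := h
  simp only [h0, h1] at a00 a01 a02 a10 a11
  by_cases hf0 : f 0 = 0
  · have hf2 : f 2 = 0 := by rw [hf0] at a01; linarith
    have hs : s = -2 * f 1 := by rw [hf0] at a00; linarith
    have hf1 : f 1 ≠ 0 := fun hf1 => hf (by ext i; fin_cases i <;> assumption)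
    simp only [hf0, hf2, hs] at a02 a10 a11 a12 a20 a21 a22
    have k : ∀ {x : ℝ}, f 1 * x = 0 → x = 0 := fun h => (mul_eq_zero.1 h).resolve_left hf1
    have k02 : K 0 2 = 0 := k (by linarith)
    have k10 : K 1 0 = 0 := k (by linarith)
    have k11 : K 1 1 = 0 := k (by linarith)
    have k12 : K 1 2 = 0 := k (by linarith)
    have k20 : K 2 0 = 0 := k (by linarith)
    have k21 : K 2 1 = 0 := k (by linarith)
    have k22 : K 2 2 = 0 := k (by linarith)
    have hK : K = K5 := by
      ext i j; fin_cases i <;> fin_cases j <;> simp [K5, *]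
    exact ⟨5, hK ▸ Equivalent.refl K5⟩
  have k : ∀ {x y : ℝ}, f 0 * x = f 0 * y → x = y := fun h => mul_left_cancel₀ hf0 h
  -- the constants are expressed by `β'`, `γ`, `l` and the ratio `t = s / f 0`
  obtain ⟨t, rfl⟩ : ∃ t, s = f 0 * t := ⟨s / f 0, by field_simp⟩
  have e2 : f 2 = f 0 * (K 1 1 + K 0 2) := by linarith
  have e1 : f 1 = f 0 * (K 1 0 - t / 2) := by linarith
  rw [e1, e2] at a10 a12 a21 a22
  rw [e2] at a11 a20
  have k12 : K 1 2 = t * K 0 2 / 2 := k (by linarith)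
  have k20 : K 2 0 = K 0 2 + K 1 0 ^ 2 + t * K 1 0 / 2 := k (by linarith)
  have k21 : K 2 1 = (K 1 1 + K 0 2) * K 1 0 + t * K 2 0 / 2 := k (by linarith)
  have k22 : K 2 2 = (K 1 1 + K 0 2) ^ 2 + K 1 2 * (3 * t / 2 - K 1 0) := k (by linarith)
  by_cases ht : t = 0
  · subst ht
    obtain ⟨d, hd⟩ := listed_of_commuting (K 1 0) (K 0 2) (K 1 1)
    refine ⟨d, ?_⟩
    convert hd using 1
    ext i j; fin_cases i <;> fin_cases j <;> simp [*]
    ring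
  have k11 : K 1 1 = 2 * K 0 2 + K 1 0 ^ 2 + t * K 1 0 / 2 := by
    refine mul_left_cancel₀ (mul_ne_zero hf0 ht) ?_
    rw [k21, k12, k20] at a11
    linear_combination a11
  have c1 : K 1 0 * (K 0 2 + (K 1 0 + t / 2) ^ 2 / 4) = 0 := by
    refine (mul_eq_zero.1 (?_ : (6 * f 0 * t) * _ = 0)).resolve_left (by positivity)
    rw [k22, k21, k20, k12, k11] at a21
    linear_combination a21
  obtain ⟨m, hm⟩ : ∃ m, t = 4 * m - 2 * K 1 0 := ⟨(t + 2 * K 1 0) / 4, by ring⟩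
  have hbm : K 1 0 ≠ 2 * m := fun h => ht (by rw [hm, h]; ring)
  by_cases hb : K 1 0 = 0 ∧ K 0 2 = 0
  · have hK : K = K5 := by
      ext i j; fin_cases i <;> fin_cases j <;> simp [K5, hb.1, hb.2, h0, h1, k12, k20, k21, k22, k11]
    exact ⟨5, hK ▸ Equivalent.refl K5⟩
  have k02 : K 0 2 = -m ^ 2 := by
    rcases mul_eq_zero.1 c1 with h | h
    · have h2 : K 0 2 ≠ 0 := fun h' => hb ⟨h, h'⟩
      rw [k22, k21, k20, k12, k11, h, hm, h] at a22
      have : (f 0 * m * K 0 2 * 48) * (K 0 2 + m ^ 2) = 0 := by linear_combination a22 / 2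
      have hm0 : m ≠ 0 := by rintro rfl; simp [h] at hbm
      have := (mul_eq_zero.1 this).resolve_left (by positivity)
      linarith
    · rw [hm] at h
      linear_combination h
  obtain ⟨d, hd⟩ := listed_of_scaling (K 1 0) m hbm
  refine ⟨d, ?_⟩
  convert hd using 1
  ext i j; fin_cases i <;> fin_cases j <;> simp [h0, h1]
  · exact k02
  · rw [k11, k02, hm]; ring
  · rw [k12, k02, hm]; ring
  · rw [k20, k02, hm]; ring
  · rw [k21, k20, k11, k02, hm]; ring
  · rw [k22, k12, k11, k02, hm]; ring

/-- A point `m` with `N(m, m) ≠ 0` can be sent to infinity, which makes `α ≠ 0`; a translation then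
removes `β`. -/
theorem exists_equivalent_normal {K : Matrix (Fin 3) (Fin 3) ℝ} {m : ℝ}
    (hm : K 0 0 * m ^ 4 + 2 * (K 0 1 + K 1 0) * m ^ 3 + (K 0 2 + 2 * K 1 1 + K 2 0) * m ^ 2
      + 2 * (K 1 2 + K 2 1) * m + K 2 2 ≠ 0) :
    ∃ K', Equivalent K K' ∧ K' 0 0 = 1 ∧ K' 0 1 = 0 := by
  obtain ⟨K₁, h1, e1⟩ : ∃ K₁, Equivalent K K₁ ∧ K₁ 0 0 = 1 := by
    refine ⟨_, equivalent_pullback K (g := !![m, 1; 1, 0]) (by simp) (inv_ne_zero hm), ?_⟩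
    refine Eq.trans ?_ (inv_mul_cancel₀ hm)
    simp [unform, form, pullback, sq2, Matrix.mul_apply, Fin.sum_univ_succ]
    left
    ring
  refine ⟨_, h1.trans (equivalent_pullback K₁ (g := !![1, -K₁ 0 1; 0, 1]) (by simp)
    (one_ne_zero)), ?_, ?_⟩
  · simp [unform, form, pullback, sq2, Matrix.mul_apply, Fin.sum_univ_succ, e1]
  · simp [unform, form, pullback, sq2, Matrix.mul_apply, Fin.sum_univ_succ, e1]

/-- The equations with `N(x, x) = 0`. Here `N(x, y)` is `x - y` times a bilinear polynomial, whose
values on the diagonal are `2 (β u² + (γ + l) u + δ)`. If these vanish, the equation is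
a multiple of `K4b`; else a point where they do not is sent to infinity. -/
theorem exists_listed_of_diagonal_eq_zero {K : Matrix (Fin 3) (Fin 3) ℝ} (hK : K ≠ 0)
    (h4 : K 0 0 = 0) (h3 : K 1 0 = -K 0 1) (h2 : K 2 0 = -2 * K 1 1 - K 0 2)
    (h1 : K 2 1 = -K 1 2) (h0 : K 2 2 = 0) : ∃ d, Listed K d := by
  by_cases hv : K 0 1 = 0 ∧ K 0 2 + K 1 1 = 0 ∧ K 1 2 = 0
  · obtain ⟨v1, v2, v3⟩ := hv
    have hK' : K = K 0 2 • K4b := by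
      ext i j; fin_cases i <;> fin_cases j <;> simp [K4b, h4, h3, h2, h1, h0, v1, v3] <;> linarith
    have hγ : K 0 2 ≠ 0 := fun h => hK (by rw [hK', h, zero_smul])
    refine ⟨4, Or.inr ?_⟩
    rw [hK']
    exact (equivalent_smul K4b hγ).symm
  obtain ⟨m, hm⟩ : ∃ m : ℝ, K 0 1 * m ^ 2 + (K 0 2 + K 1 1) * m + K 1 2 ≠ 0 := by
    by_contra! h
    exact hv (quadratic_eq_zero (S := univ) infinite_univ fun u _ => h u)
  obtain ⟨γ, l, δ, h⟩ : ∃ γ l δ : ℝ,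
      Equivalent K !![0, 1, γ; -1, l, δ; -2 * l - γ, -δ, 0] := by
    set D := K 0 1 * m ^ 2 + (K 0 2 + K 1 1) * m + K 1 2 with hD
    refine ⟨D⁻¹ * (2 * K 0 1 * m + 2 * K 1 1 + K 0 2), -D⁻¹ * K 1 1, D⁻¹ * K 0 1, ?_⟩
    convert equivalent_pullback K (g := !![m, 1; 1, 0]) (by simp)
      (neg_ne_zero.2 (inv_ne_zero hm)) using 1
    ext i j; fin_cases i <;> fin_cases j <;>
      simp [unform, form, pullback, sq2, Matrix.mul_apply, Fin.sum_univ_succ, h0, h1, h2, h3, h4,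
        -mul_eq_zero, -zero_eq_mul] <;> field_simp <;> (try rw [hD]) <;> ring
  obtain ⟨l', δ', h'⟩ : ∃ l' δ' : ℝ, Equivalent K !![0, 1, 0; -1, l', δ'; -2 * l', -δ', 0] := by
    refine ⟨l, -(-γ / 2) ^ 2 + l * (-γ / 2) + δ, h.trans ?_⟩
    convert equivalent_pullback _ (g := !![1, -γ / 2; 0, 1]) (by simp) one_ne_zero using 1
    ext i j; fin_cases i <;> fin_cases j <;>
      simp [unform, form, pullback, sq2, Matrix.mul_apply, Fin.sum_univ_succ] <;> ring
  by_cases hl : (l', δ') = (0, 0)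
  · obtain ⟨rfl, rfl⟩ := Prod.mk.inj hl
    exact ⟨3, Or.inr (Or.inr (by simpa [K3c] using h'))⟩
  · exact ⟨2, (DimTwo.family6 l' δ' hl).listed.of_equivalent h'⟩

/-- An equation with a symmetry besides `∂_t` is equivalent to a listed one. -/
theorem exists_listed {K : Matrix (Fin 3) (Fin 3) ℝ} (hK : K ≠ 0) {w : Coef}
    (hw : w ∈ sol (form K)) (hw2 : w.2 ≠ 0) : ∃ d, Listed K d := by
  by_cases hdiag : ∃ m : ℝ, K 0 0 * m ^ 4 + 2 * (K 0 1 + K 1 0) * m ^ 3 +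
      (K 0 2 + 2 * K 1 1 + K 2 0) * m ^ 2 + 2 * (K 1 2 + K 2 1) * m + K 2 2 ≠ 0
  · obtain ⟨m, hm⟩ := hdiag
    obtain ⟨K', hKK', h0, h1⟩ := exists_equivalent_normal hm
    obtain ⟨g, c, hg, hc, h⟩ := equivalent_iff.1 hKK'.symm
    have hw' : transport g w ∈ sol (form K') := by
      rw [← sol_smul hc, ← h]
      exact transport_mem_sol hw
    have hw2' : (transport g w).2 ≠ 0 := fun h => by
      refine hw2 (congrArg Prod.snd (transport_injective hg (a₁ := (0, w.2)) (a₂ := 0) ?_))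
      rw [map_zero]
      exact Prod.ext rfl h
    obtain ⟨hs, ha⟩ := mem_sol_form.1 hw'
    generalize transport g w = w' at *
    suffices ∃ d, Listed K' d by
      obtain ⟨d, hd⟩ := this
      exact ⟨d, hd.of_equivalent hKK'⟩
    by_cases hg0 : w'.2.2.2 = 0
    · by_cases hf0 : w'.2.2.1 = 0
      · have := hs.e00
        rw [hf0, h0] at this
        exact absurd (Prod.ext (by simpa using this) (Prod.ext hf0 hg0)) hw2'
      · exact exists_listed_of_symEqs h0 h1 hf0 hs
    · exact exists_listed_of_antiEqs h0 h1 hg0 ha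
  · push Not at hdiag
    have h0 : K 2 2 = 0 := by simpa using hdiag 0
    have p1 := hdiag 1
    have p2 := hdiag (-1)
    have p3 := hdiag 2
    have p4 := hdiag (-2)
    exact exists_listed_of_diagonal_eq_zero hK (by linarith) (by linarith) (by linarith)
      (by linarith) h0

/-! ### The solutions of the determining equations for the listed equations -/

/-- `c 0, …, c (d - 1)` form a basis of the solutions of the determining equations. -/
def IsSolBasis {d : ℕ} (c : Fin d → Coef) (K : Matrix (Fin 3) (Fin 3) ℝ) : Prop :=
  LinearIndependent ℝ c ∧ Submodule.span ℝ (range c) = sol (form K)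

theorem IsSolBasis.finrank {d : ℕ} {c : Fin d → Coef} {K : Matrix (Fin 3) (Fin 3) ℝ}
    (h : IsSolBasis c K) : Module.finrank ℝ (sol (form K)) = d := by
  rw [← h.2, finrank_span_eq_card h.1, Fintype.card_fin]

theorem coef_ext {v w : Coef} (h1 : v.1 = w.1) (h2 : v.2.1 = w.2.1)
    (f0 : v.2.2.1 0 = w.2.2.1 0) (f1 : v.2.2.1 1 = w.2.2.1 1) (f2 : v.2.2.1 2 = w.2.2.1 2)
    (g0 : v.2.2.2 0 = w.2.2.2 0) (g1 : v.2.2.2 1 = w.2.2.2 1) (g2 : v.2.2.2 2 = w.2.2.2 2) :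
    v = w := by
  refine Prod.ext h1 (Prod.ext h2 (Prod.ext ?_ ?_))
  · ext i; fin_cases i <;> assumption
  · ext i; fin_cases i <;> assumption

theorem isSolBasis_of {d : ℕ} {c : Fin d → Coef} {K : Matrix (Fin 3) (Fin 3) ℝ}
    (hli : LinearIndependent ℝ c) (hmem : ∀ i, c i ∈ sol (form K))
    (hspan : ∀ w ∈ sol (form K), ∃ a : Fin d → ℝ, ∑ i, a i • c i = w) : IsSolBasis c K :=
  ⟨hli, le_antisymm (Submodule.span_le.2 (range_subset_iff.2 hmem)) fun w hw =>
    (Submodule.mem_span_range_iff_exists_fun ℝ).2 (hspan w hw)⟩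

theorem isSolBasis_K5 :
    IsSolBasis ![(1, 0, 0, 0), (0, 2, ![0, -1, 0], 0), (0, 0, 0, ![0, 1, 0]),
      (0, 0, ![1, 0, 0], 0), (0, 0, 0, ![1, 0, 0])] K5 := by
  refine isSolBasis_of ?_ ?_ ?_
  · rw [Fintype.linearIndependent_iff]
    intro a ha
    have h1 := congrArg (fun w : Coef => w.1) ha
    have h2 := congrArg (fun w : Coef => w.2.1) ha
    have h3 := congrArg (fun w : Coef => w.2.2.1 0) ha
    have h4 := congrArg (fun w : Coef => w.2.2.2 0) ha
    have h5 := congrArg (fun w : Coef => w.2.2.2 1) ha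
    simp [Fin.sum_univ_succ] at h1 h2 h3 h4 h5
    intro i; fin_cases i <;> assumption
  · intro i
    rw [mem_sol_form]
    fin_cases i <;> refine ⟨?_, ?_⟩ <;> constructor <;> simp [K5]
  · intro w hw
    obtain ⟨hs, ha⟩ := mem_sol_form.1 hw
    have h1 := hs.e00
    have h2 := hs.e01
    have h3 := ha.e01
    simp [K5] at h1 h2 h3
    refine ⟨![w.1, -w.2.2.1 1, w.2.2.2 1, w.2.2.1 0, w.2.2.2 0], ?_⟩
    apply coef_ext <;> simp [Fin.sum_univ_succ] <;> linarith

theorem isSolBasis_K4a {l : ℝ} (hl : l ≠ 0) :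
    IsSolBasis ![(1, 0, 0, 0), (0, 0, 0, ![0, 1, 0]), (0, 0, 0, ![1, 0, -l]),
      (0, 0, ![1, 0, l], 0)] (K4a l) := by
  refine isSolBasis_of ?_ ?_ ?_
  · rw [Fintype.linearIndependent_iff]
    intro a ha
    have h1 := congrArg (fun w : Coef => w.1) ha
    have h3 := congrArg (fun w : Coef => w.2.2.1 0) ha
    have h4 := congrArg (fun w : Coef => w.2.2.2 0) ha
    have h5 := congrArg (fun w : Coef => w.2.2.2 1) ha
    simp [Fin.sum_univ_succ] at h1 h3 h4 h5
    intro i; fin_cases i <;> assumption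
  · intro i
    rw [mem_sol_form]
    fin_cases i <;> refine ⟨?_, ?_⟩ <;> constructor <;> simp [K4a] <;> ring
  · intro w hw
    obtain ⟨hs, ha⟩ := mem_sol_form.1 hw
    have h1 := hs.e00
    have h2 := hs.e01
    have h3 := ha.e01
    have h4 := hs.e11
    simp [K4a, hl] at h1 h2 h3 h4
    refine ⟨![w.1, w.2.2.2 1, w.2.2.2 0, w.2.2.1 0], ?_⟩
    apply coef_ext <;> simp [Fin.sum_univ_succ] <;> linarith

theorem isSolBasis_K4b :
    IsSolBasis ![(1, 0, 0, 0), (0, 0, ![0, 0, 1], 0), (0, 0, ![0, 1, 0], 0),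
      (0, 0, ![1, 0, 0], 0)] K4b := by
  refine isSolBasis_of ?_ ?_ ?_
  · rw [Fintype.linearIndependent_iff]
    intro a ha
    have h1 := congrArg (fun w : Coef => w.1) ha
    have h3 := congrArg (fun w : Coef => w.2.2.1 0) ha
    have h4 := congrArg (fun w : Coef => w.2.2.1 1) ha
    have h5 := congrArg (fun w : Coef => w.2.2.1 2) ha
    simp [Fin.sum_univ_succ] at h1 h3 h4 h5
    intro i; fin_cases i <;> assumption
  · intro i
    rw [mem_sol_form]
    fin_cases i <;> refine ⟨?_, ?_⟩ <;> constructor <;> simp [K4b]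
  · intro w hw
    obtain ⟨hs, ha⟩ := mem_sol_form.1 hw
    have h1 := hs.e02
    have h2 := ha.e02
    have h3 := ha.e01
    have h4 := ha.e12
    simp [K4b] at h1 h2 h3 h4
    refine ⟨![w.1, w.2.2.1 2, w.2.2.1 1, w.2.2.1 0], ?_⟩
    apply coef_ext <;> simp [Fin.sum_univ_succ] <;> linarith

theorem isSolBasis_K3a {γ : ℝ} (hγ : γ ≠ 0) :
    IsSolBasis ![(1, 0, 0, 0), (0, 0, 0, ![1, 0, γ]), (0, 0, ![1, 0, γ], 0)] (K3a γ) := by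
  refine isSolBasis_of ?_ ?_ ?_
  · rw [Fintype.linearIndependent_iff]
    intro a ha
    have h1 := congrArg (fun w : Coef => w.1) ha
    have h3 := congrArg (fun w : Coef => w.2.2.1 0) ha
    have h4 := congrArg (fun w : Coef => w.2.2.2 0) ha
    simp [Fin.sum_univ_succ] at h1 h3 h4
    intro i; fin_cases i <;> assumption
  · intro i
    rw [mem_sol_form]
    fin_cases i <;> refine ⟨?_, ?_⟩ <;> constructor <;> simp [K3a] <;> ring
  · intro w hw
    obtain ⟨hs, ha⟩ := mem_sol_form.1 hw
    have h1 := hs.e00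
    have h2 := hs.e01
    have h3 := hs.e02
    have h4 := ha.e01
    have h5 := ha.e02
    simp [K3a, hγ] at h1 h2 h3 h4 h5
    refine ⟨![w.1, w.2.2.2 0, w.2.2.1 0], ?_⟩
    apply coef_ext <;> simp [Fin.sum_univ_succ] <;> linarith

theorem isSolBasis_K3b {μ : ℝ} (hμ : μ ≠ 0) :
    IsSolBasis ![(1, 0, 0, 0), (0, 0, 0, ![1, -2 * μ, μ ^ 2]),
      (0, 1, ![-(1 / (4 * μ)), -1 / 2, 3 * μ / 4], 0)] (K3b μ) := by
  refine isSolBasis_of ?_ ?_ ?_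
  · rw [Fintype.linearIndependent_iff]
    intro a ha
    have h1 := congrArg (fun w : Coef => w.1) ha
    have h3 := congrArg (fun w : Coef => w.2.1) ha
    have h4 := congrArg (fun w : Coef => w.2.2.2 0) ha
    simp [Fin.sum_univ_succ] at h1 h3 h4
    intro i; fin_cases i <;> assumption
  · intro i
    rw [mem_sol_form]
    fin_cases i <;> refine ⟨?_, ?_⟩ <;> constructor <;> simp [K3b] <;> field_simp <;> ring
  · intro w hw
    obtain ⟨hs, ha⟩ := mem_sol_form.1 hw
    have h1 := hs.e00
    have h2 := hs.e01
    have h3 := hs.e02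
    have h4 := ha.e01
    have h5 := ha.e02
    simp [K3b] at h1 h2 h3 h4 h5
    have h3' : w.2.1 = -(4 * μ) * w.2.2.1 0 :=
      mul_left_cancel₀ (pow_ne_zero 2 hμ) (by linarith)
    have h5' : w.2.2.2 1 = -(2 * μ) * w.2.2.2 0 :=
      mul_left_cancel₀ (pow_ne_zero 2 hμ) (by linarith)
    have h6 : w.2.2.1 1 = 2 * μ * w.2.2.1 0 := by linarith
    refine ⟨![w.1, w.2.2.2 0, w.2.1], ?_⟩
    apply coef_ext <;> simp [Fin.sum_univ_succ, h3', h5', h6] <;> field_simp <;> linarith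

theorem isSolBasis_K3c :
    IsSolBasis ![(1, 0, 0, 0), (0, 1, ![0, -1, 0], 0), (0, 0, ![1, 0, 0], 0)] K3c := by
  refine isSolBasis_of ?_ ?_ ?_
  · rw [Fintype.linearIndependent_iff]
    intro a ha
    have h1 := congrArg (fun w : Coef => w.1) ha
    have h3 := congrArg (fun w : Coef => w.2.1) ha
    have h4 := congrArg (fun w : Coef => w.2.2.1 0) ha
    simp [Fin.sum_univ_succ] at h1 h3 h4
    intro i; fin_cases i <;> assumption
  · intro i
    rw [mem_sol_form]
    fin_cases i <;> refine ⟨?_, ?_⟩ <;> constructor <;> simp [K3c]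
  · intro w hw
    obtain ⟨hs, ha⟩ := mem_sol_form.1 hw
    have h1 := hs.e01
    have h2 := hs.e02
    have h3 := ha.e00
    have h4 := ha.e01
    have h5 := ha.e02
    simp [K3c] at h1 h2 h3 h4 h5
    refine ⟨![w.1, w.2.1, w.2.2.1 0], ?_⟩
    apply coef_ext <;> simp [Fin.sum_univ_succ] <;> linarith

theorem isSolBasis_pair {K : Matrix (Fin 3) (Fin 3) ℝ} {v : ℝ × (Fin 3 → ℝ) × (Fin 3 → ℝ)}
    (hv : v ≠ 0) (hs : SymEqs K v.1 v.2.1) (ha : AntiEqs K v.2.2)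
    (h : ∀ s f g, SymEqs K s f → AntiEqs K g → ∃ r : ℝ, (s, f, g) = r • v) :
    IsSolBasis ![(1, 0, 0, 0), (0, v)] K := by
  refine isSolBasis_of ?_ ?_ ?_
  · rw [LinearIndependent.pair_iff]
    intro a b hab
    have h1 := congrArg Prod.fst hab
    have h2 := congrArg Prod.snd hab
    simp at h1
    rw [h1] at h2
    simp [hv] at h2
    exact ⟨h1, h2⟩
  · intro i
    fin_cases i
    · exact time_mem_sol _
    · exact mem_sol_form.2 ⟨hs, ha⟩
  · rintro ⟨a, s, f, g⟩ hw
    obtain ⟨hs, ha⟩ := mem_sol_form.1 hw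
    obtain ⟨r, hr⟩ := h s f g hs ha
    refine ⟨![a, r], ?_⟩
    rw [hr]
    ext <;> simp

theorem isSolBasis_commuting {b γ l : ℝ} (h : γ ≠ 0 ∧ (b, l) ≠ (0, 0) ∨ b ≠ 0) :
    IsSolBasis ![(1, 0, 0, 0), (0, 0, ![1, b, l + γ], 0)]
      !![1, 0, γ; b, l, 0; γ + b ^ 2, b * (l + γ), (l + γ) ^ 2] := by
  refine isSolBasis_pair ?_ ?_ ?_ ?_
  · intro h
    have := congrArg (fun v => v.2.1 0) h
    simp at this
  · constructor <;> simp <;> ring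
  · constructor <;> simp
  · rintro s f g ⟨a00, a01, a02, a10, -, -, -, -, -⟩ ⟨b00, b01, b02, b10, -, b12, -, -, -⟩
    simp at a00 a01 a02 a10 b00 b01 b02 b10 b12
    have f2 : f 2 = f 0 * (l + γ) := by linarith
    have hs : s = 0 := by
      rcases h with ⟨hγ, -⟩ | hb
      · simpa [hγ] using a02
      · refine mul_left_cancel₀ hb ?_
        linear_combination 2 * a10 - 2 * f2 - b * a00
    have f1 : f 1 = f 0 * b := by linarith
    have gb : g 1 * b = 0 := by
      rcases b00 with h | h
      · rw [h] at b10 b01; linarith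
      · rw [h, mul_zero]
    have g0 : g 0 = 0 := by
      rcases b00 with h' | h'
      · exact h'
      · subst h'
        rcases h with ⟨hγ, hl⟩ | hb
        · have hl' : l ≠ 0 := by rintro rfl; exact hl rfl
          refine (mul_eq_zero.1 (?_ : (4 * γ * l) * g 0 = 0)).resolve_left (by positivity)
          simp [hγ] at b02
          linear_combination (-1) * b12 + (l - γ) * b01
        · exact absurd rfl hb
    have g1 : g 1 = 0 := by
      rcases h with ⟨hγ, -⟩ | hb
      · simpa [hγ] using b02
      · simpa [hb] using gb
    have g2 : g 2 = 0 := by rw [g0] at b01; linarith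
    refine ⟨f 0, ?_⟩
    ext i
    · simp [hs]
    · fin_cases i <;> simp [f1, f2]
    · fin_cases i <;> simp [g0, g1, g2]

theorem isSolBasis_scaling {b m : ℝ} (hb : b ≠ 0) (hm : m ≠ 0) (h : b ≠ 2 * m) :
    IsSolBasis ![(1, 0, 0, 0), (0, 1, ![-1 / (2 * (b - 2 * m)), -(b - m) / (b - 2 * m),
        -(2 * b * m - 3 * m ^ 2) / (2 * (b - 2 * m))], 0)]
      !![1, 0, -m ^ 2; b, 2 * b * m - 2 * m ^ 2, (b - 2 * m) * m ^ 2;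
        2 * b * m - m ^ 2, 2 * b * m ^ 2 - 2 * m ^ 3, 2 * b * m ^ 3 - 3 * m ^ 4] := by
  obtain ⟨k, rfl⟩ : ∃ k, b = k + 2 * m := ⟨b - 2 * m, by ring⟩
  have hk : k ≠ 0 := by simpa using h
  have hkm : k + 2 * m - 2 * m = k := by ring
  simp only [hkm]
  refine isSolBasis_pair ?_ ?_ ?_ ?_
  · intro h
    have := congrArg (fun v => v.1) h
    simp at this
  · constructor <;> simp <;> field_simp <;> ring
  · constructor <;> simp
  · rintro s f g ⟨a00, a01, a02, -, -, -, -, -, -⟩ ⟨b00, b01, b02, -, -, -, -, -, -⟩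
    simp at a00 a01 a02 b00 b01 b02
    have b00 : g 0 = 0 := b00.resolve_right fun h' => hb (by linarith)
    have hs : s = -2 * k * f 0 := mul_left_cancel₀ (pow_ne_zero 2 hm) (by linarith)
    have f0 : f 0 = s * (-1 / (2 * k)) := by rw [hs]; field_simp
    have f1 : f 1 = s * (-(k + 2 * m - m) / k) := by
      rw [hs]; field_simp; rw [hs] at a00; linarith
    have f2 : f 2 = s * (-(2 * (k + 2 * m) * m - 3 * m ^ 2) / (2 * k)) := by
      rw [hs]; field_simp; linarith
    have g1 : g 1 = 0 := by simpa [b00, hm] using b02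
    have g2 : g 2 = 0 := by rw [b00] at b01; linarith
    refine ⟨s, ?_⟩
    ext i
    · simp
    · fin_cases i
      exacts [f0, f1, f2]
    · fin_cases i <;> simp [b00, g1, g2]

theorem isSolBasis_family4 {b : ℝ} (hb : b ≠ 0) :
    IsSolBasis ![(1, 0, 0, 0), (0, 1, ![-(1 / (2 * b)), -1, 0], 0)]
      !![1, 0, 0; b, 0, 0; 0, 0, 0] := by
  refine isSolBasis_pair ?_ ?_ ?_ ?_
  · intro h
    have := congrArg (fun v => v.1) h
    simp at this
  · constructor <;> simp
    field_simp
    ring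
  · constructor <;> simp
  · rintro s f g ⟨a00, a01, a02, a10, -, -, -, -, -⟩ ⟨b00, b01, b02, b10, -, -, -, -, -⟩
    simp [hb] at a00 a01 a02 a10 b00 b01 b02 b10
    have f1 : f 1 = -s := mul_left_cancel₀ hb (by rw [a01] at a10; linarith)
    have f0 : f 0 = -s / (2 * b) := by field_simp; linarith
    have g1 : g 1 = 0 := by simpa [b00, b01, hb] using b10
    refine ⟨s, ?_⟩
    ext i
    · simp
    · fin_cases i <;> simp [f0, f1, a01] ; ring
    · fin_cases i <;> simp [b00, g1, b01]

theorem isSolBasis_family6 {l δ : ℝ} (h : (l, δ) ≠ (0, 0)) :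
    IsSolBasis ![(1, 0, 0, 0), (0, 0, ![1, l, δ], 0)]
      !![0, 1, 0; -1, l, δ; -2 * l, -δ, 0] := by
  refine isSolBasis_pair ?_ ?_ ?_ ?_
  · intro h
    have := congrArg (fun v => v.2.1 0) h
    simp at this
  · constructor <;> simp <;> ring
  · constructor <;> simp
  · rintro s f g ⟨-, a01, a02, -, a11, a12, -, -, -⟩ ⟨b00, b01, b02, -, -, -, -, -, -⟩
    simp at a01 a02 a11 a12 b00 b01 b02
    have g0 : g 0 = 0 := b00
    have f2 : f 2 = f 0 * δ := by linarith
    have hs : s = 0 := by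
      by_contra hs
      have hl : l = 0 := a11.resolve_left hs
      have hδ : δ = 0 := (mul_eq_zero.1
        (by linear_combination a12 - l * f2 + δ * a01 : (2 * s) * δ = 0)).resolve_left (by simpa)
      exact h (by rw [hl, hδ])
    rw [g0] at b01 b02
    refine ⟨f 0, ?_⟩
    ext i
    · simp [hs]
    · fin_cases i <;> simp [f2] ; linarith
    · fin_cases i <;> simp [g0] <;> linarith

theorem isSolBasis_family7 {γ l δ : ℝ} (hγ : γ ≠ 0)
    (h : (2 * l * γ ^ 2 + δ ^ 2, δ * (2 * γ - l),
      δ * (2 * γ ^ 3 + l ^ 2 * γ - l * γ ^ 2 + δ ^ 2)) ≠ (0, 0, 0)) :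
    IsSolBasis ![(1, 0, 0, 0), (0, 0, 0, ![1, δ / γ, γ - l])]
      !![1, 0, γ; 0, l, δ; γ, δ, (l - γ) ^ 2 + δ ^ 2 / γ] := by
  refine isSolBasis_pair ?_ ?_ ?_ ?_
  · intro h
    have := congrArg (fun v => v.2.2 0) h
    simp at this
  · constructor <;> simp
  · constructor <;> simp <;> field_simp <;> ring
  · rintro s f g ⟨a00, a01, a02, -, a11, a12, -, -, a22⟩ ⟨-, b01, b02, -, -, -, -, -, -⟩
    simp at a00 a01 a02 a11 a12 a22 b01 b02
    have f2 : f 2 = f 0 * (l + γ) := by linarith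
    have f1 : f 1 = -s / 2 := by linarith
    have hs : s = 0 := by
      by_contra hs
      have hl : l = 2 * γ := mul_left_cancel₀ hs (by linear_combination a11 - 2 * a02)
      have hδ : δ ^ 2 = -4 * γ ^ 3 := by
        rw [f2, f1] at a22
        field_simp at a22
        rw [hl] at a22
        refine mul_left_cancel₀ hs ?_
        linear_combination a22 / 2 + 3 * γ ^ 2 * a02
      refine h ?_
      rw [hl]
      refine Prod.ext ?_ (Prod.ext ?_ ?_)
      · simp only; linear_combination hδ
      · simp only; ring
      · simp only; linear_combination δ * hδ
    rw [hs] at f1 a02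
    have f0 : f 0 = 0 := by
      by_contra hf0
      have hδ : δ = 0 := by simpa [hf0] using a02
      subst hδ
      rw [f2] at a12
      have hl : l = 0 := (mul_eq_zero.1 (?_ : (4 * f 0 * γ) * l = 0)).resolve_left (by positivity)
      · exact h (by simp [hl])
      · simp at a12
        linear_combination a12
    have f2' : f 2 = 0 := by rw [f2, f0, zero_mul]
    refine ⟨g 0, ?_⟩
    ext i
    · simp [hs]
    · fin_cases i <;> simp [f0, f1, f2']
    · fin_cases i <;> simp
      · field_simp; linarith
      · linarith

theorem isSolBasis_family8 {l w : ℝ} (hw : w ≠ l ^ 2) :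
    IsSolBasis ![(1, 0, 0, 0), (0, 0, 0, ![0, 1, 0])] !![1, 0, 0; 0, l, 0; 0, 0, w] := by
  refine isSolBasis_pair ?_ ?_ ?_ ?_
  · intro h
    have := congrArg (fun v => v.2.2 1) h
    simp at this
  · constructor <;> simp
  · constructor <;> simp
  · rintro s f g ⟨a00, a01, -, -, a11, a12, -, -, a22⟩ ⟨-, b01, -, -, -, b12, -, -, -⟩
    simp at a00 a01 a11 a12 a22 b01 b12
    have hw' : w - l ^ 2 ≠ 0 := sub_ne_zero.2 hw
    have f0 : f 0 = 0 := (mul_eq_zero.1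
      (by linear_combination -a12 + l * a01 : (w - l ^ 2) * f 0 = 0)).resolve_left hw'
    have g0 : g 0 = 0 := (mul_eq_zero.1
      (by linear_combination -b12 + l * b01 : (w - l ^ 2) * g 0 = 0)).resolve_left hw'
    rw [f0] at a01
    rw [g0] at b01
    have hs : s = 0 := by
      by_contra hs
      have hl : l = 0 := by simpa [hs] using a11
      refine hw' ((mul_eq_zero.1 (?_ : (2 * s) * (w - l ^ 2) = 0)).resolve_left (by simpa))
      rw [hl]
      linear_combination a22 + w * a00
    refine ⟨g 1, ?_⟩
    ext i
    · simp [hs]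
    · fin_cases i <;> simp <;> linarith
    · fin_cases i <;> simp <;> linarith

/-- The quadratic polynomial with given coefficients. -/
def quad (a : Fin 3 → ℝ) : ℝ[X] := C (a 0) * X ^ 2 + C (a 1) * X + C (a 2)

theorem DimTwo.isSolBasis {K : Matrix (Fin 3) (Fin 3) ℝ} {τ φ ψ : ℝ[X]} (h : DimTwo K τ φ ψ) :
    ∃ s f g, τ = C s * X ∧ φ = quad f ∧ ψ = quad g ∧
      IsSolBasis ![(1, 0, 0, 0), (0, s, f, g)] K := by
  cases h with
  | family1 b γ l hγ h =>
    refine ⟨_, _, _, ?_, ?_, ?_, isSolBasis_commuting (Or.inl ⟨hγ, h⟩)⟩ <;> simp [quad]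
    ring
  | family2 ε γ δ b c e l w hε hγ hb hc he hl hw hb0 hδ =>
    set m := ε * √(-γ) with hm
    have hε2 : ε ^ 2 = 1 := by rcases hε with h | h <;> rw [h] <;> norm_num
    have hr : √(-γ) ^ 2 = -γ := Real.sq_sqrt (by linarith)
    have hr0 : √(-γ) ≠ 0 := (Real.sqrt_pos.2 (by linarith)).ne'
    have hm2 : γ = -m ^ 2 := by rw [hm, mul_pow, hε2, hr]; ring
    have hm0 : m ≠ 0 := by rintro h; rw [h] at hm2; simp at hm2; exact hγ.ne hm2
    have hδ' : δ = (b - 2 * m) * m ^ 2 := by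
      have h1 : δ / γ = 2 * m - b := by rw [hb, hm]; ring
      rw [(div_eq_iff hγ.ne).1 h1, hm2]; ring
    have hinv : ε * (δ / √(-γ)) = δ / m := by
      rw [eq_div_iff hm0, hm]; field_simp; linear_combination hε2
    have hε3 : ε * √(-γ) ^ 3 = m ^ 3 := by
      rw [hm]; linear_combination (-ε * √(-γ) ^ 3) * hε2
    have hc' : c = 2 * b * m - m ^ 2 := by
      rw [hc, mul_assoc 2 ε, hinv, hδ', hm2]; field_simp; ring
    have he' : e = 2 * b * m ^ 2 - 2 * m ^ 3 := by rw [he, hε3, hδ']; ring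
    have hl' : l = 2 * b * m - 2 * m ^ 2 := by rw [hl, hc', hm2]; ring
    have hw' : w = 2 * b * m ^ 3 - 3 * m ^ 4 := by
      rw [hw, mul_assoc 2 ε, ← hm, hδ', hm2]; ring
    have hbm : b ≠ 2 * m := by rintro h; rw [h] at hδ'; simp at hδ'; exact hδ hδ'
    have hbm' : b - 2 * m ≠ 0 := sub_ne_zero.2 hbm
    clear_value m
    clear hb hc he hl hw hγ hinv hε3 hr hr0 hm
    subst hm2 hδ' hc' he' hl' hw'
    refine ⟨_, _, _, ?_, ?_, ?_, isSolBasis_scaling hb0 hm0 hbm⟩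
    · simp
    · simp only [quad]
      rw [show (2 * b * m - 2 * m ^ 2 + -m ^ 2) * (-m ^ 2 / (2 * ((b - 2 * m) * m ^ 2))) =
          -(2 * b * m - 3 * m ^ 2) / (2 * (b - 2 * m)) by field_simp; ring,
        show 1 / 2 * (b * (-m ^ 2 / ((b - 2 * m) * m ^ 2)) - 1) = -(b - m) / (b - 2 * m) by
          field_simp; ring,
        show -m ^ 2 / (2 * ((b - 2 * m) * m ^ 2)) = -1 / (2 * (b - 2 * m)) by field_simp]
      simp
      ring
    · simp [quad]
  | family3 b l hb hl =>
    refine ⟨0, ![1, b, l], 0, ?_, ?_, ?_, ?_⟩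
    · simp
    · simp [quad]; ring
    · simp [quad]
    · simpa using isSolBasis_commuting (γ := 0) (l := l) (Or.inr hb)
  | family4 b hb =>
    refine ⟨_, _, _, ?_, ?_, ?_, isSolBasis_family4 hb⟩ <;> simp [quad]
  | family5 b hb =>
    refine ⟨0, ![1, b, b ^ 2], 0, ?_, ?_, ?_, ?_⟩
    · simp
    · simp [quad]; ring
    · simp [quad]
    · convert isSolBasis_commuting (γ := 0) (l := b ^ 2) (Or.inr hb) using 1
      · simp
      · ext i j; fin_cases i <;> fin_cases j <;> simp <;> ring
  | family6 l δ h =>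
    refine ⟨_, _, _, ?_, ?_, ?_, isSolBasis_family6 h⟩ <;> simp [quad]
    ring
  | family7 γ l δ hγ h =>
    refine ⟨_, _, _, ?_, ?_, ?_, isSolBasis_family7 hγ h⟩ <;> simp [quad]
    ring
  | family8 l w hw =>
    refine ⟨_, _, _, ?_, ?_, ?_, isSolBasis_family8 hw⟩ <;> simp [quad]

theorem Listed.finrank_sol {K : Matrix (Fin 3) (Fin 3) ℝ} {d : ℕ} (h : Listed K d) :
    Module.finrank ℝ (sol (form K)) = d := by
  match d, h with
  | 5, h => exact (Equivalent.finrank_sol h).trans isSolBasis_K5.finrank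
  | 4, Or.inl ⟨l, hl, h⟩ =>
    have hl : l ≠ 0 := by rcases hl with rfl | rfl <;> norm_num
    exact (Equivalent.finrank_sol h).trans (isSolBasis_K4a hl).finrank
  | 4, Or.inr h => exact (Equivalent.finrank_sol h).trans isSolBasis_K4b.finrank
  | 3, Or.inl ⟨l, hl, h⟩ =>
    have hl : l ≠ 0 := by rcases hl with rfl | rfl <;> norm_num
    exact (Equivalent.finrank_sol h).trans (isSolBasis_K3a hl).finrank
  | 3, Or.inr (Or.inl ⟨μ, hμ, h⟩) => exact (Equivalent.finrank_sol h).trans (isSolBasis_K3b hμ).finrank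
  | 3, Or.inr (Or.inr h) => exact (Equivalent.finrank_sol h).trans isSolBasis_K3c.finrank
  | 2, ⟨L, τ, φ, ψ, hL, h⟩ =>
    obtain ⟨s, f, g, -, -, -, hb⟩ := hL.isSolBasis
    exact (Equivalent.finrank_sol h).trans hb.finrank

theorem Listed.mem_Icc {K : Matrix (Fin 3) (Fin 3) ℝ} {d : ℕ} (h : Listed K d) :
    2 ≤ d ∧ d ≤ 5 := by
  match d, h with
  | 5, _ => simp
  | 4, _ => simp
  | 3, _ => simp
  | 2, _ => simp

theorem finrank_sol_eq_one_or_listed {K : Matrix (Fin 3) (Fin 3) ℝ} (hK : K ≠ 0) :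
    Module.finrank ℝ (sol (form K)) = 1 ∨ ∃ d, Listed K d := by
  by_cases h : ∃ w ∈ sol (form K), w.2 ≠ 0
  · obtain ⟨w, hw, hw2⟩ := h
    exact Or.inr (exists_listed hK hw hw2)
  · push Not at h
    left
    refine finrank_eq_one (⟨(1, 0, 0, 0), time_mem_sol _⟩ : sol (form K)) ?_ ?_
    · intro h
      have := congrArg (fun w : sol (form K) => w.1.1) h
      simp at this
    · rintro ⟨w, hw⟩
      refine ⟨w.1, Subtype.ext (Prod.ext ?_ ?_)⟩
      · simp
      · rw [h w hw]; ext <;> simp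

/-- The dimension of the solution space is `d ≥ 2` iff the equation is equivalent to one of
those listed under `d`. -/
theorem finrank_sol_eq_iff {K : Matrix (Fin 3) (Fin 3) ℝ} (hK : K ≠ 0) {d : ℕ} (hd : 2 ≤ d) :
    Module.finrank ℝ (sol (form K)) = d ↔ Listed K d := by
  refine ⟨fun h => ?_, Listed.finrank_sol⟩
  rcases finrank_sol_eq_one_or_listed hK with h1 | ⟨d', hd'⟩
  · omega
  · rw [← h, hd'.finrank_sol]
    exact hd'

/-! ### Linearization of the right-hand side -/

/-- The biquadratic polynomial `N(x, y)` of an equation. -/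
def biq (K : Matrix (Fin 3) (Fin 3) ℝ) (x y : ℝ) : ℝ := P K y * x ^ 2 + 2 * Q K y * x + R K y

/-- `(z - x) ∂f/∂y` for the right-hand side `f(x, y, z)`. -/
def numDeriv (K : Matrix (Fin 3) (Fin 3) ℝ) (x y z : ℝ) : ℝ :=
  (2 * K 0 0 * y + 2 * K 0 1) * (z * x) + (2 * K 1 0 * y + K 1 1) * (z + x)
    + (2 * K 2 0 * y + 2 * K 2 1)

theorem hasDerivAt_rhs (K : Matrix (Fin 3) (Fin 3) ℝ) {x y z : ℝ} (h : z ≠ x) (a b c : ℝ) :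
    HasDerivAt (fun s : ℝ => rhs K (x + s * a) (y + s * b) (z + s * c))
      (biq K z y / (z - x) ^ 2 * a + numDeriv K x y z / (z - x) * b
        - biq K x y / (z - x) ^ 2 * c) 0 := by
  have line : ∀ p q : ℝ, HasDerivAt (fun s : ℝ => p + s * q) q 0 := fun p q => by
    simpa using ((hasDerivAt_id (0 : ℝ)).mul_const q).const_add p
  have hx := line x a
  have hy := line y b
  have hz := line z c
  have quad : ∀ k l m : ℝ, HasDerivAt (fun s : ℝ => k * (y + s * b) ^ 2 + l * (y + s * b) + m)
      ((2 * k * y + l) * b) 0 := fun k l m => by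
    refine ((((hy.pow 2).const_mul k).add (hy.const_mul l)).add_const m).congr_deriv ?_
    simp; ring
  have hP : HasDerivAt (fun s : ℝ => P K (y + s * b)) ((2 * K 0 0 * y + 2 * K 0 1) * b) 0 :=
    quad _ _ _
  have hQ : HasDerivAt (fun s : ℝ => Q K (y + s * b)) ((2 * K 1 0 * y + K 1 1) * b) 0 :=
    quad _ _ _
  have hR : HasDerivAt (fun s : ℝ => R K (y + s * b)) ((2 * K 2 0 * y + 2 * K 2 1) * b) 0 :=
    quad _ _ _
  have hzx : z - x ≠ 0 := sub_ne_zero.2 h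
  have hd := (((hP.mul (hz.mul hx)).add (hQ.mul (hz.add hx))).add hR).div (hz.sub hx)
    (by simpa using hzx)
  refine hd.congr_deriv ?_
  simp only [zero_mul, add_zero, biq, numDeriv, Pi.mul_apply, Pi.add_apply, Pi.sub_apply]
  field_simp
  ring

theorem rhs_eq_add (K : Matrix (Fin 3) (Fin 3) ℝ) {x z : ℝ} (y : ℝ) (h : z ≠ x) :
    rhs K x y z = P K y * x + Q K y + biq K x y / (z - x) := by
  have : z - x ≠ 0 := sub_ne_zero.2 h
  simp only [rhs, biq]
  field_simp
  ring

variable {I J : Opens ℝ}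

/-- The symmetry condition, with the derivatives carried out. -/
theorem isSymmetry_iff {K : Matrix (Fin 3) (Fin 3) ℝ} {V : PointField I J} :
    IsSymmetry K V ↔ ∀ t ∈ I, ∀ u : ℤ → ℝ, (∀ k, u k ∈ J) → (∀ k, u (k + 1) ≠ u (k - 1)) →
      ∀ n : ℤ,
        (fderiv ℝ (V.1 n) (t, u n) (1, flow K u n)).2
          - ((fderiv ℝ (V.1 n) (t, u n) (1, flow K u n)).1 * flow K u n
            + (V.1 n (t, u n)).1 *
              (biq K (u (n + 1)) (u n) / (u (n + 1) - u (n - 1)) ^ 2 * flow K u (n - 1)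
                + numDeriv K (u (n - 1)) (u n) (u (n + 1)) / (u (n + 1) - u (n - 1)) * flow K u n
                - biq K (u (n - 1)) (u n) / (u (n + 1) - u (n - 1)) ^ 2 * flow K u (n + 1))) =
        biq K (u (n + 1)) (u n) / (u (n + 1) - u (n - 1)) ^ 2 * characteristic K V t u (n - 1)
          + numDeriv K (u (n - 1)) (u n) (u (n + 1)) / (u (n + 1) - u (n - 1)) *
            characteristic K V t u n
          - biq K (u (n - 1)) (u n) / (u (n + 1) - u (n - 1)) ^ 2 *
            characteristic K V t u (n + 1) := by
  refine forall₂_congr fun t ht => forall₃_congr fun u hu hne => forall_congr' fun n => ?_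
  have hflow : ∀ Z : ℤ → ℝ, HasDerivAt (fun s : ℝ => flow K (u + s • Z) n)
      (biq K (u (n + 1)) (u n) / (u (n + 1) - u (n - 1)) ^ 2 * Z (n - 1)
        + numDeriv K (u (n - 1)) (u n) (u (n + 1)) / (u (n + 1) - u (n - 1)) * Z n
        - biq K (u (n - 1)) (u n) / (u (n + 1) - u (n - 1)) ^ 2 * Z (n + 1)) 0 := fun Z =>
    hasDerivAt_rhs K (hne n) _ _ _
  have hp : (t, u n) ∈ (I : Set ℝ) ×ˢ (J : Set ℝ) := ⟨ht, hu n⟩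
  have hcurve : HasDerivAt (fun s : ℝ => (t + s, (u + s • flow K u) n)) (1, flow K u n) 0 := by
    refine HasDerivAt.prodMk ?_ ?_
    · simpa using (hasDerivAt_id (0 : ℝ)).const_add t
    · simpa using ((hasDerivAt_id (0 : ℝ)).mul_const (flow K u n)).const_add (u n)
  have hV : HasDerivAt (fun s : ℝ => V.1 n (t + s, (u + s • flow K u) n))
      (fderiv ℝ (V.1 n) (t, u n) (1, flow K u n)) 0 :=
    (field_differentiableAt V n hp).hasFDerivAt.comp_hasDerivAt_of_eq (0 : ℝ) hcurve (by simp)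
  have hV1 : HasDerivAt (fun s : ℝ => (V.1 n (t + s, (u + s • flow K u) n)).1)
      (fderiv ℝ (V.1 n) (t, u n) (1, flow K u n)).1 0 :=
    (ContinuousLinearMap.fst ℝ ℝ ℝ).hasFDerivAt.comp_hasDerivAt (0 : ℝ) hV
  have hV2 : HasDerivAt (fun s : ℝ => (V.1 n (t + s, (u + s • flow K u) n)).2)
      (fderiv ℝ (V.1 n) (t, u n) (1, flow K u n)).2 0 :=
    (ContinuousLinearMap.snd ℝ ℝ ℝ).hasFDerivAt.comp_hasDerivAt (0 : ℝ) hV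
  have hchar := hV2.sub (hV1.mul (hflow (flow K u)))
  have e1 : deriv (fun s : ℝ => characteristic K V (t + s) (u + s • flow K u) n) 0 = _ :=
    hchar.deriv
  rw [e1, (hflow (characteristic K V t u)).deriv]
  simp

/-- The sequence, of period `4` on each side of `n`, with the values `p, x, y, z, q` at
`n - 2, …, n + 2`. Values two places apart are `x`, `z`, or `y` and one of `p`, `q`. -/
def window (p x y z q : ℝ) (n k : ℤ) : ℝ :=
  if (k - n) % 4 = 0 then y else if (k - n) % 4 = 1 then z else if (k - n) % 4 = 3 then x
  else if n < k then q else p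

theorem window_ne {p x y z q : ℝ} (hp : y ≠ p) (hx : z ≠ x) (hq : q ≠ y) (n k : ℤ) :
    window p x y z q n (k + 1) ≠ window p x y z q n (k - 1) := by
  have h1 : (k + 1 - n) % 4 = ((k - n) % 4 + 1) % 4 := by omega
  have h2 : (k - 1 - n) % 4 = ((k - n) % 4 + 3) % 4 := by omega
  simp only [window, h1, h2]
  have h3 : (k - n) % 4 = 0 ∨ (k - n) % 4 = 1 ∨ (k - n) % 4 = 2 ∨ (k - n) % 4 = 3 := by omega
  rcases h3 with h | h | h | h <;> rw [h] <;> norm_num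
  · exact hx
  · split_ifs
    exacts [hq, hp.symm]
  · exact hx.symm
  · split_ifs
    exacts [hq.symm, hp]

/-- The symmetry condition involves the values of the sequence at five consecutive places
only, which are arbitrary except that values two places apart are different. -/
theorem IsSymmetry.window_eq {K : Matrix (Fin 3) (Fin 3) ℝ} {V : PointField I J}
    (h : IsSymmetry K V) {t p x y z q : ℝ} (ht : t ∈ I) (hp : p ∈ J) (hx : x ∈ J) (hy : y ∈ J)
    (hz : z ∈ J) (hq : q ∈ J) (hyp : y ≠ p) (hzx : z ≠ x) (hqy : q ≠ y) (n : ℤ) :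
    (fderiv ℝ (V.1 n) (t, y) (1, rhs K x y z)).2
        - (fderiv ℝ (V.1 n) (t, y) (1, rhs K x y z)).1 * rhs K x y z
        + ((V.1 (n - 1) (t, x)).1 - (V.1 n (t, y)).1) * (biq K z y / (z - x) ^ 2) * rhs K p x y
        - ((V.1 (n + 1) (t, z)).1 - (V.1 n (t, y)).1) * (biq K x y / (z - x) ^ 2) * rhs K y z q =
      biq K z y / (z - x) ^ 2 * (V.1 (n - 1) (t, x)).2
        + numDeriv K x y z / (z - x) * (V.1 n (t, y)).2
        - biq K x y / (z - x) ^ 2 * (V.1 (n + 1) (t, z)).2 := by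
  have hu : ∀ k, window p x y z q n k ∈ J := fun k => by
    simp only [window]; split_ifs <;> assumption
  have := isSymmetry_iff.1 h t ht (window p x y z q n) hu (window_ne hyp hzx hqy n) n
  have w0 : window p x y z q n n = y := by simp [window]
  have w1 : window p x y z q n (n + 1) = z := by simp [window]
  have w2 : window p x y z q n (n - 1) = x := by
    simp [window]
  have w3 : window p x y z q n (n + 1 + 1) = q := by
    have h1 : (n + 1 + 1 - n) % 4 = 2 := by omega
    have h2 : n < n + 1 + 1 := by omega
    simp [window, h1, h2]
  have w4 : window p x y z q n (n - 1 - 1) = p := by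
    have h1 : (n - 1 - 1 - n) % 4 = 2 := by omega
    have h2 : ¬ n < n - 1 - 1 := by omega
    simp [window, h1, h2]
  simp only [characteristic, flow, w0, w1, w2, w3, w4, sub_add_cancel, add_sub_cancel_right] at this
  linear_combination this

/-! ### The vector fields with polynomial coefficients -/

theorem eval_quad (a : Fin 3 → ℝ) (u : ℝ) :
    (quad a).eval u = a 0 * u ^ 2 + a 1 * u + a 2 := by
  simp [quad]

theorem vf_apply (τ φ ψ : ℝ[X]) (n : ℤ) {t u : ℝ} (ht : t ∈ I) (hu : u ∈ J) :
    (vf I J τ φ ψ).1 n (t, u) = (τ.eval t, φ.eval u + (-1) ^ n * ψ.eval u) :=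
  if_pos ⟨ht, hu⟩

/-- The vector field with given coefficients. -/
def field (I J : Opens ℝ) : Coef →ₗ[ℝ] PointField I J where
  toFun w := vf I J (C w.1 + C w.2.1 * X) (quad w.2.2.1) (quad w.2.2.2)
  map_add' v w := field_ext fun n p hp => by
    obtain ⟨t, u⟩ := p
    have h := vf_apply (C v.1 + C v.2.1 * X) (quad v.2.2.1) (quad v.2.2.2) n hp.1 hp.2
    have h' := vf_apply (C w.1 + C w.2.1 * X) (quad w.2.2.1) (quad w.2.2.2) n hp.1 hp.2
    rw [vf_apply _ _ _ n hp.1 hp.2, Submodule.coe_add, Pi.add_apply, Pi.add_apply, h, h']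
    simp only [eval_quad]
    ext <;> simp <;> ring
  map_smul' r w := field_ext fun n p hp => by
    obtain ⟨t, u⟩ := p
    have h := vf_apply (C w.1 + C w.2.1 * X) (quad w.2.2.1) (quad w.2.2.2) n hp.1 hp.2
    rw [vf_apply _ _ _ n hp.1 hp.2, Submodule.coe_smul, Pi.smul_apply, Pi.smul_apply]
    simp only [RingHom.id_apply]
    rw [h]
    simp only [eval_quad]
    ext <;> simp <;> ring

theorem field_apply (w : Coef) (n : ℤ) {t u : ℝ} (ht : t ∈ I) (hu : u ∈ J) :
    (field I J w).1 n (t, u) = (w.1 + w.2.1 * t,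
      (w.2.2.1 + (-1 : ℝ) ^ n • w.2.2.2) 0 * u ^ 2 + (w.2.2.1 + (-1 : ℝ) ^ n • w.2.2.2) 1 * u
        + (w.2.2.1 + (-1 : ℝ) ^ n • w.2.2.2) 2) := by
  refine (vf_apply _ _ _ n ht hu).trans ?_
  simp only [eval_quad]
  ext <;> simp
  ring

theorem infinite_of_isConnected (hI : IsConnected (I : Set ℝ)) : (I : Set ℝ).Infinite := by
  obtain ⟨x, hx⟩ := hI.nonempty
  exact infinite_of_mem_nhds x (I.isOpen.mem_nhds hx)

theorem coef_eq_of_eval_eq {S : Set ℝ} (hS : S.Infinite) {a b : Fin 3 → ℝ}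
    (h : ∀ u ∈ S, a 0 * u ^ 2 + a 1 * u + a 2 = b 0 * u ^ 2 + b 1 * u + b 2) : a = b := by
  have := quadratic_eq_zero hS (a := a 0 - b 0) (b := a 1 - b 1) (c := a 2 - b 2)
    fun u hu => by linear_combination h u hu
  ext i
  fin_cases i
  exacts [sub_eq_zero.1 this.1, sub_eq_zero.1 this.2.1, sub_eq_zero.1 this.2.2]

theorem field_injective (hI : IsConnected (I : Set ℝ)) (hJ : IsConnected (J : Set ℝ)) :
    Function.Injective (field I J) := by
  intro v w h
  have hI' := infinite_of_isConnected hI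
  have hJ' := infinite_of_isConnected hJ
  obtain ⟨t₀, ht₀⟩ := hI.nonempty
  obtain ⟨u₀, hu₀⟩ := hJ.nonempty
  have key : ∀ (n : ℤ), ∀ t ∈ I, ∀ u ∈ J, (field I J v).1 n (t, u) = (field I J w).1 n (t, u) :=
    fun n t _ u _ => by rw [h]
  have h1 := quadratic_eq_zero hI' (a := 0) (b := v.2.1 - w.2.1) (c := v.1 - w.1) fun t ht => by
    have := congrArg Prod.fst (key 0 t ht u₀ hu₀)
    rw [field_apply v 0 ht hu₀, field_apply w 0 ht hu₀] at this
    linear_combination this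
  have h2 : ∀ n : ℤ, v.2.2.1 + (-1 : ℝ) ^ n • v.2.2.2 = w.2.2.1 + (-1 : ℝ) ^ n • w.2.2.2 :=
    fun n => coef_eq_of_eval_eq hJ' fun u hu => by
      have := congrArg Prod.snd (key n t₀ ht₀ u hu)
      rwa [field_apply v n ht₀ hu, field_apply w n ht₀ hu] at this
  have h3 := h2 0
  have h4 := h2 1
  simp only [zpow_zero, one_smul, zpow_one, neg_smul] at h3 h4
  refine Prod.ext (sub_eq_zero.1 h1.2.2) (Prod.ext (sub_eq_zero.1 h1.2.1) (Prod.ext ?_ ?_))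
  · ext i
    have e3 := congrFun h3 i
    have e4 := congrFun h4 i
    simp only [Pi.add_apply, Pi.neg_apply] at e3 e4
    linarith
  · ext i
    have e3 := congrFun h3 i
    have e4 := congrFun h4 i
    simp only [Pi.add_apply, Pi.neg_apply] at e3 e4
    linarith

theorem fderiv_field (w : Coef) (n : ℤ) {t u : ℝ} (ht : t ∈ I) (hu : u ∈ J) (c r : ℝ) :
    fderiv ℝ ((field I J w).1 n) (t, u) (c, r) = (w.2.1 * c,
      (2 * (w.2.2.1 + (-1 : ℝ) ^ n • w.2.2.2) 0 * u
        + (w.2.2.1 + (-1 : ℝ) ^ n • w.2.2.2) 1) * r) := by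
  have hp : (t, u) ∈ (I : Set ℝ) ×ˢ (J : Set ℝ) := ⟨ht, hu⟩
  have hline : HasDerivAt (fun s : ℝ => (t + s * c, u + s * r)) (c, r) 0 := by
    refine HasDerivAt.prodMk ?_ ?_
    · simpa using ((hasDerivAt_id (0 : ℝ)).mul_const c).const_add t
    · simpa using ((hasDerivAt_id (0 : ℝ)).mul_const r).const_add u
  have h1 : HasDerivAt (fun s : ℝ => (field I J w).1 n (t + s * c, u + s * r))
      (fderiv ℝ ((field I J w).1 n) (t, u) (c, r)) 0 :=
    (field_differentiableAt _ n hp).hasFDerivAt.comp_hasDerivAt_of_eq (0 : ℝ) hline (by simp)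
  set A := w.2.2.1 + (-1 : ℝ) ^ n • w.2.2.2 with hA
  have h2 : HasDerivAt (fun s : ℝ => (w.1 + w.2.1 * (t + s * c),
      A 0 * (u + s * r) ^ 2 + A 1 * (u + s * r) + A 2)) (w.2.1 * c, (2 * A 0 * u + A 1) * r) 0 := by
    have hu' : HasDerivAt (fun s : ℝ => u + s * r) r 0 := hline.snd
    refine HasDerivAt.prodMk ?_ ?_
    · simpa using ((((hasDerivAt_id (0 : ℝ)).mul_const c).const_add t).const_mul w.2.1).const_add w.1
    · refine ((((hu'.pow 2).const_mul (A 0)).add (hu'.const_mul (A 1))).add_const (A 2)).congr_deriv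
        ?_
      simp; ring
  refine h1.unique (h2.congr_of_eventuallyEq ?_)
  have hmem : ∀ᶠ s in nhds (0 : ℝ), (t + s * c, u + s * r) ∈ (I : Set ℝ) ×ˢ (J : Set ℝ) :=
    hline.continuousAt.eventually_mem (by simpa using (isOpen_dom I J).mem_nhds hp)
  filter_upwards [hmem] with s hs
  exact field_apply w n hs.1 hs.2

/-- The determining equations, as an identity in `u_{n-1}, u_n, u_{n+1}`, for a vector field
that has the coefficients `A` at `n` and `B` at `n ± 1`. -/
theorem determining_identity (K : Matrix (Fin 3) (Fin 3) ℝ) (s : ℝ) (A B : Fin 3 → ℝ)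
    (x y z : ℝ) :
    ((2 * A 0 * y + A 1) - s) * (P K y * (z * x) + Q K y * (z + x) + R K y) * (z - x)
      - (biq K z y * (B 0 * x ^ 2 + B 1 * x + B 2)
        + numDeriv K x y z * (z - x) * (A 0 * y ^ 2 + A 1 * y + A 2)
        - biq K x y * (B 0 * z ^ 2 + B 1 * z + B 2)) =
    -(z - x) * pol ((adMat B)ᵀ * form K + form K * adMat A + s • form K) x y z := by
  simp [pol, form, adMat, biq, numDeriv, P, Q, R, Matrix.mul_apply, Fin.sum_univ_succ]
  ring

/-- The determining equations at the even and at the odd places, where the vector field has the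
coefficients `f ± g` and its neighbours have `f ∓ g`. -/
theorem mem_sol_iff_of_parts {E : Matrix (Fin 3) (Fin 3) ℝ} {w : Coef} :
    w ∈ sol E ↔
      (adMat (w.2.2.1 - w.2.2.2))ᵀ * E + E * adMat (w.2.2.1 + w.2.2.2) + w.2.1 • E = 0 ∧
      (adMat (w.2.2.1 + w.2.2.2))ᵀ * E + E * adMat (w.2.2.1 - w.2.2.2) + w.2.1 • E = 0 := by
  have hsub : ∀ a b, adMat (a - b) = adMat a - adMat b := fun a b => by
    rw [sub_eq_add_neg, adMat_add, ← neg_one_smul ℝ b, adMat_smul]; module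
  simp only [hsub, adMat_add, Matrix.transpose_sub, Matrix.transpose_add, Matrix.sub_mul,
    Matrix.mul_sub, Matrix.add_mul, Matrix.mul_add]
  constructor
  · rintro ⟨h1, h2⟩
    rw [h1, h2]
    constructor <;> abel
  · rintro ⟨h1, h2⟩
    constructor
    · have : (2 : ℝ) • ((adMat w.2.2.1)ᵀ * E - (-(E * adMat w.2.2.1) - w.2.1 • E)) = 0 := by
        rw [← add_zero (0 : Matrix (Fin 3) (Fin 3) ℝ)]
        nth_rw 1 [← h1]
        rw [← h2]
        module
      exact sub_eq_zero.1 ((smul_eq_zero_iff_right two_ne_zero).1 this)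
    · have : (2 : ℝ) • ((adMat w.2.2.2)ᵀ * E - E * adMat w.2.2.2) = 0 := by
        rw [← sub_zero (0 : Matrix (Fin 3) (Fin 3) ℝ)]
        nth_rw 1 [← h2]
        rw [← h1]
        module
      exact sub_eq_zero.1 ((smul_eq_zero_iff_right two_ne_zero).1 this)

theorem zpow_neg_one_cases (n : ℤ) : ((-1 : ℝ) ^ n = 1 ∨ (-1 : ℝ) ^ n = -1) := by
  rcases Int.even_or_odd n with h | h
  · exact Or.inl h.neg_one_zpow
  · exact Or.inr h.neg_one_zpow

theorem isSymmetry_field {K : Matrix (Fin 3) (Fin 3) ℝ} {w : Coef} (hw : w ∈ sol (form K)) :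
    IsSymmetry K (field I J w) := by
  rw [isSymmetry_iff]
  intro t ht u hu hne n
  have hzx := sub_ne_zero.2 (hne n)
  have e1 : (-1 : ℝ) ^ (n + 1) = -(-1 : ℝ) ^ n := by rw [zpow_add_one₀ (by norm_num)]; ring
  have e2 : (-1 : ℝ) ^ (n - 1) = -(-1 : ℝ) ^ n := by rw [zpow_sub_one₀ (by norm_num)]; norm_num
  have hdet : (adMat (w.2.2.1 - (-1 : ℝ) ^ n • w.2.2.2))ᵀ * form K
      + form K * adMat (w.2.2.1 + (-1 : ℝ) ^ n • w.2.2.2) + w.2.1 • form K = 0 := by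
    obtain ⟨h1, h2⟩ := mem_sol_iff_of_parts.1 hw
    rcases zpow_neg_one_cases n with h | h <;> rw [h]
    · simpa using h1
    · simpa [sub_eq_add_neg] using h2
  rw [fderiv_field w n ht (hu n), mul_one]
  simp only [characteristic, field_apply w _ ht (hu _), e1, e2]
  have hid := determining_identity K w.2.1 (w.2.2.1 + (-1 : ℝ) ^ n • w.2.2.2)
    (w.2.2.1 - (-1 : ℝ) ^ n • w.2.2.2) (u (n - 1)) (u n) (u (n + 1))
  rw [hdet] at hid
  have hpol0 : pol 0 (u (n - 1)) (u n) (u (n + 1)) = 0 := by simp [pol]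
  rw [hpol0] at hid
  simp only [neg_smul, ← sub_eq_add_neg]
  generalize w.2.2.1 + (-1 : ℝ) ^ n • w.2.2.2 = A at hid ⊢
  generalize w.2.2.1 - (-1 : ℝ) ^ n • w.2.2.2 = B at hid ⊢
  rw [show flow K u n = (P K (u n) * (u (n + 1) * u (n - 1)) + Q K (u n) * (u (n + 1) + u (n - 1))
    + R K (u n)) / (u (n + 1) - u (n - 1)) from rfl]
  field_simp
  linear_combination hid

/-! ### Symmetries have polynomial coefficients -/

variable {I J : Opens ℝ}

/-- Continuous functions on an open set that agree off a finite set agree. -/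
theorem eqOn_of_finite {S T : Set ℝ} (hS : IsOpen S) (hT : T.Finite) {f g : ℝ → ℝ}
    (hf : ContinuousOn f S) (hg : ContinuousOn g S) (h : ∀ u ∈ S, u ∉ T → f u = g u) :
    ∀ u ∈ S, f u = g u := by
  intro u hu
  have hfu := (hf.continuousAt (hS.mem_nhds hu)).tendsto.mono_left
    (nhdsWithin_le_nhds (s := {u}ᶜ))
  have hgu := (hg.continuousAt (hS.mem_nhds hu)).tendsto.mono_left
    (nhdsWithin_le_nhds (s := {u}ᶜ))
  refine tendsto_nhds_unique (hfu.congr' ?_) hgu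
  have h1 : ∀ᶠ v in nhdsWithin u {u}ᶜ, v ∈ S := nhdsWithin_le_nhds (hS.mem_nhds hu)
  have h2 : ∀ᶠ v in nhdsWithin u {u}ᶜ, v ∉ T \ {u} :=
    nhdsWithin_le_nhds ((hT.subset sdiff_subset).isClosed.isOpen_compl.mem_nhds (by simp))
  filter_upwards [h1, h2, self_mem_nhdsWithin] with v hv1 hv2 hv3
  exact h v hv1 fun hv => hv2 ⟨hv, hv3⟩

theorem finite_quadratic_zeros {a b c : ℝ} (h : ¬(a = 0 ∧ b = 0 ∧ c = 0)) :
    {u : ℝ | a * u ^ 2 + b * u + c = 0}.Finite := by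
  by_contra hinf
  exact h (quadratic_eq_zero hinf fun u hu => hu)

theorem finite_biq_left {K : Matrix (Fin 3) (Fin 3) ℝ} {x y : ℝ} (h : biq K x y ≠ 0) :
    {u : ℝ | biq K u y = 0}.Finite := by
  refine finite_quadratic_zeros (a := P K y) (b := 2 * Q K y) (c := R K y) ?_
  rintro ⟨h1, h2, h3⟩
  exact h (by rw [biq, h1, h2, h3]; ring)

theorem biq_eq (K : Matrix (Fin 3) (Fin 3) ℝ) (x y : ℝ) :
    biq K x y = (K 0 0 * x ^ 2 + 2 * K 1 0 * x + K 2 0) * y ^ 2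
      + (2 * K 0 1 * x ^ 2 + 2 * K 1 1 * x + 2 * K 2 1) * y
      + (K 0 2 * x ^ 2 + 2 * K 1 2 * x + K 2 2) := by
  simp only [biq, P, Q, R]; ring

theorem finite_biq_right {K : Matrix (Fin 3) (Fin 3) ℝ} {x y : ℝ} (h : biq K x y ≠ 0) :
    {u : ℝ | biq K x u = 0}.Finite := by
  simp only [biq_eq]
  refine finite_quadratic_zeros ?_
  rintro ⟨h1, h2, h3⟩
  exact h (by rw [biq_eq, h1, h2, h3]; ring)

theorem exists_biq_ne_zero {K : Matrix (Fin 3) (Fin 3) ℝ} (hK : K ≠ 0) {S : Set ℝ}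
    (hS : S.Infinite) : ∃ x ∈ S, ∃ y ∈ S, biq K x y ≠ 0 := by
  by_contra! h
  have h1 : ∀ x ∈ S, ∀ i, form K 0 i * x ^ 2 + form K 1 i * x + form K 2 i = 0 := fun x hx => by
    have := quadratic_eq_zero hS fun y hy => (biq_eq K x y).symm.trans (h x hx y hy)
    intro i; fin_cases i
    exacts [this.1, this.2.1, this.2.2]
  refine hK (form_eq_zero ?_)
  ext i j
  have := quadratic_eq_zero hS fun x hx => h1 x hx j
  fin_cases i
  exacts [this.1, this.2.1, this.2.2]

theorem exists_mem_notMem_finite {S T : Set ℝ} (hS : S.Infinite) (hT : T.Finite) :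
    ∃ u ∈ S, u ∉ T := by
  obtain ⟨u, hu⟩ := (hS.sdiff hT).nonempty
  exact ⟨u, hu.1, hu.2⟩

theorem field_slice_continuousOn (V : PointField I J) (n : ℤ) {t : ℝ} (ht : t ∈ I) :
    ContinuousOn (fun u => V.1 n (t, u)) J :=
  (V.2 n).1.continuousOn.comp (by fun_prop) fun _ hu => ⟨ht, hu⟩

/-- The coefficient of `∂_t` is the same at neighbouring places: the symmetry condition depends
on `u_{n+2}` only through the difference of these two coefficients. -/
theorem IsSymmetry.fst_succ_eq {K : Matrix (Fin 3) (Fin 3) ℝ} (hK : K ≠ 0) {V : PointField I J}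
    (h : IsSymmetry K V) (hJ : IsConnected (J : Set ℝ)) {t : ℝ} (ht : t ∈ I) (n : ℤ) :
    ∀ y ∈ J, ∀ z ∈ J, (V.1 (n + 1) (t, z)).1 = (V.1 n (t, y)).1 := by
  have hJ' := infinite_of_isConnected hJ
  have generic : ∀ x ∈ J, ∀ y ∈ J, ∀ z ∈ J, z ≠ x → biq K x y ≠ 0 → biq K y z ≠ 0 →
      (V.1 (n + 1) (t, z)).1 = (V.1 n (t, y)).1 := by
    intro x hx y hy z hz hzx hxy hyz
    -- the condition for two values `p ≠ q` of `u_{n+2}`; the choice of `u_{n-2}` does not matter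
    obtain ⟨p, hp, hpy⟩ := exists_mem_notMem_finite hJ' (finite_singleton y)
    obtain ⟨q, hq, hqp⟩ := exists_mem_notMem_finite hJ' ((finite_singleton y).insert p)
    simp only [mem_singleton_iff, mem_insert_iff, not_or] at hpy hqp
    have e1 := h.window_eq ht hp hx hy hz hp (Ne.symm hpy) hzx hpy n
    have e2 := h.window_eq ht hp hx hy hz hq (Ne.symm hpy) hzx hqp.2 n
    have hd : rhs K y z p - rhs K y z q = biq K y z * (q - p) / ((p - y) * (q - y)) := by
      rw [rhs_eq_add K z hpy, rhs_eq_add K z hqp.2]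
      have := sub_ne_zero.2 hpy
      have := sub_ne_zero.2 hqp.2
      field_simp
      ring
    have hd0 : rhs K y z p - rhs K y z q ≠ 0 := by
      rw [hd]
      exact div_ne_zero (mul_ne_zero hyz (sub_ne_zero.2 hqp.1))
        (mul_ne_zero (sub_ne_zero.2 hpy) (sub_ne_zero.2 hqp.2))
    have e3 : ((V.1 (n + 1) (t, z)).1 - (V.1 n (t, y)).1) *
        ((biq K x y / (z - x) ^ 2) * (rhs K y z p - rhs K y z q)) = 0 := by
      linear_combination e2 - e1
    have e4 : (biq K x y / (z - x) ^ 2) * (rhs K y z p - rhs K y z q) ≠ 0 :=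
      mul_ne_zero (div_ne_zero hxy (pow_ne_zero 2 (sub_ne_zero.2 hzx))) hd0
    exact sub_eq_zero.1 ((mul_eq_zero.1 e3).resolve_right e4)
  obtain ⟨x₀, hx₀, y₀, hy₀, h0⟩ := exists_biq_ne_zero hK hJ'
  intro y hy z hz
  revert y
  refine eqOn_of_finite J.isOpen ((finite_biq_right h0).union (finite_biq_left h0))
    continuousOn_const (continuous_fst.comp_continuousOn (field_slice_continuousOn V n ht)) ?_
  intro y hy hyT
  simp only [mem_union, mem_ofPred_eq, not_or] at hyT
  revert z
  refine eqOn_of_finite J.isOpen (finite_biq_right hyT.2)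
    (continuous_fst.comp_continuousOn (field_slice_continuousOn V (n + 1) ht))
    continuousOn_const ?_
  intro z hz hzT
  obtain ⟨x, hx, hxT⟩ := exists_mem_notMem_finite hJ' ((finite_biq_left hyT.1).insert z)
  simp only [mem_insert_iff, mem_ofPred_eq, not_or] at hxT
  exact generic x hx y hy z hz (Ne.symm hxT.1) hxT.2 hzT

/-- The coefficient of `∂_t` depends on `t` only. -/
theorem IsSymmetry.fst_eq {K : Matrix (Fin 3) (Fin 3) ℝ} (hK : K ≠ 0) {V : PointField I J}
    (h : IsSymmetry K V) (hJ : IsConnected (J : Set ℝ)) {t : ℝ} (ht : t ∈ I) {u₀ u : ℝ}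
    (hu₀ : u₀ ∈ J) (hu : u ∈ J) (n : ℤ) : (V.1 n (t, u)).1 = (V.1 0 (t, u₀)).1 := by
  have hstep := fun m => h.fst_succ_eq hK hJ ht m
  have h0 : (V.1 n (t, u₀)).1 = (V.1 0 (t, u₀)).1 := by
    induction n using Int.induction_on with
    | zero => rfl
    | succ k ih => rw [hstep _ u₀ hu₀ u₀ hu₀, ih]
    | pred k ih => rw [← ih, ← hstep (-(k : ℤ) - 1) u₀ hu₀ u₀ hu₀, sub_add_cancel]
  rw [← h0, ← hstep n u hu u₀ hu₀, ← hstep n u₀ hu₀ u₀ hu₀]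

/-- The symmetry condition after `τ_n(t, u_n) = T(t)` is known, with denominators cleared. -/
theorem IsSymmetry.cleared {K : Matrix (Fin 3) (Fin 3) ℝ} (hK : K ≠ 0) {V : PointField I J}
    (h : IsSymmetry K V) (hJ : IsConnected (J : Set ℝ)) {t : ℝ} (ht : t ∈ I) {u₀ : ℝ}
    (hu₀ : u₀ ∈ J) (n : ℤ) :
    ∀ x ∈ J, ∀ y ∈ J, ∀ z ∈ J,
      (fderiv ℝ (V.1 n) (t, y) (1, 0)).2 * (z - x) ^ 2
        + ((fderiv ℝ (V.1 n) (t, y) (0, 1)).2 - deriv (fun s => (V.1 0 (s, u₀)).1) t)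
          * (P K y * (z * x) + Q K y * (z + x) + R K y) * (z - x)
        - (biq K z y * (V.1 (n - 1) (t, x)).2
          + numDeriv K x y z * (z - x) * (V.1 n (t, y)).2
          - biq K x y * (V.1 (n + 1) (t, z)).2) = 0 := by
  intro x hx y hy
  have hJ' := infinite_of_isConnected hJ
  have hp : (t, y) ∈ (I : Set ℝ) ×ˢ (J : Set ℝ) := ⟨ht, hy⟩
  have hcont : ContinuousOn (fun z => (fderiv ℝ (V.1 n) (t, y) (1, 0)).2 * (z - x) ^ 2
        + ((fderiv ℝ (V.1 n) (t, y) (0, 1)).2 - deriv (fun s => (V.1 0 (s, u₀)).1) t)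
          * (P K y * (z * x) + Q K y * (z + x) + R K y) * (z - x)
        - (biq K z y * (V.1 (n - 1) (t, x)).2
          + numDeriv K x y z * (z - x) * (V.1 n (t, y)).2
          - biq K x y * (V.1 (n + 1) (t, z)).2)) J := by
    have := continuous_snd.comp_continuousOn (field_slice_continuousOn V (n + 1) ht)
    have h2 : ContinuousOn (fun z => (V.1 (n + 1) (t, z)).2) J := this
    simp only [biq, numDeriv]
    fun_prop
  refine eqOn_of_finite J.isOpen (finite_singleton x) hcont continuousOn_const ?_
  intro z hz hzx
  have hzx : z ≠ x := hzx
  obtain ⟨p, hp', hpy⟩ := exists_mem_notMem_finite hJ' (finite_singleton y)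
  have hpy : p ≠ y := hpy
  have e := h.window_eq ht hp' hx hy hz hp' hpy.symm hzx hpy n
  rw [h.fst_eq hK hJ ht hu₀ hx, h.fst_eq hK hJ ht hu₀ hy, h.fst_eq hK hJ ht hu₀ hz] at e
  have hfst : ∀ r, (fderiv ℝ (V.1 n) (t, y) (1, r)).1 = deriv (fun s => (V.1 0 (s, u₀)).1) t := by
    intro r
    have hline : HasDerivAt (fun s : ℝ => (t + s, y + s * r)) (1, r) 0 := by
      refine HasDerivAt.prodMk ?_ ?_
      · simpa using (hasDerivAt_id (0 : ℝ)).const_add t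
      · simpa using ((hasDerivAt_id (0 : ℝ)).mul_const r).const_add y
    have h1 : HasDerivAt (fun s : ℝ => V.1 n (t + s, y + s * r))
        (fderiv ℝ (V.1 n) (t, y) (1, r)) 0 :=
      (field_differentiableAt V n hp).hasFDerivAt.comp_hasDerivAt_of_eq (0 : ℝ) hline (by simp)
    have h2 : HasDerivAt (fun s : ℝ => (V.1 n (t + s, y + s * r)).1)
        (fderiv ℝ (V.1 n) (t, y) (1, r)).1 0 :=
      (ContinuousLinearMap.fst ℝ ℝ ℝ).hasFDerivAt.comp_hasDerivAt (0 : ℝ) h1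
    have hmem : ∀ᶠ s in nhds (0 : ℝ), (t + s, y + s * r) ∈ (I : Set ℝ) ×ˢ (J : Set ℝ) :=
      hline.continuousAt.eventually_mem (by simpa using (isOpen_dom I J).mem_nhds hp)
    have h3 : HasDerivAt (fun s : ℝ => (V.1 0 (t + s, u₀)).1)
        (fderiv ℝ (V.1 n) (t, y) (1, r)).1 0 := by
      refine h2.congr_of_eventuallyEq ?_
      filter_upwards [hmem] with s hs
      exact (h.fst_eq hK hJ hs.1 hu₀ hs.2 n).symm
    have h5 : HasDerivAt (fun s => (V.1 0 (s, u₀)).1) (fderiv ℝ (V.1 n) (t, y) (1, r)).1 t := by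
      have := HasDerivAt.comp_sub_const t t (f := fun s : ℝ => (V.1 0 (t + s, u₀)).1)
        (f' := (fderiv ℝ (V.1 n) (t, y) (1, r)).1) (by simpa using h3)
      simpa using this
    exact h5.deriv.symm
  rw [hfst] at e
  have hlin : fderiv ℝ (V.1 n) (t, y) (1, rhs K x y z) =
      fderiv ℝ (V.1 n) (t, y) (1, 0) + rhs K x y z • fderiv ℝ (V.1 n) (t, y) (0, 1) := by
    rw [← map_smul, ← map_add]
    simp
  rw [hlin, Prod.snd_add, Prod.smul_snd, smul_eq_mul, rhs] at e
  have := sub_ne_zero.2 hzx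
  field_simp at e
  linear_combination e

/-- The cleared symmetry condition at `u_{n-1} = u_{n+1}`. -/
theorem IsSymmetry.snd_period {K : Matrix (Fin 3) (Fin 3) ℝ} (hK : K ≠ 0) {V : PointField I J}
    (h : IsSymmetry K V) (hJ : IsConnected (J : Set ℝ)) {t : ℝ} (ht : t ∈ I) (n : ℤ) :
    ∀ u ∈ J, (V.1 (n - 1) (t, u)).2 = (V.1 (n + 1) (t, u)).2 := by
  obtain ⟨x₀, hx₀, y₀, hy₀, h0⟩ := exists_biq_ne_zero hK (infinite_of_isConnected hJ)
  refine eqOn_of_finite J.isOpen (finite_biq_left h0)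
    (continuous_snd.comp_continuousOn (field_slice_continuousOn V _ ht))
    (continuous_snd.comp_continuousOn (field_slice_continuousOn V _ ht)) ?_
  intro u hu hu0
  have := h.cleared hK hJ ht hx₀ n u hu y₀ hy₀ u hu
  refine mul_left_cancel₀ hu0 ?_
  linear_combination -this

/-- For fixed `u_{n-1}`, `u_n`, the symmetry condition expresses the coefficient of `∂_u` at
`n + 1` by polynomials of degree two. -/
theorem IsSymmetry.snd_quadratic {K : Matrix (Fin 3) (Fin 3) ℝ} (hK : K ≠ 0) {V : PointField I J}
    (h : IsSymmetry K V) (hJ : IsConnected (J : Set ℝ)) {t : ℝ} (ht : t ∈ I) (n : ℤ) :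
    ∃ a : Fin 3 → ℝ, ∀ u ∈ J, (V.1 n (t, u)).2 = a 0 * u ^ 2 + a 1 * u + a 2 := by
  obtain ⟨x, hx, y, hy, h0⟩ := exists_biq_ne_zero hK (infinite_of_isConnected hJ)
  have e := h.cleared hK hJ ht hx (n - 1) x hx y hy
  rw [sub_add_cancel] at e
  generalize (fderiv ℝ (V.1 (n - 1)) (t, y) (1, 0)).2 = a at e
  generalize (fderiv ℝ (V.1 (n - 1)) (t, y) (0, 1)).2
    - deriv (fun s => (V.1 0 (s, x)).1) t = b at e
  generalize (V.1 (n - 1 - 1) (t, x)).2 = c at e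
  generalize (V.1 (n - 1) (t, y)).2 = d at e
  refine ⟨![-(a + b * (P K y * x + Q K y) - P K y * c
        - ((2 * K 0 0 * y + 2 * K 0 1) * x + (2 * K 1 0 * y + K 1 1)) * d) / biq K x y,
      -(-2 * a * x + b * (Q K y * x + R K y - P K y * x ^ 2 - Q K y * x) - 2 * Q K y * c
        - ((2 * K 1 0 * y + K 1 1) * x + (2 * K 2 0 * y + 2 * K 2 1)
          - (2 * K 0 0 * y + 2 * K 0 1) * x ^ 2 - (2 * K 1 0 * y + K 1 1) * x) * d) / biq K x y,
      -(a * x ^ 2 - b * (Q K y * x + R K y) * x - R K y * c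
        + ((2 * K 1 0 * y + K 1 1) * x + (2 * K 2 0 * y + 2 * K 2 1)) * x * d) / biq K x y],
    fun u hu => ?_⟩
  have e := e u hu
  have e' : (V.1 n (t, u)).2 = -(a * (u - x) ^ 2 + b * (P K y * (u * x) + Q K y * (u + x) + R K y)
      * (u - x) - (biq K u y * c + numDeriv K x y u * (u - x) * d)) / biq K x y := by
    rw [eq_div_iff h0]
    linear_combination e
  rw [e']
  simp only [Matrix.cons_val]
  rw [div_mul_eq_mul_div, div_mul_eq_mul_div, ← add_div, ← add_div]
  congr 1
  simp only [biq, numDeriv]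
  ring

/-- The coefficient of `∂_u` does not depend on time: the part of the symmetry condition that is
symmetric in `u_{n-1}`, `u_{n+1}`. -/
theorem IsSymmetry.fderiv_time {K : Matrix (Fin 3) (Fin 3) ℝ} (hK : K ≠ 0) {V : PointField I J}
    (h : IsSymmetry K V) (hJ : IsConnected (J : Set ℝ)) {t : ℝ} (ht : t ∈ I) (n : ℤ) {y : ℝ}
    (hy : y ∈ J) : (fderiv ℝ (V.1 n) (t, y) (1, 0)).2 = 0 := by
  have hJ' := infinite_of_isConnected hJ
  obtain ⟨x, hx, -⟩ := exists_mem_notMem_finite hJ' finite_empty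
  obtain ⟨z, hz, hzx⟩ := exists_mem_notMem_finite hJ' (finite_singleton x)
  have hzx : z ≠ x := hzx
  have e1 := h.cleared hK hJ ht hx n x hx y hy z hz
  have e2 := h.cleared hK hJ ht hx n z hz y hy x hx
  rw [h.snd_period hK hJ ht n x hx] at e1
  rw [h.snd_period hK hJ ht n z hz] at e2
  have e3 : (2 * (z - x) ^ 2) * (fderiv ℝ (V.1 n) (t, y) (1, 0)).2 = 0 := by
    simp only [numDeriv] at e1 e2
    linear_combination e1 + e2
  have := sub_ne_zero.2 hzx
  exact (mul_eq_zero.1 e3).resolve_left (by positivity)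

theorem IsSymmetry.snd_const {K : Matrix (Fin 3) (Fin 3) ℝ} (hK : K ≠ 0) {V : PointField I J}
    (h : IsSymmetry K V) (hI : IsConnected (I : Set ℝ)) (hJ : IsConnected (J : Set ℝ))
    {t t₀ : ℝ} (ht : t ∈ I) (ht₀ : t₀ ∈ I) (n : ℤ) {u : ℝ} (hu : u ∈ J) :
    (V.1 n (t, u)).2 = (V.1 n (t₀, u)).2 := by
  have hd : ∀ s ∈ I, HasDerivAt (fun s => (V.1 n (s, u)).2) 0 s := fun s hs => by
    have hp : (s, u) ∈ (I : Set ℝ) ×ˢ (J : Set ℝ) := ⟨hs, hu⟩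
    have hline : HasDerivAt (fun r : ℝ => (r, u)) (1, 0) s :=
      (hasDerivAt_id s).prodMk (hasDerivAt_const s u)
    have h1 := (field_differentiableAt V n hp).hasFDerivAt.comp_hasDerivAt s hline
    have h2 := (ContinuousLinearMap.snd ℝ ℝ ℝ).hasFDerivAt.comp_hasDerivAt s h1
    exact h2.congr_deriv (h.fderiv_time hK hJ hs n hu)
  exact I.isOpen.is_const_of_deriv_eq_zero hI.isPreconnected
    (fun s hs => (hd s hs).differentiableAt.differentiableWithinAt)
    (fun s hs => (hd s hs).deriv) ht ht₀

/-- Every Lie point symmetry has coefficients that solve the determining equations. -/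
theorem IsSymmetry.exists_coef {K : Matrix (Fin 3) (Fin 3) ℝ} (hK : K ≠ 0) {V : PointField I J}
    (h : IsSymmetry K V) (hI : IsConnected (I : Set ℝ)) (hJ : IsConnected (J : Set ℝ)) :
    ∃ w ∈ sol (form K), V = field I J w := by
  have hJ' := infinite_of_isConnected hJ
  obtain ⟨t₀, ht₀⟩ := hI.nonempty
  obtain ⟨u₀, hu₀⟩ := hJ.nonempty
  set T : ℝ → ℝ := fun s => (V.1 0 (s, u₀)).1 with hT
  choose a ha using fun n => h.snd_quadratic hK hJ ht₀ n
  have hsnd : ∀ n, ∀ t ∈ I, ∀ u ∈ J, (V.1 n (t, u)).2 = a n 0 * u ^ 2 + a n 1 * u + a n 2 :=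
    fun n t ht u hu => (h.snd_const hK hI hJ ht ht₀ n hu).trans (ha n u hu)
  have hper : ∀ n, a (n + 2) = a n := fun n => coef_eq_of_eval_eq hJ' fun u hu => by
    rw [← ha _ u hu, ← ha _ u hu]
    have := h.snd_period hK hJ ht₀ (n + 1) u hu
    rw [add_sub_cancel_right, add_assoc] at this
    exact this.symm
  have hspace : ∀ n, ∀ t ∈ I, ∀ y ∈ J,
      (fderiv ℝ (V.1 n) (t, y) (0, 1)).2 = 2 * a n 0 * y + a n 1 := fun n t ht y hy => by
    have hp : (t, y) ∈ (I : Set ℝ) ×ˢ (J : Set ℝ) := ⟨ht, hy⟩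
    have hline : HasDerivAt (fun r : ℝ => (t, r)) (0, 1) y :=
      (hasDerivAt_const y t).prodMk (hasDerivAt_id y)
    have h1 := (field_differentiableAt V n hp).hasFDerivAt.comp_hasDerivAt y hline
    have h2 : HasDerivAt (fun r => (V.1 n (t, r)).2) (fderiv ℝ (V.1 n) (t, y) (0, 1)).2 y :=
      (ContinuousLinearMap.snd ℝ ℝ ℝ).hasFDerivAt.comp_hasDerivAt y h1
    have h3 : HasDerivAt (fun r : ℝ => a n 0 * r ^ 2 + a n 1 * r + a n 2)
        (2 * a n 0 * y + a n 1) y := by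
      refine ((((hasDerivAt_id y).pow 2).const_mul (a n 0)).add
        ((hasDerivAt_id y).const_mul (a n 1))).add_const (a n 2) |>.congr_deriv ?_
      simp; ring
    refine h2.unique (h3.congr_of_eventuallyEq ?_)
    filter_upwards [J.isOpen.mem_nhds hy] with r hr
    exact hsnd n t ht r hr
  -- the determining equations, with the derivative of `T` in the place of `s₁`
  have hdet : ∀ t ∈ I, ∀ n, (adMat (a (n + 1)))ᵀ * form K + form K * adMat (a n)
      + deriv T t • form K = 0 := fun t ht n => by
    refine eq_zero_of_pol_eq_zero hJ' fun x hx y hy z hz hzx => ?_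
    have e := h.cleared hK hJ ht hu₀ n x hx y hy z hz
    rw [h.fderiv_time hK hJ ht n hy, hspace n t ht y hy, h.snd_period hK hJ ht n x hx,
      hsnd _ t ht x hx, hsnd _ t ht y hy, hsnd _ t ht z hz] at e
    have hid := determining_identity K (deriv T t) (a n) (a (n + 1)) x y z
    have : -(z - x) * pol ((adMat (a (n + 1)))ᵀ * form K + form K * adMat (a n)
      + deriv T t • form K) x y z = 0 := by
      rw [← hid]
      linear_combination e
    exact (mul_eq_zero.1 this).resolve_left (neg_ne_zero.2 (sub_ne_zero.2 hzx))
  have hT' : ∀ t ∈ I, deriv T t = deriv T t₀ := fun t ht => by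
    have h1 := (hdet t ht 0).trans (hdet t₀ ht₀ 0).symm
    exact smul_left_injective ℝ (fun h => hK (form_eq_zero h)) (add_left_cancel h1)
  have hTd : ∀ t ∈ I, DifferentiableAt ℝ T t := fun t ht => by
    have hp : (t, u₀) ∈ (I : Set ℝ) ×ˢ (J : Set ℝ) := ⟨ht, hu₀⟩
    have hline : HasDerivAt (fun r : ℝ => (r, u₀)) (1, 0) t :=
      (hasDerivAt_id t).prodMk (hasDerivAt_const t u₀)
    have h1 := (field_differentiableAt V 0 hp).hasFDerivAt.comp_hasDerivAt t hline
    exact ((ContinuousLinearMap.fst ℝ ℝ ℝ).hasFDerivAt.comp_hasDerivAt t h1).differentiableAt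
  set s := deriv T t₀ with hs
  have hTaff : ∀ t ∈ I, T t = (T t₀ - s * t₀) + s * t := fun t ht => by
    have hd : ∀ r ∈ I, HasDerivAt (fun r => T r - s * r) 0 r := fun r hr => by
      have := (hTd r hr).hasDerivAt.sub ((hasDerivAt_id r).const_mul s)
      refine this.congr_deriv ?_
      rw [hT' r hr]; simp
    have : T t - s * t = T t₀ - s * t₀ := I.isOpen.is_const_of_deriv_eq_zero hI.isPreconnected
      (fun s hs => (hd s hs).differentiableAt.differentiableWithinAt)
      (fun s hs => (hd s hs).deriv) ht ht₀
    linarith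
  have heven : ∀ n, a n = (1 / 2 : ℝ) • (a 0 + a 1) + (-1 : ℝ) ^ n • (1 / 2 : ℝ) • (a 0 - a 1) := by
    have hp2 : ∀ k : ℤ, a (2 * k) = a 0 ∧ a (2 * k + 1) = a 1 := fun k => by
      induction k using Int.induction_on with
      | zero => simp
      | succ k ih =>
        rw [show (2 * ((k : ℤ) + 1)) = 2 * k + 2 by ring,
          show (2 * (k : ℤ) + 2 + 1) = 2 * k + 1 + 2 by ring, hper, hper]
        exact ih
      | pred k ih =>
        rw [← hper (2 * (-(k : ℤ) - 1)), ← hper (2 * (-(k : ℤ) - 1) + 1),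
          show (2 * (-(k : ℤ) - 1) + 2) = 2 * -k by ring,
          show (2 * (-(k : ℤ) - 1) + 1 + 2) = 2 * -k + 1 by ring]
        exact ih
    intro n
    rcases Int.even_or_odd' n with ⟨k, rfl | rfl⟩
    · rw [(hp2 k).1, (even_two_mul k).neg_one_zpow]
      module
    · rw [(hp2 k).2, (odd_two_mul_add_one k).neg_one_zpow]
      module
  refine ⟨(T t₀ - s * t₀, s, (1 / 2 : ℝ) • (a 0 + a 1), (1 / 2 : ℝ) • (a 0 - a 1)), ?_, ?_⟩
  · have h0 := hdet t₀ ht₀ 0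
    have h1 := hdet t₀ ht₀ 1
    rw [show (1 : ℤ) + 1 = 0 + 2 by ring, hper] at h1
    rw [zero_add] at h0
    have c0 : (1 / 2 : ℝ) • (a 0 + a 1) + (1 / 2 : ℝ) • (a 0 - a 1) = a 0 := by module
    have c1 : (1 / 2 : ℝ) • (a 0 + a 1) - (1 / 2 : ℝ) • (a 0 - a 1) = a 1 := by module
    rw [mem_sol_iff_of_parts]
    simp only [c0, c1]
    exact ⟨h0, h1⟩
  · refine field_ext fun n p hp => ?_
    obtain ⟨t, u⟩ := p
    rw [field_apply _ n hp.1 hp.2]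
    simp only
    rw [← heven n]
    refine Prod.ext ?_ (hsnd n t hp.1 u hp.2)
    rw [h.fst_eq hK hJ hp.1 hu₀ hp.2]
    exact hTaff t hp.1

theorem isSymmetry_iff_exists_coef {K : Matrix (Fin 3) (Fin 3) ℝ} (hK : K ≠ 0)
    (hI : IsConnected (I : Set ℝ)) (hJ : IsConnected (J : Set ℝ)) {V : PointField I J} :
    IsSymmetry K V ↔ ∃ w ∈ sol (form K), V = field I J w :=
  ⟨fun h => h.exists_coef hK hI hJ, fun ⟨_, hw, h⟩ => h ▸ isSymmetry_field hw⟩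

/-! ### The symmetry algebra -/

variable {I J : Opens ℝ}

theorem field_lie (v w : Coef) : ⁅field I J v, field I J w⁆ = field I J (coefBracket v w) := by
  refine field_ext fun n p hp => ?_
  obtain ⟨t, u⟩ := p
  rw [lie_apply, VectorField.lieBracket, field_apply v n hp.1 hp.2, field_apply w n hp.1 hp.2,
    fderiv_field _ n hp.1 hp.2, fderiv_field _ n hp.1 hp.2, field_apply _ n hp.1 hp.2]
  have hε : ((-1 : ℝ) ^ n) ^ 2 = 1 := by
    rcases zpow_neg_one_cases n with h | h <;> rw [h] <;> norm_num
  generalize (-1 : ℝ) ^ n = ε at hε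
  refine Prod.ext ?_ ?_
  · simp [coefBracket]; ring
  · simp [coefBracket, brk]
    linear_combination (-((v.2.2.2 0 * w.2.2.2 1 - v.2.2.2 1 * w.2.2.2 0) * u ^ 2
      + 2 * (v.2.2.2 0 * w.2.2.2 2 - v.2.2.2 2 * w.2.2.2 0) * u
      + (v.2.2.2 1 * w.2.2.2 2 - v.2.2.2 2 * w.2.2.2 1))) * hε

/-- The image of the solutions of the determining equations, as a Lie algebra. -/
def solAlgebra (I J : Opens ℝ) (K : Matrix (Fin 3) (Fin 3) ℝ) :
    LieSubalgebra ℝ (PointField I J) where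
  toSubmodule := (sol (form K)).map (field I J)
  lie_mem' := by
    rintro _ _ ⟨v, hv, rfl⟩ ⟨w, hw, rfl⟩
    exact ⟨coefBracket v w, coefBracket_mem_sol hv hw, (field_lie v w).symm⟩

theorem mem_solAlgebra {K : Matrix (Fin 3) (Fin 3) ℝ} {V : PointField I J} :
    V ∈ solAlgebra I J K ↔ ∃ w ∈ sol (form K), field I J w = V := Iff.rfl

theorem mem_solAlgebra_iff {K : Matrix (Fin 3) (Fin 3) ℝ} (hK : K ≠ 0)
    (hI : IsConnected (I : Set ℝ)) (hJ : IsConnected (J : Set ℝ)) {V : PointField I J} :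
    V ∈ solAlgebra I J K ↔ IsSymmetry K V := by
  rw [isSymmetry_iff_exists_coef hK hI hJ, mem_solAlgebra]
  exact exists_congr fun w => and_congr_right fun _ => eq_comm

theorem symmetryAlgebra_eq {K : Matrix (Fin 3) (Fin 3) ℝ} (hK : K ≠ 0)
    (hI : IsConnected (I : Set ℝ)) (hJ : IsConnected (J : Set ℝ)) :
    symmetryAlgebra I J K = solAlgebra I J K := by
  have : {V : PointField I J | IsSymmetry K V} = solAlgebra I J K :=
    Set.ext fun V => (mem_solAlgebra_iff hK hI hJ).symm
  rw [symmetryAlgebra, this, LieSubalgebra.lieSpan_eq]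

/-- The symmetry algebra is isomorphic to the solution space of the determining equations. -/
def solEquiv (hI : IsConnected (I : Set ℝ)) (hJ : IsConnected (J : Set ℝ))
    (K : Matrix (Fin 3) (Fin 3) ℝ) : sol (form K) ≃ₗ[ℝ] solAlgebra I J K :=
  Submodule.equivMapOfInjective (field I J) (field_injective hI hJ) (sol (form K))

theorem IsSolBasis.isBasisOf (hI : IsConnected (I : Set ℝ)) (hJ : IsConnected (J : Set ℝ))
    {d : ℕ} {c : Fin d → Coef} {K : Matrix (Fin 3) (Fin 3) ℝ} (h : IsSolBasis c K)
    {e : Fin d → PointField I J} (he : ∀ i, e i = field I J (c i)) :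
    IsBasisOf e (solAlgebra I J K) := by
  obtain rfl : e = field I J ∘ c := funext he
  refine ⟨h.1.map' _ (LinearMap.ker_eq_bot.2 (field_injective hI hJ)), ?_⟩
  rw [range_comp, Submodule.span_image, h.2]
  rfl

theorem vf_eq_field {τ φ ψ : ℝ[X]} {w : Coef} (hτ : τ = C w.1 + C w.2.1 * X)
    (hφ : φ = quad w.2.2.1) (hψ : ψ = quad w.2.2.2) : vf I J τ φ ψ = field I J w := by
  rw [hτ, hφ, hψ]; rfl

/-! ### Nilradicals -/

/-- An eigenvector, for a nonzero eigenvalue, of an element of a nilpotent ideal would lie in the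
ideal itself. -/
theorem eq_zero_of_lie_eq_smul {L : Type*} [LieRing L] [LieAlgebra ℝ L] {M : LieIdeal ℝ L}
    (hM : LieRing.IsNilpotent M) {x e : L} (hx : x ∈ M) {r : ℝ} (hr : r ≠ 0)
    (h : ⁅x, e⁆ = r • e) : e = 0 := by
  have he : e ∈ M := by
    have h1 : ⁅x, e⁆ ∈ M := by
      rw [← lie_skew]
      exact neg_mem (M.lie_mem hx)
    rw [h] at h1
    have := M.smul_mem r⁻¹ h1
    rwa [smul_smul, inv_mul_cancel₀ hr, one_smul] at this
  obtain ⟨k, hk⟩ := LieModule.exists_forall_pow_toEnd_eq_zero ℝ M M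
  have hpow : ∀ m : ℕ, ((LieModule.toEnd ℝ M M ⟨x, hx⟩) ^ m) ⟨e, he⟩ = r ^ m • ⟨e, he⟩ := by
    intro m
    induction m with
    | zero => simp
    | succ m ih =>
      rw [pow_succ', Module.End.mul_apply, ih, map_smul, pow_succ, mul_smul]
      congr 1
      exact Subtype.ext h
  have := hpow k
  rw [hk] at this
  have h2 := (smul_eq_zero_iff_right (pow_ne_zero k hr)).1 this.symm
  exact congrArg Subtype.val h2

/-- A criterion for the nilradical: commutators lie in an Abelian subspace `S`, and all elements
outside of `S` have an eigenvector with a nonzero eigenvalue. -/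
theorem isSolvableWithAbelianNilradical_of {L : LieSubalgebra ℝ (PointField I J)}
    {S : Submodule ℝ (PointField I J)} (hSL : S ≤ L.toSubmodule)
    (hLL : ∀ x ∈ L, ∀ y ∈ L, ⁅x, y⁆ ∈ S) (hSS : ∀ x ∈ S, ∀ y ∈ S, ⁅x, y⁆ = 0)
    (heig : ∀ x ∈ L, x ∉ S → ∃ e ∈ L, e ≠ 0 ∧ ∃ r : ℝ, r ≠ 0 ∧ ⁅x, e⁆ = r • e) :
    IsSolvableWithAbelianNilradical L S := by
  let N : LieIdeal ℝ L :=
    { S.comap L.toSubmodule.subtype with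
      lie_mem := fun {x m} _ => hLL x x.2 m m.2 }
  have hN : ∀ x : L, x ∈ N ↔ (x : PointField I J) ∈ S := fun x => Iff.rfl
  have habel : IsLieAbelian N :=
    ⟨fun x y => Subtype.ext (Subtype.ext (hSS _ x.2 _ y.2))⟩
  refine ⟨?_, N, ⟨?_, ?_⟩, habel, ?_⟩
  · have h1 : LieAlgebra.derivedSeries ℝ L 1 ≤ N := by
      rw [LieAlgebra.derivedSeries_def, LieAlgebra.derivedSeriesOfIdeal_succ,
        LieAlgebra.derivedSeriesOfIdeal_zero, LieSubmodule.lie_le_iff]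
      intro x _ y _
      exact hLL x x.2 y y.2
    refine LieAlgebra.IsSolvable.mk (R := ℝ) (k := 2) ?_
    rw [LieAlgebra.derivedSeries_def, LieAlgebra.derivedSeriesOfIdeal_succ, eq_bot_iff,
      LieSubmodule.lie_le_iff]
    intro x hx y hy
    exact (LieSubmodule.mem_bot _).2 (Subtype.ext (hSS _ (h1 hx) _ (h1 hy)))
  · exact inferInstanceAs (LieModule.IsNilpotent N N)
  · intro M hM x hx
    by_contra hxS
    obtain ⟨e, heL, he, r, hr, h⟩ := heig x x.2 hxS
    exact he (congrArg Subtype.val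
      (eq_zero_of_lie_eq_smul (e := ⟨e, heL⟩) hM hx hr (Subtype.ext h)))
  · refine le_antisymm ?_ fun x hx => ⟨⟨x, hSL hx⟩, hx, rfl⟩
    rintro _ ⟨x, hx, rfl⟩
    exact hx

/-! ### The structure of the symmetry algebras -/

variable {I J : Opens ℝ}

theorem IsSolBasis.mem_iff {d : ℕ} {c : Fin d → Coef} {K : Matrix (Fin 3) (Fin 3) ℝ}
    (h : IsSolBasis c K) {w : Coef} : w ∈ sol (form K) ↔ ∃ a : Fin d → ℝ, w = ∑ i, a i • c i := by
  rw [← h.2, Submodule.mem_span_range_iff_exists_fun]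
  exact exists_congr fun a => eq_comm

theorem isSolvableWithAbelianNilradical_sol (hI : IsConnected (I : Set ℝ))
    (hJ : IsConnected (J : Set ℝ)) {K : Matrix (Fin 3) (Fin 3) ℝ} {S : Submodule ℝ Coef}
    (hSL : S ≤ sol (form K))
    (hLL : ∀ v ∈ sol (form K), ∀ w ∈ sol (form K), coefBracket v w ∈ S)
    (hSS : ∀ v ∈ S, ∀ w ∈ S, coefBracket v w = 0)
    (heig : ∀ v ∈ sol (form K), v ∉ S → ∃ e ∈ sol (form K), e ≠ 0 ∧
      ∃ r : ℝ, r ≠ 0 ∧ coefBracket v e = r • e) :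
    IsSolvableWithAbelianNilradical (solAlgebra I J K) (S.map (field I J)) := by
  refine isSolvableWithAbelianNilradical_of ?_ ?_ ?_ ?_
  · exact Submodule.map_mono hSL
  · rintro _ ⟨v, hv, rfl⟩ _ ⟨w, hw, rfl⟩
    exact ⟨_, hLL v hv w hw, (field_lie v w).symm⟩
  · rintro _ ⟨v, hv, rfl⟩ _ ⟨w, hw, rfl⟩
    rw [field_lie, hSS v hv w hw, map_zero]
  · rintro _ ⟨v, hv, rfl⟩ hvS
    obtain ⟨e, he, he0, r, hr, h⟩ := heig v hv fun h => hvS ⟨v, h, rfl⟩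
    refine ⟨_, ⟨e, he, rfl⟩, fun h => he0 (field_injective hI hJ (h.trans (map_zero _).symm)),
      r, hr, ?_⟩
    rw [field_lie, h, map_smul]

theorem mem_sol_K5 {w : Coef} :
    w ∈ sol (form K5) ↔ ∃ a s f g h : ℝ, w = (a, 2 * s, ![f, -s, 0], ![g, h, 0]) := by
  rw [isSolBasis_K5.mem_iff]
  constructor
  · rintro ⟨a, rfl⟩
    refine ⟨a 0, a 1, a 3, a 4, a 2, ?_⟩
    apply coef_ext <;> simp [Fin.sum_univ_succ] ; ring
  · rintro ⟨a, s, f, g, h, rfl⟩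
    refine ⟨![a, s, h, f, g], ?_⟩
    apply coef_ext <;> simp [Fin.sum_univ_succ] ; ring

theorem nilradical_K5 (hI : IsConnected (I : Set ℝ)) (hJ : IsConnected (J : Set ℝ)) :
    IsSolvableWithAbelianNilradical (solAlgebra I J K5)
      ((Submodule.span ℝ {((1, 0, 0, 0) : Coef), (0, 0, ![1, 0, 0], 0),
        (0, 0, 0, ![1, 0, 0])}).map (field I J)) := by
  have hS : ∀ w : Coef, w ∈ Submodule.span ℝ {((1, 0, 0, 0) : Coef), (0, 0, ![1, 0, 0], 0),
      (0, 0, 0, ![1, 0, 0])} ↔ ∃ a f g : ℝ, w = (a, 0, ![f, 0, 0], ![g, 0, 0]) := fun w => by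
    rw [Submodule.mem_span_triple]
    refine exists₃_congr fun a f g => ?_
    rw [eq_comm]
    simp
  refine isSolvableWithAbelianNilradical_sol hI hJ ?_ ?_ ?_ ?_
  · intro w hw
    obtain ⟨a, f, g, rfl⟩ := (hS w).1 hw
    exact mem_sol_K5.2 ⟨a, 0, f, g, 0, by simp⟩
  · intro v hv w hw
    obtain ⟨a, s, f, g, h, rfl⟩ := mem_sol_K5.1 hv
    obtain ⟨a', s', f', g', h', rfl⟩ := mem_sol_K5.1 hw
    refine (hS _).2 ⟨a * (2 * s') - 2 * s * a', (-s * f' + f * s') + (h * g' - g * h'),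
      (-s * g' - f * h') + (h * f' + g * s'), ?_⟩
    apply coef_ext <;> simp [coefBracket, brk]
  · intro v hv w hw
    obtain ⟨a, f, g, rfl⟩ := (hS v).1 hv
    obtain ⟨a', f', g', rfl⟩ := (hS w).1 hw
    apply coef_ext <;> simp [coefBracket, brk]
  · intro v hv hvS
    obtain ⟨a, s, f, g, h, rfl⟩ := mem_sol_K5.1 hv
    -- if time is not rescaled, the eigenvector is `u² ∂_u` at the even places
    by_cases hs : s = 0
    · have hh : h ≠ 0 := by
        rintro rfl
        exact hvS ((hS _).2 ⟨a, f, g, by simp [hs]⟩)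
      refine ⟨(0, 0, ![1, 0, 0], ![1, 0, 0]), mem_sol_K5.2 ⟨0, 0, 1, 1, 0, by simp⟩, ?_, h, hh, ?_⟩
      · intro h0
        have := congrArg (fun w : Coef => w.2.2.1 0) h0
        simp at this
      · apply coef_ext <;> simp [coefBracket, brk, hs]
    · refine ⟨(1, 0, 0, 0), time_mem_sol _, ?_, -(2 * s), by simpa, ?_⟩
      · intro h0
        have := congrArg Prod.fst h0
        simp at this
      · apply coef_ext <;> simp [coefBracket, brk]

/-- A time translation, a dilation of time and a further vector field that is an eigenvector of
the dilation. -/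
theorem nilradical_of_dilation (hI : IsConnected (I : Set ℝ)) (hJ : IsConnected (J : Set ℝ))
    {K : Matrix (Fin 3) (Fin 3) ℝ} {x y : Coef} {κ : ℝ}
    (hsol : ∀ w, w ∈ sol (form K) ↔ ∃ a b c : ℝ, w = a • ((1, 0, 0, 0) : Coef) + b • x + c • y)
    (hbr : ∀ a b c a' b' c' : ℝ,
      coefBracket (a • ((1, 0, 0, 0) : Coef) + b • x + c • y)
          (a' • ((1, 0, 0, 0) : Coef) + b' • x + c' • y) =
        (a * c' - c * a') • ((1, 0, 0, 0) : Coef) + (κ * (b * c' - c * b')) • x) :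
    IsSolvableWithAbelianNilradical (solAlgebra I J K)
      ((Submodule.span ℝ {((1, 0, 0, 0) : Coef), x}).map (field I J)) := by
  have hS : ∀ w : Coef, w ∈ Submodule.span ℝ {((1, 0, 0, 0) : Coef), x} ↔
      ∃ a b : ℝ, w = a • ((1, 0, 0, 0) : Coef) + b • x := fun w => by
    rw [Submodule.mem_span_pair]
    exact exists₂_congr fun a b => eq_comm
  refine isSolvableWithAbelianNilradical_sol hI hJ ?_ ?_ ?_ ?_
  · intro w hw
    obtain ⟨a, b, rfl⟩ := (hS w).1 hw
    exact (hsol _).2 ⟨a, b, 0, by rw [zero_smul, add_zero]⟩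
  · intro v hv w hw
    obtain ⟨a, b, c, rfl⟩ := (hsol v).1 hv
    obtain ⟨a', b', c', rfl⟩ := (hsol w).1 hw
    rw [hbr]
    exact (hS _).2 ⟨_, _, rfl⟩
  · intro v hv w hw
    obtain ⟨a, b, rfl⟩ := (hS v).1 hv
    obtain ⟨a', b', rfl⟩ := (hS w).1 hw
    simpa only [zero_smul, add_zero, mul_zero, zero_mul, sub_zero] using hbr a b 0 a' b' 0
  · intro v hv hvS
    obtain ⟨a, b, c, rfl⟩ := (hsol v).1 hv
    have hc : c ≠ 0 := by
      rintro rfl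
      exact hvS ((hS _).2 ⟨a, b, by rw [zero_smul, add_zero]⟩)
    refine ⟨(1, 0, 0, 0), time_mem_sol _, ?_, -c, neg_ne_zero.2 hc, ?_⟩
    · intro h0
      have := congrArg Prod.fst h0
      simp at this
    · simpa only [zero_smul, add_zero, mul_zero, zero_mul, sub_zero, one_smul, mul_one, zero_sub]
        using hbr a b c 1 0 0

theorem nilradical_K3b (hI : IsConnected (I : Set ℝ)) (hJ : IsConnected (J : Set ℝ)) {μ : ℝ}
    (hμ : μ ≠ 0) :
    IsSolvableWithAbelianNilradical (solAlgebra I J (K3b μ))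
      ((Submodule.span ℝ {((1, 0, 0, 0) : Coef), (0, 0, 0, ![1, -2 * μ, μ ^ 2])}).map
        (field I J)) := by
  refine nilradical_of_dilation hI hJ (κ := 1)
    (y := (0, 1, ![-(1 / (4 * μ)), -1 / 2, 3 * μ / 4], 0)) (fun w => ?_) ?_
  · rw [(isSolBasis_K3b hμ).mem_iff]
    constructor
    · rintro ⟨a, rfl⟩
      exact ⟨a 0, a 1, a 2, by simp [Fin.sum_univ_succ]⟩
    · rintro ⟨a, b, c, rfl⟩
      exact ⟨![a, b, c], by simp [Fin.sum_univ_succ]⟩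
  · intro a b c a' b' c'
    apply coef_ext <;> simp [coefBracket, brk] <;> field_simp <;> ring

theorem nilradical_K3c (hI : IsConnected (I : Set ℝ)) (hJ : IsConnected (J : Set ℝ)) :
    IsSolvableWithAbelianNilradical (solAlgebra I J K3c)
      ((Submodule.span ℝ {((1, 0, 0, 0) : Coef), (0, 0, ![1, 0, 0], 0)}).map (field I J)) := by
  refine nilradical_of_dilation hI hJ (κ := 1) (y := (0, 1, ![0, -1, 0], 0)) (fun w => ?_) ?_
  · rw [isSolBasis_K3c.mem_iff]
    constructor
    · rintro ⟨a, rfl⟩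
      exact ⟨a 0, a 2, a 1, by simp [Fin.sum_univ_succ]⟩
    · rintro ⟨a, b, c, rfl⟩
      exact ⟨![a, c, b], by simp [Fin.sum_univ_succ]⟩
  · intro a b c a' b' c'
    apply coef_ext <;> simp [coefBracket, brk]
    ring

theorem isLieAbelian_K3a {γ : ℝ} (hγ : γ ≠ 0) : IsLieAbelian (solAlgebra I J (K3a γ)) := by
  have hsol : ∀ w : Coef, w ∈ sol (form (K3a γ)) →
      ∃ a f g : ℝ, w = (a, 0, f • ![1, 0, γ], g • ![1, 0, γ]) := by
    intro w hw
    obtain ⟨a, rfl⟩ := (isSolBasis_K3a hγ).mem_iff.1 hw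
    exact ⟨a 0, a 2, a 1, by simp [Fin.sum_univ_succ]⟩
  refine ⟨?_⟩
  rintro ⟨_, v, hv, rfl⟩ ⟨_, w, hw, rfl⟩
  refine Subtype.ext ((field_lie v w).trans ?_)
  obtain ⟨a, f, g, rfl⟩ := hsol v hv
  obtain ⟨a', f', g', rfl⟩ := hsol w hw
  rw [show coefBracket _ _ = 0 from ?_]
  · exact map_zero _
  · apply coef_ext <;> simp [coefBracket, brk] <;> ring

attribute [local instance] LieRing.ofAssociativeRing in
/-- A parametrization of the symmetry algebra by `gl(2, ℝ)`. -/
theorem isGL2_of (hI : IsConnected (I : Set ℝ)) (hJ : IsConnected (J : Set ℝ))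
    {K : Matrix (Fin 3) (Fin 3) ℝ} (W : Matrix (Fin 2) (Fin 2) ℝ →ₗ[ℝ] Coef)
    (hmem : ∀ M, W M ∈ sol (form K)) (hinj : Function.Injective W)
    (hsurj : ∀ w ∈ sol (form K), ∃ M, W M = w)
    (hlie : ∀ M N, W (M * N - N * M) = coefBracket (W M) (W N)) :
    IsGL2 (solAlgebra I J K) := by
  let F : Matrix (Fin 2) (Fin 2) ℝ →ₗ⁅ℝ⁆ solAlgebra I J K :=
    { toFun := fun M => ⟨field I J (W M), W M, hmem M, rfl⟩
      map_add' := fun M N => Subtype.ext (by simp)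
      map_smul' := fun r M => Subtype.ext (by simp)
      map_lie' := fun {M N} => Subtype.ext (by
        change field I J (W (M * N - N * M)) = ⁅field I J (W M), field I J (W N)⁆
        rw [hlie, field_lie]) }
  refine ⟨(LieEquiv.ofBijective F ⟨fun M N h => ?_, ?_⟩).symm⟩
  · exact hinj (field_injective hI hJ (congrArg Subtype.val h))
  · rintro ⟨_, w, hw, rfl⟩
    obtain ⟨M, rfl⟩ := hsurj w hw
    exact ⟨M, rfl⟩

/-- The trace goes to the time translation, and the matrix `(p, q; r, s)` acts on `u` by the
fractional linear transformations that it generates. -/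
theorem isGL2_K4b (hI : IsConnected (I : Set ℝ)) (hJ : IsConnected (J : Set ℝ)) :
    IsGL2 (solAlgebra I J K4b) := by
  let W : Matrix (Fin 2) (Fin 2) ℝ →ₗ[ℝ] Coef :=
    { toFun := fun M => (M 0 0 + M 1 1, 0, ![M 1 0, M 1 1 - M 0 0, -M 0 1], 0)
      map_add' := fun M N => by apply coef_ext <;> simp <;> ring
      map_smul' := fun r M => by apply coef_ext <;> simp <;> ring }
  have hW : ∀ M, W M = (M 0 0 + M 1 1, 0, ![M 1 0, M 1 1 - M 0 0, -M 0 1], 0) := fun _ => rfl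
  refine isGL2_of hI hJ W ?_ ?_ ?_ ?_
  · intro M
    rw [hW, isSolBasis_K4b.mem_iff]
    exact ⟨![M 0 0 + M 1 1, -M 0 1, M 1 1 - M 0 0, M 1 0], by simp [Fin.sum_univ_succ]⟩
  · intro M N h
    simp only [hW, Prod.mk.injEq] at h
    have h0 := congrFun h.2.2.1 0
    have h1 := congrFun h.2.2.1 1
    have h2 := congrFun h.2.2.1 2
    simp at h0 h1 h2
    ext i j
    fin_cases i <;> fin_cases j <;> simp <;> linarith [h.1]
  · intro w hw
    obtain ⟨a, rfl⟩ := isSolBasis_K4b.mem_iff.1 hw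
    refine ⟨!![(a 0 - a 2) / 2, -a 1; a 3, (a 0 + a 2) / 2], ?_⟩
    rw [hW]
    apply coef_ext <;> simp [Fin.sum_univ_succ] <;> ring
  · intro M N
    simp only [hW]
    apply coef_ext <;> simp [coefBracket, brk, Matrix.mul_apply, Fin.sum_univ_succ] <;> ring

/-- The vector fields at the even places determine the others, and are those of `K4b`. -/
theorem isGL2_K4a (hI : IsConnected (I : Set ℝ)) (hJ : IsConnected (J : Set ℝ)) {l : ℝ}
    (hl : l = 1 ∨ l = -1) : IsGL2 (solAlgebra I J (K4a l)) := by
  have hl2 : l ^ 2 = 1 := by rcases hl with rfl | rfl <;> norm_num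
  have hl0 : l ≠ 0 := by rcases hl with rfl | rfl <;> norm_num
  let W : Matrix (Fin 2) (Fin 2) ℝ →ₗ[ℝ] Coef :=
    { toFun := fun M => (M 0 0 + M 1 1, 0,
        ![(M 1 0 - l * M 0 1) / 2, 0, l * ((M 1 0 - l * M 0 1) / 2)],
        ![(M 1 0 + l * M 0 1) / 2, M 1 1 - M 0 0, -l * ((M 1 0 + l * M 0 1) / 2)])
      map_add' := fun M N => by apply coef_ext <;> simp <;> ring
      map_smul' := fun r M => by apply coef_ext <;> simp <;> ring }
  have hW : ∀ M, W M = (M 0 0 + M 1 1, 0,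
        ![(M 1 0 - l * M 0 1) / 2, 0, l * ((M 1 0 - l * M 0 1) / 2)],
        ![(M 1 0 + l * M 0 1) / 2, M 1 1 - M 0 0, -l * ((M 1 0 + l * M 0 1) / 2)]) :=
    fun _ => rfl
  refine isGL2_of hI hJ W ?_ ?_ ?_ ?_
  · intro M
    rw [hW, (isSolBasis_K4a hl0).mem_iff]
    refine ⟨![M 0 0 + M 1 1, M 1 1 - M 0 0, (M 1 0 + l * M 0 1) / 2,
      (M 1 0 - l * M 0 1) / 2], ?_⟩
    apply coef_ext <;> simp [Fin.sum_univ_succ] <;> ring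
  · intro M N h
    simp only [hW, Prod.mk.injEq] at h
    have h0 := congrFun h.2.2.1 0
    have h1 := congrFun h.2.2.2 0
    have h2 := congrFun h.2.2.2 1
    simp at h0 h1 h2
    have h3 : M 0 1 = N 0 1 := mul_left_cancel₀ hl0 (by linarith)
    ext i j
    fin_cases i <;> fin_cases j <;> simp <;> linarith [h.1]
  · intro w hw
    obtain ⟨a, rfl⟩ := (isSolBasis_K4a hl0).mem_iff.1 hw
    refine ⟨!![(a 0 - a 1) / 2, l * (a 2 - a 3); a 2 + a 3, (a 0 + a 1) / 2], ?_⟩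
    rw [hW]
    apply coef_ext <;> simp [Fin.sum_univ_succ]
    · ring
    · linear_combination ((a 3 - a 2) / 2) * hl2
    · linear_combination (l * (a 3 - a 2) / 2) * hl2
    · linear_combination ((a 2 - a 3) / 2) * hl2
    · ring
    · linear_combination (l * (a 2 - a 3) / 2) * hl2
  · intro M N
    simp only [hW]
    rcases hl with rfl | rfl <;> apply coef_ext <;>
      simp [coefBracket, brk, Matrix.mul_apply, Fin.sum_univ_succ] <;> ring

/-! ### The listed vector fields -/

variable {I J : Opens ℝ}

theorem finrank_symmetryAlgebra (hI : IsConnected (I : Set ℝ)) (hJ : IsConnected (J : Set ℝ))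
    {K : Matrix (Fin 3) (Fin 3) ℝ} (hK : K ≠ 0) :
    Module.finrank ℝ (symmetryAlgebra I J K) = Module.finrank ℝ (sol (form K)) := by
  rw [symmetryAlgebra_eq hK hI hJ]
  exact (solEquiv hI hJ K).finrank_eq.symm

theorem finite_symmetryAlgebra (hI : IsConnected (I : Set ℝ)) (hJ : IsConnected (J : Set ℝ))
    {K : Matrix (Fin 3) (Fin 3) ℝ} (hK : K ≠ 0) : Module.Finite ℝ (symmetryAlgebra I J K) := by
  rw [symmetryAlgebra_eq hK hI hJ]
  exact Module.Finite.equiv (solEquiv hI hJ K)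

theorem vf_time : vf I J 1 0 0 = field I J (1, 0, 0, 0) :=
  vf_eq_field (by simp) (by simp [quad]) (by simp [quad])

theorem basis5_eq (i : Fin 5) : basis5 I J i = field I J (![(1, 0, 0, 0),
    (0, 2, ![0, -1, 0], 0), (0, 0, 0, ![0, 1, 0]), (0, 0, ![1, 0, 0], 0),
    (0, 0, 0, ![1, 0, 0])] i) := by
  fin_cases i
  exacts [vf_time,
    vf_eq_field (by simpa using (map_ofNat C 2).symm) (by simp [quad]) (by simp [quad]),
    vf_eq_field (by simp) (by simp [quad]) (by simp [quad]),
    vf_eq_field (by simp) (by simp [quad]) (by simp [quad]),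
    vf_eq_field (by simp) (by simp [quad]) (by simp [quad])]

theorem basis4a_eq (l : ℝ) (i : Fin 4) : basis4a I J l i = field I J (![(1, 0, 0, 0),
    (0, 0, 0, ![0, 1, 0]), (0, 0, 0, ![1, 0, -l]), (0, 0, ![1, 0, l], 0)] i) := by
  fin_cases i
  exacts [vf_time, vf_eq_field (by simp) (by simp [quad]) (by simp [quad]),
    vf_eq_field (by simp) (by simp [quad]) (by simp [quad]; ring),
    vf_eq_field (by simp) (by simp [quad]) (by simp [quad])]

theorem basis4b_eq (i : Fin 4) : basis4b I J i = field I J (![(1, 0, 0, 0),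
    (0, 0, ![0, 0, 1], 0), (0, 0, ![0, 1, 0], 0), (0, 0, ![1, 0, 0], 0)] i) := by
  fin_cases i
  exacts [vf_time, vf_eq_field (by simp) (by simp [quad]) (by simp [quad]),
    vf_eq_field (by simp) (by simp [quad]) (by simp [quad]),
    vf_eq_field (by simp) (by simp [quad]) (by simp [quad])]

theorem basis3a_eq (γ : ℝ) (i : Fin 3) : basis3a I J γ i = field I J (![(1, 0, 0, 0),
    (0, 0, 0, ![1, 0, γ]), (0, 0, ![1, 0, γ], 0)] i) := by
  fin_cases i
  exacts [vf_time, vf_eq_field (by simp) (by simp [quad]) (by simp [quad]),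
    vf_eq_field (by simp) (by simp [quad]) (by simp [quad])]

theorem basis3b_eq {μ : ℝ} (hμ : μ ≠ 0) (i : Fin 3) : basis3b I J μ i = field I J (![(1, 0, 0, 0),
    (0, 0, 0, ![1, -2 * μ, μ ^ 2]),
    (0, 1, ![-(1 / (4 * μ)), -1 / 2, 3 * μ / 4], 0)] i) := by
  fin_cases i
  · exact vf_time
  · exact vf_eq_field (by simp) (by simp [quad])
      (Polynomial.funext fun u => by simp [quad]; ring)
  · exact vf_eq_field (by simp)
      (Polynomial.funext fun u => by simp [quad]; field_simp; ring) (by simp [quad])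

theorem basis3c_eq (i : Fin 3) : basis3c I J i = field I J (![(1, 0, 0, 0),
    (0, 1, ![0, -1, 0], 0), (0, 0, ![1, 0, 0], 0)] i) := by
  fin_cases i
  exacts [vf_time, vf_eq_field (by simp) (by simp [quad]) (by simp [quad]),
    vf_eq_field (by simp) (by simp [quad]) (by simp [quad])]

theorem dimTwo_eq {τ φ ψ : ℝ[X]} {s : ℝ} {f g : Fin 3 → ℝ} (hτ : τ = C s * X) (hφ : φ = quad f)
    (hψ : ψ = quad g) (i : Fin 2) : ![vf I J 1 0 0, vf I J τ φ ψ] i =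
      field I J (![(1, 0, 0, 0), (0, s, f, g)] i) := by
  fin_cases i
  exacts [vf_time, vf_eq_field (by simp [hτ]) hφ hψ]

theorem K5_ne_zero : K5 ≠ 0 := fun h => by simpa [K5] using congrFun (congrFun h 0) 0

theorem K4a_ne_zero (l : ℝ) : K4a l ≠ 0 := fun h => by
  simpa [K4a] using congrFun (congrFun h 0) 0

theorem K4b_ne_zero : K4b ≠ 0 := fun h => by simpa [K4b] using congrFun (congrFun h 0) 2

theorem K3a_ne_zero (γ : ℝ) : K3a γ ≠ 0 := fun h => by
  simpa [K3a] using congrFun (congrFun h 0) 0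

theorem K3b_ne_zero (μ : ℝ) : K3b μ ≠ 0 := fun h => by
  simpa [K3b] using congrFun (congrFun h 0) 0

theorem K3c_ne_zero : K3c ≠ 0 := fun h => by simpa [K3c] using congrFun (congrFun h 0) 1

theorem DimTwo.ne_zero {K : Matrix (Fin 3) (Fin 3) ℝ} {τ φ ψ : ℝ[X]} (h : DimTwo K τ φ ψ) :
    K ≠ 0 := by
  rintro h0
  have h1 := congrFun (congrFun h0 0) 0
  have h2 := congrFun (congrFun h0 0) 1
  cases h <;> simp at h1 h2

theorem span_basis5 :
    Submodule.span ℝ {basis5 I J 0, basis5 I J 3, basis5 I J 4} =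
      (Submodule.span ℝ {((1, 0, 0, 0) : Coef), (0, 0, ![1, 0, 0], 0),
        (0, 0, 0, ![1, 0, 0])}).map (field I J) := by
  rw [basis5_eq, basis5_eq, basis5_eq, Submodule.map_span, image_insert_eq, image_pair]
  rfl

theorem basis5_lie : ⁅basis5 I J 1, basis5 I J 2⁆ = 0 := by
  rw [basis5_eq, basis5_eq, field_lie, ← map_zero (field I J)]
  congr 1
  apply coef_ext <;> simp [coefBracket, brk]

/-- The common eigenvectors are `∂_t` and the sum and the difference of the other two. -/
theorem basis5_actDiagonally (hI : IsConnected (I : Set ℝ)) (hJ : IsConnected (J : Set ℝ)) :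
    ActDiagonally (basis5 I J 1) (basis5 I J 2)
      (Submodule.span ℝ {basis5 I J 0, basis5 I J 3, basis5 I J 4}) := by
  set c : Fin 3 → Coef := ![(1, 0, 0, 0), (0, 0, ![1, 0, 0], ![1, 0, 0]),
    (0, 0, ![1, 0, 0], ![-1, 0, 0])] with hc
  refine ⟨3, fun i => field I J (c i), ?_, ?_, fun i => ⟨?_, ?_⟩⟩
  · refine LinearIndependent.map' ?_ _ (LinearMap.ker_eq_bot.2 (field_injective hI hJ))
    rw [Fintype.linearIndependent_iff]
    intro a ha
    have h1 := congrArg (fun w : Coef => w.1) ha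
    have h3 := congrArg (fun w : Coef => w.2.2.1 0) ha
    have h4 := congrArg (fun w : Coef => w.2.2.2 0) ha
    simp [Fin.sum_univ_succ, hc] at h1 h3 h4
    intro i; fin_cases i
    · exact h1
    · simp only [Fin.mk_one]; linarith
    · simp only [Fin.reduceFinMk]; linarith
  · rw [span_basis5, show (fun i => field I J (c i)) = field I J ∘ c from rfl, range_comp,
      Submodule.span_image]
    congr 1
    ext w
    rw [Submodule.mem_span_range_iff_exists_fun, Submodule.mem_span_triple]
    constructor
    · rintro ⟨a, rfl⟩
      refine ⟨a 0, a 1 + a 2, a 1 - a 2, ?_⟩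
      apply coef_ext <;> simp [Fin.sum_univ_succ, hc] ; ring
    · rintro ⟨a, f, g, rfl⟩
      refine ⟨![a, (f + g) / 2, (f - g) / 2], ?_⟩
      apply coef_ext <;> simp [Fin.sum_univ_succ, hc] <;> ring
  · refine ⟨![-2, -1, -1] i, ?_⟩
    rw [basis5_eq, field_lie, ← map_smul]
    congr 1
    fin_cases i <;> apply coef_ext <;> simp [coefBracket, brk, hc]
  · refine ⟨![0, 1, -1] i, ?_⟩
    rw [basis5_eq, field_lie, ← map_smul]
    congr 1
    fin_cases i <;> apply coef_ext <;> simp [coefBracket, brk, hc]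

end EYdKN

end

theorem mainTheorem1 (I J : TopologicalSpace.Opens ℝ)
    (hI : IsConnected (I : Set ℝ)) (hJ : IsConnected (J : Set ℝ)) :
    -- the symmetries form a Lie algebra of dimension between 1 and 5, and dimension at least 4
    -- occurs only in the integrable case
    (∀ K : Matrix (Fin 3) (Fin 3) ℝ, K ≠ 0 →
      (∀ V : EYdKN.PointField I J, V ∈ EYdKN.symmetryAlgebra I J K ↔ EYdKN.IsSymmetry K V) ∧
      Module.Finite ℝ (EYdKN.symmetryAlgebra I J K) ∧
      1 ≤ Module.finrank ℝ (EYdKN.symmetryAlgebra I J K) ∧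
      Module.finrank ℝ (EYdKN.symmetryAlgebra I J K) ≤ 5 ∧
      (4 ≤ Module.finrank ℝ (EYdKN.symmetryAlgebra I J K) → EYdKN.IsYdKN K)) ∧
    -- up to allowed transformations the list is complete
    (∀ K : Matrix (Fin 3) (Fin 3) ℝ, K ≠ 0 →
      (Module.finrank ℝ (EYdKN.symmetryAlgebra I J K) = 5 ↔ EYdKN.Equivalent K EYdKN.K5) ∧
      (Module.finrank ℝ (EYdKN.symmetryAlgebra I J K) = 4 ↔
        (∃ l : ℝ, (l = 1 ∨ l = -1) ∧ EYdKN.Equivalent K (EYdKN.K4a l)) ∨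
        EYdKN.Equivalent K EYdKN.K4b) ∧
      (Module.finrank ℝ (EYdKN.symmetryAlgebra I J K) = 3 ↔
        (∃ γ : ℝ, (γ = 1 ∨ γ = -1) ∧ EYdKN.Equivalent K (EYdKN.K3a γ)) ∨
        (∃ μ : ℝ, μ ≠ 0 ∧ EYdKN.Equivalent K (EYdKN.K3b μ)) ∨
        EYdKN.Equivalent K EYdKN.K3c) ∧
      (Module.finrank ℝ (EYdKN.symmetryAlgebra I J K) = 2 ↔
        ∃ K' τ φ ψ, EYdKN.DimTwo K' τ φ ψ ∧ EYdKN.Equivalent K K')) ∧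
    -- dimension 5
    (EYdKN.IsBasisOf (EYdKN.basis5 I J) (EYdKN.symmetryAlgebra I J EYdKN.K5) ∧
      EYdKN.IsSolvableWithAbelianNilradical (EYdKN.symmetryAlgebra I J EYdKN.K5)
        (Submodule.span ℝ
          {EYdKN.basis5 I J 0, EYdKN.basis5 I J 3, EYdKN.basis5 I J 4}) ∧
      ⁅EYdKN.basis5 I J 1, EYdKN.basis5 I J 2⁆ = 0 ∧
      EYdKN.ActDiagonally (EYdKN.basis5 I J 1) (EYdKN.basis5 I J 2)
        (Submodule.span ℝ
          {EYdKN.basis5 I J 0, EYdKN.basis5 I J 3, EYdKN.basis5 I J 4})) ∧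
    -- dimension 4
    (∀ l : ℝ, (l = 1 ∨ l = -1) →
      EYdKN.IsBasisOf (EYdKN.basis4a I J l) (EYdKN.symmetryAlgebra I J (EYdKN.K4a l)) ∧
      EYdKN.IsGL2 (EYdKN.symmetryAlgebra I J (EYdKN.K4a l))) ∧
    (EYdKN.IsBasisOf (EYdKN.basis4b I J) (EYdKN.symmetryAlgebra I J EYdKN.K4b) ∧
      EYdKN.IsGL2 (EYdKN.symmetryAlgebra I J EYdKN.K4b)) ∧
    -- dimension 3
    (∀ γ : ℝ, (γ = 1 ∨ γ = -1) →
      EYdKN.IsBasisOf (EYdKN.basis3a I J γ) (EYdKN.symmetryAlgebra I J (EYdKN.K3a γ)) ∧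
      IsLieAbelian (EYdKN.symmetryAlgebra I J (EYdKN.K3a γ))) ∧
    (∀ μ : ℝ, μ ≠ 0 →
      EYdKN.IsBasisOf (EYdKN.basis3b I J μ) (EYdKN.symmetryAlgebra I J (EYdKN.K3b μ)) ∧
      EYdKN.IsSolvableWithAbelianNilradical (EYdKN.symmetryAlgebra I J (EYdKN.K3b μ))
        (Submodule.span ℝ {EYdKN.basis3b I J μ 0, EYdKN.basis3b I J μ 1})) ∧
    (EYdKN.IsBasisOf (EYdKN.basis3c I J) (EYdKN.symmetryAlgebra I J EYdKN.K3c) ∧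
      EYdKN.IsSolvableWithAbelianNilradical (EYdKN.symmetryAlgebra I J EYdKN.K3c)
        (Submodule.span ℝ {EYdKN.basis3c I J 0, EYdKN.basis3c I J 2})) ∧
    -- dimension 2
    (∀ K τ φ ψ, EYdKN.DimTwo K τ φ ψ →
      EYdKN.IsBasisOf ![EYdKN.vf I J 1 0 0, EYdKN.vf I J τ φ ψ]
        (EYdKN.symmetryAlgebra I J K)) := by
  refine ⟨fun K hK => ⟨fun V => ?_, EYdKN.finite_symmetryAlgebra hI hJ hK, ?_⟩,
    fun K hK => ?_, ?_, fun l hl => ?_, ?_, fun γ hγ => ?_, fun μ hμ => ?_, ?_,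
    fun K τ φ ψ h => ?_⟩
  · rw [EYdKN.symmetryAlgebra_eq hK hI hJ, EYdKN.mem_solAlgebra_iff hK hI hJ]
  · rw [EYdKN.finrank_symmetryAlgebra hI hJ hK]
    rcases EYdKN.finrank_sol_eq_one_or_listed hK with h | ⟨d, hd⟩
    · rw [h]
      omega
    · rw [hd.finrank_sol]
      have hd25 := hd.mem_Icc
      refine ⟨by omega, by omega, fun h4 => ?_⟩
      obtain rfl | rfl : d = 4 ∨ d = 5 := by omega
      · rcases hd with ⟨l, -, h⟩ | h
        · exact h.isYdKN (by simp [EYdKN.IsYdKN, EYdKN.K4a])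
        · exact h.isYdKN (by simp [EYdKN.IsYdKN, EYdKN.K4b])
      · exact EYdKN.Equivalent.isYdKN hd (by simp [EYdKN.IsYdKN, EYdKN.K5])
  · rw [EYdKN.finrank_symmetryAlgebra hI hJ hK]
    exact ⟨EYdKN.finrank_sol_eq_iff (d := 5) hK (by norm_num),
      EYdKN.finrank_sol_eq_iff (d := 4) hK (by norm_num),
      EYdKN.finrank_sol_eq_iff (d := 3) hK (by norm_num),
      EYdKN.finrank_sol_eq_iff (d := 2) hK (by norm_num)⟩
  · rw [EYdKN.symmetryAlgebra_eq EYdKN.K5_ne_zero hI hJ]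
    refine ⟨EYdKN.isSolBasis_K5.isBasisOf hI hJ EYdKN.basis5_eq, ?_, EYdKN.basis5_lie,
      EYdKN.basis5_actDiagonally hI hJ⟩
    rw [EYdKN.span_basis5]
    exact EYdKN.nilradical_K5 hI hJ
  · have hl0 : l ≠ 0 := by rcases hl with rfl | rfl <;> norm_num
    rw [EYdKN.symmetryAlgebra_eq (EYdKN.K4a_ne_zero l) hI hJ]
    exact ⟨(EYdKN.isSolBasis_K4a hl0).isBasisOf hI hJ (EYdKN.basis4a_eq l),
      EYdKN.isGL2_K4a hI hJ hl⟩
  · rw [EYdKN.symmetryAlgebra_eq EYdKN.K4b_ne_zero hI hJ]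
    exact ⟨EYdKN.isSolBasis_K4b.isBasisOf hI hJ EYdKN.basis4b_eq, EYdKN.isGL2_K4b hI hJ⟩
  · have hγ0 : γ ≠ 0 := by rcases hγ with rfl | rfl <;> norm_num
    rw [EYdKN.symmetryAlgebra_eq (EYdKN.K3a_ne_zero γ) hI hJ]
    exact ⟨(EYdKN.isSolBasis_K3a hγ0).isBasisOf hI hJ (EYdKN.basis3a_eq γ),
      EYdKN.isLieAbelian_K3a hγ0⟩
  · rw [EYdKN.symmetryAlgebra_eq (EYdKN.K3b_ne_zero μ) hI hJ]
    refine ⟨(EYdKN.isSolBasis_K3b hμ).isBasisOf hI hJ (EYdKN.basis3b_eq hμ), ?_⟩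
    rw [EYdKN.basis3b_eq hμ, EYdKN.basis3b_eq hμ, ← Set.image_pair, ← Submodule.map_span]
    exact EYdKN.nilradical_K3b hI hJ hμ
  · rw [EYdKN.symmetryAlgebra_eq EYdKN.K3c_ne_zero hI hJ]
    refine ⟨EYdKN.isSolBasis_K3c.isBasisOf hI hJ EYdKN.basis3c_eq, ?_⟩
    rw [EYdKN.basis3c_eq, EYdKN.basis3c_eq, ← Set.image_pair, ← Submodule.map_span]
    exact EYdKN.nilradical_K3c hI hJ
  · obtain ⟨s, f, g, hτ, hφ, hψ, hb⟩ := h.isSolBasis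
    rw [EYdKN.symmetryAlgebra_eq h.ne_zero hI hJ]
    exact hb.isBasisOf hI hJ (EYdKN.dimTwo_eq hτ hφ hψ)
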